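/- Let $T=\mathbf{R}^2/\mathbf{Z}^2$ with the symplectic form $dx\,dy$, equipped with a translation-invariant complex structure $J$ inducing the standard orientation (for instance the standard one). For an integer $m$ let $L_{(m)}\subset T$ be the image of the line through the origin of slope $-m$, oriented from left to right and equipped with the star $\star_{(m)}=(\varepsilon,-m\varepsilon)$, where $\varepsilon$ is a fixed irrational number. Let $\tau(x,y)=(x,y-x)$ be the Dehn twist, and write $x_{m,\kappa}=(\kappa,0)\in L_{(0)}\cap L_{(m)}$ for $\kappa\in\frac1m\mathbf{Z}$; it depends only on $\kappa$ modulo $1$. For $y\in L_{(m_0)}\cap L_{(m_2)}$, $x_1\in L_{(m_0)}\cap L_{(m_1)}$, $x_2\in L_{(m_1)}\cap L_{(m_2)}$ with $m_0<m_1<m_2$, let $\mathcal{M}(y,x_1,x_2)$ be the set of continuous maps $u$ from the closed unit disk to $T$, with three boundary marked points $z_0,z_1,z_2$ in counterclockwise order, such that $u$ is smooth away from the marked points and $J$-holomorphic in the interior, $u$ carries $z_0,z_1,z_2$ to $y,x_1,x_2$, and $u$ carries the counterclockwise arc from $z_i$ to $z_{i+1}$ (where $z_3=z_0$) into $L_{(m_i)}$;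 two such maps are identified if they differ by a biholomorphic reparametrization of the disk. The sign of $u$ is $(-1)^{s}$, where $s$ is the number of stars encountered going around the boundary, plus $\mathrm{mas}(x_1)$ if the boundary of $u$ runs against the orientation of $L_{(m_1)}$, plus $\mathrm{mas}(y)+\mathrm{mas}(x_2)$ if it runs against the orientation of $L_{(m_2)}$; here $\mathrm{mas}$ is the mod $2$ Maslov index (which vanishes for all points in question). Let $\mathrm{CF}(L,L')=\bigoplus_{x\in L\cap L'}\Lambda$ and let $$\mu_2:\mathrm{CF}(L_{(m_1)},L_{(m_2)})\times\mathrm{CF}(L_{(m_0)},L_{(m_1)})\to\mathrm{CF}(L_{(m_0)},L_{(m_2)}),\qquad \mu_2(x_2,x_1)=\sum_{y}y\sum_{u\in\mathcal{M}(y,x_1,x_2)}\pm\, t^{w(u)}$$ be the bilinear triangle product. In the absolute setting $w(u)=\int u^*(dx\,dy)$ and $\Lambda$ is the Novikov ring of series $\sum a_it^{\lambda_i}$ with $a_i\in\mathbf{Z}$, $\lambda_i\in\mathbf{R}$, $\lambda_i\to\infty$. In the setting relative to a point $D\in T$ lying on none of the three circles, $w(u)=\#u^{-1}(D)$ and $\Lambda=\mathbf{Z}[\![t]\!]$.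 Let $m_1,m_2\geq 1$ be integers, $\kappa_1\in\{0,\frac1{m_1},\dots,\frac{m_1-1}{m_1}\}$, $\kappa_2\in\{0,\frac1{m_2},\dots,\frac{m_2-1}{m_2}\}$. Put $$E(u,v)=\frac{m_1u+m_2v}{m_1+m_2},\qquad \phi(s)=\lfloor s\rfloor s-\tfrac12\lfloor s\rfloor\lfloor s+1\rfloor,\qquad \lambda(u,v)=m_1\phi(u)+m_2\phi(v)-(m_1+m_2)\phi(E(u,v)).$$ For all $\ell\in\mathbf{Z}$ one has $E(\kappa_1,\kappa_2+\ell)\in\frac1{m_1+m_2}\mathbf{Z}$, and $\lambda(\kappa_1,\kappa_2+\ell)$ is a nonnegative integer. **Theorem.** Consider $\mu_2:\mathrm{CF}(L_{(m_1)},L_{(m_1+m_2)})\times\mathrm{CF}(L_{(0)},L_{(m_1)})\to\mathrm{CF}(L_{(0)},L_{(m_1+m_2)})$. Every triangle contributing to $\mu_2(\tau^{m_1}x_{m_2,\kappa_2},x_{m_1,\kappa_1})$ has sign $+1$. In the absolute setting $$\mu_2(\tau^{m_1}x_{m_2,\kappa_2},x_{m_1,\kappa_1})=\sum_{\ell\in\mathbf{Z}}x_{m_1+m_2,E(\kappa_1,\kappa_2+\ell)}\,t^{(\ell+\kappa_2-\kappa_1)^2/(2(\frac1{m_1}+\frac1{m_2}))}.$$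 In the setting relative to $D$, for all $D$ in the open first quadrant sufficiently close to $(0,0)$ (such $D$ lie on none of the three circles), $$\mu_2(\tau^{m_1}x_{m_2,\kappa_2},x_{m_1,\kappa_1})=\sum_{\ell\in\mathbf{Z}}x_{m_1+m_2,E(\kappa_1,\kappa_2+\ell)}\,t^{\lambda(\kappa_1,\kappa_2+\ell)}.$$ All sums over triangles and over $\ell$ converge, in the topology of $\Lambda$ in which two series are close when they agree in all exponents below a large bound. -/

import Mathlib

open scoped PowerSeries.WithPiTopology

noncomputable section

namespace TorusFloer

/-! ### The torus, the special Lagrangian circles and the Dehn twist -/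

/-- The torus `T = ℝ² / ℤ²`. -/
abbrev Torus : Type := UnitAddCircle × UnitAddCircle

/-- The covering map `ℝ² → T`. -/
def pt (p : ℝ × ℝ) : Torus := ((p.1 : UnitAddCircle), (p.2 : UnitAddCircle))

/-- `Lag m` is the image in `T` of the line through the origin of slope `-m`. -/
def Lag (m : ℤ) : Set Torus := Set.range fun x : ℝ => pt (x, -(m : ℝ) * x)

/-- The direction of the left-to-right orientation of `Lag m`. -/
def dir (m : ℤ) : ℝ × ℝ := (1, -(m : ℝ))

/-- The Dehn twist `τ (x, y) = (x, y - x)`. -/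
def dehn (p : Torus) : Torus := (p.1, p.2 - p.1)

/-- The point `(κ, 0)` of `T`; it depends on `κ` modulo `1` only. -/
def xPt (κ : ℝ) : Torus := pt (κ, 0)

/-- The star `(ε, -m ε)` on `Lag m`. -/
def star (ε : ℝ) (m : ℤ) : Torus := pt (ε, -(m : ℝ) * ε)

theorem pt_eq_of_int {p q : ℝ × ℝ} (h₁ : p.1 = q.1) (h₂ : ∃ n : ℤ, p.2 = q.2 + n) :
    pt p = pt q := by
  obtain ⟨n, hn⟩ := h₂
  unfold pt
  rw [h₁, hn]
  congr 1
  rw [AddCircle.coe_add]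
  have : ((n : ℝ) : UnitAddCircle) = 0 := by
    rw [AddCircle.coe_eq_zero_iff]
    exact ⟨n, by simp⟩
  rw [this, add_zero]

theorem xPt_mem_zero (κ : ℝ) : xPt κ ∈ Lag 0 := ⟨κ, by simp [xPt]⟩

theorem xPt_mem (m : ℤ) (κ : ℝ) (h : ∃ k : ℤ, (m : ℝ) * κ = k) :
    xPt κ ∈ Lag 0 ∩ Lag m := by
  refine ⟨xPt_mem_zero κ, κ, ?_⟩
  obtain ⟨k, hk⟩ := h
  exact pt_eq_of_int rfl ⟨-k, by simp [hk]⟩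

theorem dehn_mem {m : ℤ} {p : Torus} (h : p ∈ Lag m) : dehn p ∈ Lag (m + 1) := by
  obtain ⟨x, rfl⟩ := h
  refine ⟨x, ?_⟩
  simp only [pt, dehn, Prod.mk.injEq, true_and]
  rw [← AddCircle.coe_sub]
  congr 1
  push_cast
  ring

theorem dehn_iterate_mem (n : ℕ) {m : ℤ} {p : Torus} (h : p ∈ Lag m) :
    dehn^[n] p ∈ Lag (n + m) := by
  induction n with
  | zero => simpa using h
  | succ n ih =>
    rw [Function.iterate_succ_apply']
    have := dehn_mem ih
    rwa [show ((n + 1 : ℕ) : ℤ) + m = n + m + 1 by push_cast; ring]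

theorem mul_div_self_int (m : ℕ) (k : ℤ) : ∃ j : ℤ, ((m : ℤ) : ℝ) * ((k : ℝ) / (m : ℝ)) = j := by
  rcases Nat.eq_zero_or_pos m with rfl | hm
  · exact ⟨0, by simp⟩
  · refine ⟨k, ?_⟩
    have : (m : ℝ) ≠ 0 := by positivity
    push_cast
    field_simp

/-- The intersection point `x_{m, k/m} = (k/m, 0)` of `Lag 0` and `Lag m`. -/
def xGen (m : ℕ) (k : ℤ) : ↥(Lag 0 ∩ Lag m) :=
  ⟨xPt ((k : ℝ) / (m : ℝ)), xPt_mem m _ (mul_div_self_int m k)⟩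

/-- The intersection point `τ^{m₁} x_{m₂, k/m₂}` of `Lag m₁` and `Lag (m₁ + m₂)`. -/
def twistedGen (m₁ m₂ : ℕ) (k : ℤ) : ↥(Lag m₁ ∩ Lag ((m₁ : ℤ) + m₂)) :=
  ⟨dehn^[m₁] (xGen m₂ k : Torus), by
    have h := dehn_iterate_mem m₁ (xGen m₂ k).2.1
    simpa using h, dehn_iterate_mem m₁ (xGen m₂ k).2.2⟩

/-! ### Holomorphic triangles -/

/-- A translation-invariant complex structure on `T`, i.e. a complex structure on the vector
space `ℝ²`, inducing the standard orientation (equivalently, tamed by `dx dy`). -/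
structure CxStructure where
  J : (ℝ × ℝ) →L[ℝ] (ℝ × ℝ)
  sq : ∀ v, J (J v) = -v
  pos : ∀ v : ℝ × ℝ, v ≠ 0 → 0 < v.1 * (J v).2 - v.2 * (J v).1

/-- The closed unit disk. -/
abbrev Disk : Type := ↥(Metric.closedBall (0 : ℂ) 1)

/-- The inclusion of the boundary of the disk. -/
def bdry (w : Circle) : Disk := ⟨w, by rw [mem_closedBall_zero_iff, Circle.norm_coe]⟩

/-- The closed arc of the unit circle that runs counterclockwise from `a` to `b`. -/
def ccwArc (a b : Circle) : Set Circle :=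
  {w | ∃ α β θ : ℝ, Circle.exp α = a ∧ Circle.exp β = b ∧ Circle.exp θ = w ∧
    α ≤ θ ∧ θ ≤ β ∧ β < α + 2 * Real.pi}

/-- `U` is a lift of `u : D → T` to `ℝ²` which is continuous on the disk, smooth on the disk away
from the points `z i`, and whose differential at each interior point is complex linear.
As the disk is simply connected, a continuous `u` always has a continuous lift, unique
up to translation by `ℤ²`. -/
structure IsHolLift (𝒥 : CxStructure) (z : Fin 3 → Circle) (u : C(Disk, Torus))
    (U : ℂ → ℝ × ℝ) : Prop where
  lift : ∀ w : Disk, pt (U w) = u w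
  cont : ContinuousOn U (Metric.closedBall 0 1)
  smooth : ContDiffOn ℝ ((⊤ : ℕ∞) : WithTop ℕ∞) U
    (Metric.closedBall 0 1 \ Set.range fun i => (z i : ℂ))
  hol : ∀ w ∈ Metric.ball (0 : ℂ) 1, ∀ h : ℂ,
    fderiv ℝ U w (Complex.I * h) = 𝒥.J (fderiv ℝ U w h)

/-- Parametrized holomorphic triangles `(z, u)` with vertices `x 0, x 1, x 2`: the three marked
points `z i` of the boundary circle are in counterclockwise order, `z i` goes to `x i`, and the
counterclockwise arc from `z i` to `z (i + 1)` (indices modulo `3`) goes into `L i`. -/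
structure HolTriangle (𝒥 : CxStructure) (L : Fin 3 → Set Torus) (x : Fin 3 → Torus) where
  z : Fin 3 → Circle
  u : C(Disk, Torus)
  inj : Function.Injective z
  ccw : ∀ i k, z k ∈ ccwArc (z i) (z (i + 1)) → k = i ∨ k = i + 1
  vertex : ∀ i, u (bdry (z i)) = x i
  edge : ∀ i, ∀ w ∈ ccwArc (z i) (z (i + 1)), u (bdry w) ∈ L i
  hol : ∃ U : ℂ → ℝ × ℝ, IsHolLift 𝒥 z u U

/-- A map of the closed disk is holomorphic on the open disk. -/
def HolInside (g : Disk → Disk) : Prop :=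
  ∃ G : ℂ → ℂ, DifferentiableOn ℂ G (Metric.ball 0 1) ∧
    ∀ w : Disk, ‖(w : ℂ)‖ < 1 → (g w : ℂ) = G w

/-- Biholomorphisms of the open disk, extended to homeomorphisms of the closed disk. -/
structure IsBihol (g : Disk ≃ₜ Disk) : Prop where
  interior : ∀ w : Disk, ‖(g w : ℂ)‖ < 1 ↔ ‖(w : ℂ)‖ < 1
  hol : HolInside g
  hol_symm : HolInside g.symm

theorem HolInside.comp {g f : Disk → Disk} (hg : HolInside g) (hf : HolInside f)
    (hfi : ∀ w : Disk, ‖(w : ℂ)‖ < 1 → ‖(f w : ℂ)‖ < 1) : HolInside (g ∘ f) := by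
  obtain ⟨G, hG, hgG⟩ := hg
  obtain ⟨F, hF, hfF⟩ := hf
  refine ⟨G ∘ F, hG.comp hF ?_, ?_⟩
  · intro w hw
    have hw' : ‖w‖ < 1 := by simpa using hw
    have := hfi ⟨w, by simpa using hw'.le⟩ hw'
    rw [hfF ⟨w, by simpa using hw'.le⟩ hw'] at this
    simpa using this
  · intro w hw
    simp only [Function.comp_apply]
    rw [hgG _ (hfi w hw), hfF w hw]

theorem IsBihol.refl : IsBihol (Homeomorph.refl Disk) :=
  ⟨fun _ => Iff.rfl, ⟨id, differentiableOn_id, fun _ _ => rfl⟩,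
    ⟨id, differentiableOn_id, fun _ _ => rfl⟩⟩

theorem IsBihol.symm {g : Disk ≃ₜ Disk} (h : IsBihol g) : IsBihol g.symm :=
  ⟨fun w => by have := h.interior (g.symm w); simpa using this.symm, h.hol_symm, h.hol⟩

theorem IsBihol.trans {f g : Disk ≃ₜ Disk} (hf : IsBihol f) (hg : IsBihol g) :
    IsBihol (f.trans g) :=
  ⟨fun w => (hg.interior (f w)).trans (hf.interior w),
    hg.hol.comp hf.hol fun w hw => (hf.interior w).2 hw,
    hf.hol_symm.comp hg.hol_symm fun w hw => (hg.symm.interior w).2 hw⟩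

/-- Two triangles are equivalent if they differ by a reparametrization of the disk. -/
def triangleSetoid (𝒥 : CxStructure) (L : Fin 3 → Set Torus) (x : Fin 3 → Torus) :
    Setoid (HolTriangle 𝒥 L x) where
  r s t := ∃ g : Disk ≃ₜ Disk, IsBihol g ∧ (∀ i, g (bdry (s.z i)) = bdry (t.z i)) ∧
    ∀ w, s.u w = t.u (g w)
  iseqv :=
    { refl := fun _ => ⟨Homeomorph.refl _, IsBihol.refl, fun _ => rfl, fun _ => rfl⟩
      symm := by
        rintro s t ⟨g, hg, hz, hu⟩
        exact ⟨g.symm, hg.symm, fun i => by rw [← hz i]; simp, fun w => by rw [hu]; simp⟩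
      trans := by
        rintro s t r ⟨g, hg, hz, hu⟩ ⟨f, hf, hz', hu'⟩
        exact ⟨g.trans f, hg.trans hf, fun i => by simp [hz, hz'],
          fun w => by simp [hu, hu']⟩ }

/-- The moduli space `ℳ(x₀, x₁, x₂)` of holomorphic triangles modulo reparametrization. -/
def Moduli (𝒥 : CxStructure) (L : Fin 3 → Set Torus) (x : Fin 3 → Torus) : Type :=
  Quotient (triangleSetoid 𝒥 L x)

/-- A triangle representing a class of the moduli space. -/
def Moduli.rep {𝒥 : CxStructure} {L : Fin 3 → Set Torus} {x : Fin 3 → Torus}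
    (c : Moduli 𝒥 L x) : HolTriangle 𝒥 L x := Quotient.out c

namespace HolTriangle

variable {𝒥 : CxStructure} {L : Fin 3 → Set Torus} {x : Fin 3 → Torus}

/-- A lift of the triangle to `ℝ²` (well defined on the disk up to translation by `ℤ²`). -/
def lift (s : HolTriangle 𝒥 L x) : ℂ → ℝ × ℝ := Classical.choose s.hol

/-- The area `∫_D u^*(dx dy)`. -/
def area (s : HolTriangle 𝒥 L x) : ℝ :=
  ∫ w in Metric.ball (0 : ℂ) 1,
    ((fderiv ℝ s.lift w 1).1 * (fderiv ℝ s.lift w Complex.I).2 -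
      (fderiv ℝ s.lift w 1).2 * (fderiv ℝ s.lift w Complex.I).1)

/-- The number of preimages of the point `D`. -/
def mult (s : HolTriangle 𝒥 L x) (D : Torus) : ℕ := Set.ncard {w : Disk | s.u w = D}

/-- The number of stars that one meets going around the boundary of the triangle. -/
def numStars (s : HolTriangle 𝒥 L x) (st : Fin 3 → Torus) : ℕ :=
  Set.ncard {w : Circle | ∃ i, s.u (bdry w) = st i}

open Classical in
/-- This is `1` if the `i`th edge of the triangle, run through counterclockwise, goes from right
to left, against the orientation of a circle of finite slope, and `0` otherwise. -/
def reversed (s : HolTriangle 𝒥 L x) (i : Fin 3) : ℕ :=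
  if (s.lift (s.z (i + 1))).1 < (s.lift (s.z i)).1 then 1 else 0

end HolTriangle

open Classical in
/-- The Maslov index modulo `2` of a transverse intersection point of two oriented curves with
tangent directions `v` and `w`. -/
def mas (v w : ℝ × ℝ) : ℕ := if v.1 * w.2 - v.2 * w.1 < 0 then 0 else 1

/-- The triple `(Lag m₀, Lag m₁, Lag m₂)`. -/
def lags (m₀ m₁ m₂ : ℤ) : Fin 3 → Set Torus := ![Lag m₀, Lag m₁, Lag m₂]

/-- Parametrized holomorphic triangles with edges on `Lag m₀`, `Lag m₁`, `Lag m₂`. -/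
abbrev Triangle (𝒥 : CxStructure) (m₀ m₁ m₂ : ℤ) (x : Fin 3 → Torus) : Type :=
  HolTriangle 𝒥 (lags m₀ m₁ m₂) x

/-- The sign of a triangle with edges on `Lag m₀`, `Lag m₁`, `Lag m₂`, oriented from left
to right: the parity of the number of stars, corrected by Maslov indices of vertices when the
boundary runs against the orientation of `Lag m₁` or `Lag m₂`. -/
def triSign {𝒥 : CxStructure} (m₀ m₁ m₂ : ℤ) {x : Fin 3 → Torus} (ε : ℝ)
    (s : Triangle 𝒥 m₀ m₁ m₂ x) : ℤ :=
  (-1) ^ (s.numStars ![star ε m₀, star ε m₁, star ε m₂] +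
    s.reversed 1 * mas (dir m₀) (dir m₁) +
    s.reversed 2 * (mas (dir m₀) (dir m₂) + mas (dir m₁) (dir m₂)))

/-! ### Novikov ring -/

/-- The Novikov ring of series `∑ aᵢ t^{λᵢ}` with `aᵢ ∈ ℤ`, `λᵢ ∈ ℝ`, `λᵢ → ∞`: those Hahn series
that have only finitely many exponents below any bound. -/
def Novikov : Subring (HahnSeries ℝ ℤ) where
  carrier := {f | ∀ c : ℝ, (f.support ∩ Set.Iic c).Finite}
  mul_mem' := by
    intro f g hf hg c
    have bdd : ∀ f : HahnSeries ℝ ℤ, (∀ c : ℝ, (f.support ∩ Set.Iic c).Finite) →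
        ∃ b : ℝ, ∀ a ∈ f.support, b ≤ a := by
      intro f hf
      obtain ⟨b, hb⟩ := (hf 0).bddBelow
      refine ⟨min b 0, fun a ha => ?_⟩
      rcases le_total a 0 with h | h
      · exact (min_le_left _ _).trans (hb ⟨ha, h⟩)
      · exact (min_le_right _ _).trans h
    obtain ⟨b₁, h₁⟩ := bdd f hf
    obtain ⟨b₂, h₂⟩ := bdd g hg
    refine ((hf (c - b₂)).image2 (fun a b => a + b) (hg (c - b₁))).subset ?_
    rintro a ⟨ha, hac⟩
    obtain ⟨p, hp, q, hq, rfl⟩ := HahnSeries.support_mul_subset ha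
    have e₁ := h₁ p hp
    have e₂ := h₂ q hq
    simp only [Set.mem_Iic] at hac
    exact ⟨p, ⟨hp, by simp only [Set.mem_Iic]; linarith⟩, q,
      ⟨hq, by simp only [Set.mem_Iic]; linarith⟩, rfl⟩
  one_mem' := fun c => (Set.finite_singleton (0 : ℝ)).subset fun a ha => by
    simpa using HahnSeries.support_single_subset ha.1
  add_mem' := by
    intro f g hf hg c
    refine ((hf c).union (hg c)).subset ?_
    rintro a ⟨ha, hac⟩
    rcases HahnSeries.support_add_subset f g ha with h | h
    · exact Or.inl ⟨h, hac⟩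
    · exact Or.inr ⟨h, hac⟩
  zero_mem' := by intro c; simp
  neg_mem' := by
    intro f hf c
    simpa using hf c

/-- The element `t^a` of the Novikov ring. -/
def tpow (a : ℝ) : Novikov :=
  ⟨HahnSeries.single a 1, fun _ => (Set.finite_singleton a).subset fun _ hb =>
    HahnSeries.support_single_subset hb.1⟩

/-- The topology of the Novikov ring in which two series are close if they agree in all
exponents below a large bound. -/
instance : TopologicalSpace Novikov :=
  ⨅ c : ℝ, TopologicalSpace.induced
    (fun (f : Novikov) (a : Set.Iio c) => (f : HahnSeries ℝ ℤ).coeff a) ⊥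

/-! ### Floer cochains and the triangle product -/

/-- `CF(Lag m, Lag m')`, the free module on the (finite, when `m ≠ m'`) set of intersection
points. -/
abbrev CF (Λ : Type) (m m' : ℤ) : Type := ↥(Lag m ∩ Lag m') → Λ

open Classical in
/-- The element `p · a` of the Floer cochains. -/
def gen {Λ : Type} [Zero Λ] {m m' : ℤ} (p : ↥(Lag m ∩ Lag m')) (a : Λ) : CF Λ m m' :=
  Pi.single p a

section Product

variable {Λ : Type} [CommRing Λ] [TopologicalSpace Λ] (𝒥 : CxStructure) (ε : ℝ) (m₀ m₁ m₂ : ℤ)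
  (wt : ∀ x : Fin 3 → Torus, Triangle 𝒥 m₀ m₁ m₂ x → Λ)

/-- The summand `± wt(u)` of a class of triangles `u`. -/
def term (x : Fin 3 → Torus) (c : Moduli 𝒥 (lags m₀ m₁ m₂) x) : Λ :=
  triSign m₀ m₁ m₂ ε c.rep • wt x c.rep

/-- The triangle product `CF(Lag m₁, Lag m₂) × CF(Lag m₀, Lag m₁) → CF(Lag m₀, Lag m₂)`, for
`m₀ < m₁ < m₂`, that counts a triangle `u` with weight `wt u`: the bilinear map with
`(x₂, x₁) ↦ ∑_y y ∑_{u ∈ ℳ(y, x₁, x₂)} ± wt(u)`.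
For these slopes all Maslov gradings vanish and every triangle is rigid. -/
def mu2 (f₂ : CF Λ m₁ m₂) (f₁ : CF Λ m₀ m₁) : CF Λ m₀ m₂ := fun y =>
  ∑ᶠ x₂ : ↥(Lag m₁ ∩ Lag m₂), ∑ᶠ x₁ : ↥(Lag m₀ ∩ Lag m₁),
    f₂ x₂ * f₁ x₁ * ∑' c : Moduli 𝒥 (lags m₀ m₁ m₂) ![y, x₁, x₂], term 𝒥 ε m₀ m₁ m₂ wt _ c

end Product

/-- The weight `t^{area(u)}` of the absolute setting. -/
def absWeight (𝒥 : CxStructure) (m₀ m₁ m₂ : ℤ) (x : Fin 3 → Torus)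
    (s : Triangle 𝒥 m₀ m₁ m₂ x) : Novikov := tpow s.area

/-- The weight `t^{#u⁻¹(D)}` of the setting relative to the point `D`. -/
def relWeight (𝒥 : CxStructure) (D : Torus) (m₀ m₁ m₂ : ℤ) (x : Fin 3 → Torus)
    (s : Triangle 𝒥 m₀ m₁ m₂ x) : PowerSeries ℤ := PowerSeries.X ^ s.mult D

/-! ### The functions `E`, `φ`, `λ` -/

/-- `E(u, v) = (m₁ u + m₂ v) / (m₁ + m₂)`. -/
def Efun (m₁ m₂ : ℕ) (u v : ℝ) : ℝ := (m₁ * u + m₂ * v) / (m₁ + m₂)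

/-- `φ(s) = ⌊s⌋ s - ⌊s⌋ ⌊s + 1⌋ / 2`. -/
def phi (s : ℝ) : ℝ := ⌊s⌋ * s - 1 / 2 * ⌊s⌋ * ⌊s + 1⌋

/-- `λ(u, v) = m₁ φ(u) + m₂ φ(v) - (m₁ + m₂) φ(E(u, v))`. -/
def lam (m₁ m₂ : ℕ) (u v : ℝ) : ℝ :=
  m₁ * phi u + m₂ * phi v - (m₁ + m₂) * phi (Efun m₁ m₂ u v)

end TorusFloer

end

/-! A triangle is studied through its lift to the plane. On a boundary arc that goes to `Lag m` the
function y + m x of the lift is integral, hence constant, so each arc lies on a single line of slope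
0, -m₁ or -(m₁ + m₂). Once the lift is normalized to have its second vertex at (κ₁, 0), the only
datum left is the abscissa κ₂ + ℓ of the third vertex; the first vertex is then forced to be (E(κ₁,
κ₂ + ℓ), 0). A real linear isomorphism carrying J to multiplication by i makes the lift an ordinary
holomorphic map of the disk with boundary on three lines. So everything rests on a Riemann mapping
statement for Euclidean triangles: for each ℓ there is exactly one triangle up to reparametrization,
and the moduli space with output y is the set of those ℓ for which (E(κ₁, κ₂ + ℓ), 0) represents y
(`exists_index`).

Existence comes from the Schwarz-Christoffel integral (`exists_isTriangleMap`), which is continuous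
on the closed disk and smooth away from the corners. Such a map restricts to a covering of the open
triangle by the disk, hence is bijective (`IsTriangleMap.bijOn_ball`) with a conformal inverse K.
For uniqueness, any holomorphic disk F on the three lines stays inside the triangle by the open
mapping theorem (`mapsTo_openTri`). Then K ∘ F is a self-map of the disk preserving three boundary
arcs, and a maximum principle for arguments shows that it is the identity (`eqOn_id_of_arcs`). If
the three lines are concurrent, only constant maps occur.

The three numerical assertions follow from this description. Sign: along the boundary the abscissa
runs monotonically from u = κ₁ to v = κ₂ + ℓ and back, so it meets ε + ℤ, and hence the stars, an
even number of times; the Maslov indices vanish. Area: the lift is injective with nonnegative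
Jacobian, so its area is that of the Euclidean triangle, m₁m₂(u - v)²/(2(m₁ + m₂)). Multiplicity:
preimages of D correspond to lattice translates of a lift of D inside the triangle. Counting them
column by column gives three sums of positive parts, each of which is φ up to affine terms; these
cancel because E is the weighted mean of u and v, leaving λ (`ncard_triPts`). Since φ interpolates
s(s - 1)/2, λ grows quadratically in ℓ, which gives convergence. -/

noncomputable section
namespace TorusFloer

open Complex Set Filter Topology MeasureTheory Metric

/-! ### Points of the circle, the factors 1 - w/e^{iθ} and the Schwarz-Christoffel integrand -/

/-- The point `e^{iθ}` of the unit circle. -/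
def cis (θ : ℝ) : ℂ := Complex.exp (θ * I)

/-- The factor `1 - w / e^{iθ}`. -/
def lfac (θ : ℝ) (w : ℂ) : ℂ := 1 - w * cis (-θ)

theorem norm_cis (θ : ℝ) : ‖cis θ‖ = 1 := Complex.norm_exp_ofReal_mul_I θ

theorem cis_ne_zero (θ : ℝ) : cis θ ≠ 0 := Complex.exp_ne_zero _

theorem cis_add (θ τ : ℝ) : cis (θ + τ) = cis θ * cis τ := by
  simp only [cis, ← Complex.exp_add]; push_cast; ring_nf

theorem cis_zero : cis 0 = 1 := by simp [cis]

theorem cis_mul_neg (θ : ℝ) : cis θ * cis (-θ) = 1 := by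
  rw [← cis_add, add_neg_cancel, cis_zero]

theorem cis_two_pi : cis (2 * Real.pi) = 1 := by
  rw [cis]; push_cast; exact Complex.exp_two_pi_mul_I

theorem cis_add_two_pi (θ : ℝ) : cis (θ + 2 * Real.pi) = cis θ := by
  rw [cis_add, cis_two_pi, mul_one]

theorem lfac_add_two_pi (θ : ℝ) (w : ℂ) : lfac (θ + 2 * Real.pi) w = lfac θ w := by
  have : cis (-(θ + 2 * Real.pi)) = cis (-θ) := by
    rw [← cis_add_two_pi (-(θ + 2 * Real.pi))]; congr 1; ring
  rw [lfac, this, lfac]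

theorem continuous_cis : Continuous cis := by unfold cis; fun_prop

theorem circle_exp_eq_cis (θ : ℝ) : (Circle.exp θ : ℂ) = cis θ := Circle.coe_exp θ

theorem exists_cis_of_norm {w : ℂ} (hw : ‖w‖ = 1) (a : ℝ) :
    ∃ τ ∈ Ico a (a + 2 * Real.pi), w = cis τ := by
  have h1 : cis w.arg = w := by
    have := Complex.norm_mul_exp_arg_mul_I w
    rwa [hw, ofReal_one, one_mul] at this
  refine ⟨toIcoMod Real.two_pi_pos a w.arg, toIcoMod_mem_Ico _ _ _, ?_⟩
  have : ∀ n : ℤ, cis (w.arg - n • (2 * Real.pi)) = cis w.arg := by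
    intro n
    simp only [cis]
    rw [Complex.exp_eq_exp_iff_exists_int]
    exact ⟨-n, by push_cast; simp; ring⟩
  exact h1.symm.trans (this _).symm

theorem cis_injOn (a : ℝ) : InjOn cis (Ico a (a + 2 * Real.pi)) := by
  intro x hx y hy h
  obtain ⟨n, hn⟩ := Complex.exp_eq_exp_iff_exists_int.1 h
  have h2 : x = y + n * (2 * Real.pi) := by
    have := congrArg Complex.im hn
    simpa using this
  have hp := Real.two_pi_pos
  have h3 : (n : ℝ) * (2 * Real.pi) < 1 * (2 * Real.pi) := by linarith [hx.2, hy.1]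
  have h4 : (-1 : ℝ) * (2 * Real.pi) < n * (2 * Real.pi) := by linarith [hx.1, hy.2]
  have h5 := lt_of_mul_lt_mul_right h3 hp.le
  have h6 := lt_of_mul_lt_mul_right h4 hp.le
  have h7 : n = 0 := by
    have : n < 1 := by exact_mod_cast h5
    have : -1 < n := by exact_mod_cast h6
    omega
  rw [h2, h7]; simp

theorem cis_ne_of_lt {a b : ℝ} (h : a < b) (h' : b < a + 2 * Real.pi) : cis a ≠ cis b := by
  intro he
  have := cis_injOn a ⟨le_rfl, by linarith [Real.two_pi_pos]⟩ ⟨h.le, h'⟩ he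
  linarith

theorem lfac_mul_cis (θ : ℝ) (w : ℂ) : lfac θ w * cis θ = cis θ - w := by
  have := cis_mul_neg θ
  rw [lfac]; linear_combination (-w) * this

theorem norm_lfac (θ : ℝ) (w : ℂ) : ‖lfac θ w‖ = ‖cis θ - w‖ := by
  rw [← lfac_mul_cis, norm_mul, norm_cis, mul_one]

theorem norm_lfac_le {w : ℂ} (hw : ‖w‖ ≤ 1) (θ : ℝ) : ‖lfac θ w‖ ≤ 2 := by
  rw [norm_lfac]
  refine (norm_sub_le _ _).trans ?_
  rw [norm_cis]; linarith

theorem lfac_eq_zero_iff {θ : ℝ} {w : ℂ} : lfac θ w = 0 ↔ w = cis θ := by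
  rw [← norm_eq_zero, norm_lfac, norm_eq_zero, sub_eq_zero, eq_comm]

theorem lfac_re_nonneg {w : ℂ} (hw : ‖w‖ ≤ 1) (θ : ℝ) : 0 ≤ (lfac θ w).re := by
  have : (w * cis (-θ)).re ≤ 1 := by
    refine (Complex.re_le_norm _).trans ?_
    rwa [norm_mul, norm_cis, mul_one]
  rw [lfac, sub_re, one_re]; linarith

/-- A number of modulus at most 1 with real part 1 must equal 1. This is the reason for normalizing
the factors as 1 - w/e^{iθ}: away from the puncture they stay in the right half-plane, so principal
logarithms and powers are holomorphic up to the boundary and no branch has to be chosen. -/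
theorem lfac_re_pos {w : ℂ} (hw : ‖w‖ ≤ 1) {θ : ℝ} (h : w ≠ cis θ) : 0 < (lfac θ w).re := by
  refine lt_of_le_of_ne (lfac_re_nonneg hw θ) fun h0 => h ?_
  have hn : ‖w * cis (-θ)‖ ≤ 1 := by rwa [norm_mul, norm_cis, mul_one]
  have hre : (w * cis (-θ)).re = 1 := by
    rw [lfac, sub_re, one_re] at h0; linarith
  have him : (w * cis (-θ)).im = 0 := by
    have h1 := Complex.sq_norm (w * cis (-θ))
    rw [Complex.normSq_apply, hre] at h1
    have h2 : ‖w * cis (-θ)‖ ^ 2 ≤ 1 := by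
      have := norm_nonneg (w * cis (-θ)); nlinarith
    nlinarith [mul_self_nonneg (w * cis (-θ)).im]
  rw [← lfac_eq_zero_iff, lfac]
  apply Complex.ext <;> simp [hre, him]

theorem continuous_lfac (θ : ℝ) : Continuous (lfac θ) := by unfold lfac; fun_prop

theorem hasDerivAt_lfac (θ : ℝ) (w : ℂ) : HasDerivAt (lfac θ) (-cis (-θ)) w := by
  unfold lfac
  simpa using ((hasDerivAt_id w).mul_const (cis (-θ))).const_sub 1

theorem differentiable_lfac (θ : ℝ) : Differentiable ℂ (lfac θ) := fun w =>
  (hasDerivAt_lfac θ w).differentiableAt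

theorem lfac_mem_slitPlane {w : ℂ} (hw : ‖w‖ ≤ 1) {θ : ℝ} (h : w ≠ cis θ) :
    lfac θ w ∈ slitPlane := Or.inl (lfac_re_pos hw h)

/-- The principal logarithm of `1 - e^{iψ}`. -/
theorem lfac_cis {θ τ : ℝ} (h : θ < τ) (h' : τ < θ + 2 * Real.pi) :
    0 < 2 * Real.sin ((τ - θ) / 2) ∧
    Complex.log (lfac θ (cis τ)) =
      Real.log (2 * Real.sin ((τ - θ) / 2)) + ((τ - θ - Real.pi) / 2 : ℝ) * I := by
  have hs : 0 < 2 * Real.sin ((τ - θ) / 2) := by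
    have := Real.sin_pos_of_pos_of_lt_pi (x := (τ - θ) / 2) (by linarith) (by linarith)
    linarith
  refine ⟨hs, ?_⟩
  -- Half-angle identity 1 - e^{iψ} = 2 sin(ψ/2) e^{i(ψ - π)/2} with ψ = τ - θ. For 0 < ψ < 2π the
  -- angle (ψ - π)/2 lies in (-π/2, π/2), so the exponent is the principal logarithm.
  have key : lfac θ (cis τ) =
      Complex.exp (Real.log (2 * Real.sin ((τ - θ) / 2)) + ((τ - θ - Real.pi) / 2 : ℝ) * I) := by
    rw [Complex.exp_add, ← Complex.ofReal_exp, Real.exp_log hs, lfac, ← cis_add, cis]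
    have e1 : ((τ + -θ : ℝ) : ℂ) * I = (((τ - θ) / 2 : ℝ) : ℂ) * I + (((τ - θ) / 2 : ℝ) : ℂ) * I := by
      push_cast; ring
    have e2 : (((τ - θ - Real.pi) / 2 : ℝ) : ℂ) * I
        = (((τ - θ) / 2 : ℝ) : ℂ) * I + -(Real.pi / 2 * I) := by
      push_cast; ring
    rw [e1, e2, Complex.exp_add, Complex.exp_add (_ * I) (-_), Complex.exp_neg, Complex.exp_pi_div_two_mul_I,
      Complex.exp_mul_I]
    push_cast
    set x : ℂ := (τ - θ) / 2
    have := Complex.sin_sq_add_cos_sq x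
    rw [Complex.inv_I]
    linear_combination (-1 : ℂ) * this + (2 * Complex.sin x ^ 2 - 1 * Complex.sin x ^ 2) * Complex.I_sq
  rw [key, Complex.log_exp]
  · simp; linarith
  · simp; linarith

/-- The closed disk without three boundary points. -/
def pdisk (a b c : ℝ) : Set ℂ := closedBall 0 1 \ {cis a, cis b, cis c}

theorem ball_subset_pdisk (a b c : ℝ) : ball (0 : ℂ) 1 ⊆ pdisk a b c := by
  intro w hw
  refine ⟨ball_subset_closedBall hw, ?_⟩
  have : ‖w‖ < 1 := by simpa using hw
  simp only [mem_insert_iff, mem_singleton_iff]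
  rintro (rfl | rfl | rfl) <;> simp [norm_cis] at this

/-- The disk is strictly convex, so removing boundary points cannot break a segment. Convexity
yields a primitive of the integrand on the whole punctured disk, boundary arcs included, and unique
differentiability there. -/
theorem convex_pdisk (a b c : ℝ) : Convex ℝ (pdisk a b c) := by
  rw [convex_iff_openSegment_subset]
  intro x hx y hy
  by_cases hxy : x = y
  · subst hxy; simpa using hx
  · have := (strictConvex_closedBall ℝ (0 : ℂ) 1).openSegment_subset hx.1 hy.1 hxy
    rw [interior_closedBall _ one_ne_zero] at this
    exact this.trans (ball_subset_pdisk a b c)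

theorem mem_pdisk {a b c : ℝ} {w : ℂ} (h : w ∈ pdisk a b c) :
    ‖w‖ ≤ 1 ∧ w ≠ cis a ∧ w ≠ cis b ∧ w ≠ cis c := by
  obtain ⟨h1, h2⟩ := h
  simp only [mem_insert_iff, mem_singleton_iff, not_or] at h2
  exact ⟨by simpa using h1, h2⟩

theorem uniqueDiffOn_pdisk (a b c : ℝ) : UniqueDiffOn ℝ (pdisk a b c) := by
  refine uniqueDiffOn_convex (convex_pdisk a b c) ⟨0, ?_⟩
  exact interior_maximal (ball_subset_pdisk a b c) isOpen_ball (by simp)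

/-- The Schwarz-Christoffel integrand. -/
def scDeriv (a b c α β γ : ℝ) (w : ℂ) : ℂ :=
  lfac a w ^ ((α - 1 : ℝ) : ℂ) * lfac b w ^ ((β - 1 : ℝ) : ℂ) * lfac c w ^ ((γ - 1 : ℝ) : ℂ)

theorem contDiffOn_scDeriv (a b c α β γ : ℝ) {n : WithTop ℕ∞} :
    ContDiffOn ℂ n (scDeriv a b c α β γ) (pdisk a b c) := by
  have key : ∀ θ x : ℝ, ∀ w : ℂ, ‖w‖ ≤ 1 → w ≠ cis θ →
      ContDiffAt ℂ n (fun w => lfac θ w ^ ((x - 1 : ℝ) : ℂ)) w := by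
    intro θ x w hw h
    exact (((differentiable_lfac θ).analyticAt w).cpow analyticAt_const
      (lfac_mem_slitPlane hw h)).contDiffAt
  intro w hw
  obtain ⟨h1, ha, hb, hc⟩ := mem_pdisk hw
  exact (((key a α w h1 ha).mul (key b β w h1 hb)).mul (key c γ w h1 hc)).contDiffWithinAt

theorem scDeriv_ne_zero {a b c α β γ : ℝ} {w : ℂ} (hw : w ∈ pdisk a b c) :
    scDeriv a b c α β γ w ≠ 0 := by
  obtain ⟨h1, ha, hb, hc⟩ := mem_pdisk hw
  unfold scDeriv
  refine mul_ne_zero (mul_ne_zero ?_ ?_) ?_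
  all_goals
    rw [Complex.cpow_def_of_ne_zero (by rwa [Ne, lfac_eq_zero_iff])]
    exact Complex.exp_ne_zero _

end TorusFloer
end

/-! ### The Schwarz-Christoffel integral and its boundary values -/

noncomputable section
namespace TorusFloer

open Complex Set Filter Topology MeasureTheory Metric

theorem one_sub_le_norm_lfac {w : ℂ} (hw : ‖w‖ ≤ 1) {t : ℝ} (ht : 0 ≤ t) (θ : ℝ) :
    1 - t ≤ ‖lfac θ (t * w)‖ := by
  rw [norm_lfac]
  have h1 := norm_sub_norm_le (cis θ) (t * w)
  rw [norm_cis, norm_mul, Complex.norm_of_nonneg ht] at h1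
  nlinarith

/-- Away from one of the three points all but one of the factors are bounded below. -/
theorem exists_norm_scDeriv_le {a b c : ℝ} (hab : a < b) (hbc : b < c)
    (hca : c < a + 2 * Real.pi) {α β γ : ℝ} (hα : 0 < α) (hβ : 0 < β) (hγ : 0 < γ)
    (hsum : α + β + γ = 1) :
    ∃ M : ℝ, ∀ w : ℂ, ‖w‖ ≤ 1 → ∀ t ∈ Ioo (0 : ℝ) 1, ‖scDeriv a b c α β γ (t * w)‖ ≤
      M * ((1 - t) ^ (α - 1) + (1 - t) ^ (β - 1) + (1 - t) ^ (γ - 1)) := by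
  have d1 : 0 < ‖cis a - cis b‖ := norm_pos_iff.2 (sub_ne_zero.2 (cis_ne_of_lt hab (by linarith)))
  have d2 : 0 < ‖cis b - cis c‖ := norm_pos_iff.2 (sub_ne_zero.2 (cis_ne_of_lt hbc (by linarith)))
  have d3 : 0 < ‖cis a - cis c‖ :=
    norm_pos_iff.2 (sub_ne_zero.2 (cis_ne_of_lt (hab.trans hbc) hca))
  -- With δ half the least distance between the three points, at most one factor is smaller than δ
  -- at any given point. That factor is still at least 1 - t at t w, which leaves a single
  -- integrable singularity along the ray.
  obtain ⟨δ, hδ, e1, e2, e3⟩ : ∃ δ > 0, 2 * δ ≤ ‖cis a - cis b‖ ∧ 2 * δ ≤ ‖cis b - cis c‖ ∧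
      2 * δ ≤ ‖cis a - cis c‖ := by
    refine ⟨min (min ‖cis a - cis b‖ ‖cis b - cis c‖) ‖cis a - cis c‖ / 2, by positivity, ?_⟩
    rw [mul_div_cancel₀ _ two_ne_zero]
    exact ⟨(min_le_left _ _).trans (min_le_left _ _), (min_le_left _ _).trans (min_le_right _ _),
      min_le_right _ _⟩
  have far : ∀ θ τ : ℝ, 2 * δ ≤ ‖cis θ - cis τ‖ → ∀ v : ℂ, δ ≤ ‖lfac θ v‖ ∨ δ ≤ ‖lfac τ v‖ := by
    intro θ τ h v
    rw [norm_lfac, norm_lfac]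
    by_contra! hcon
    have := norm_sub_le (cis θ - v) (cis τ - v)
    rw [sub_sub_sub_cancel_right] at this
    linarith [hcon.1, hcon.2]
  refine ⟨δ ^ (α - 1) * δ ^ (β - 1) + δ ^ (β - 1) * δ ^ (γ - 1) + δ ^ (α - 1) * δ ^ (γ - 1), ?_⟩
  intro w hw t ht
  have ht1 : 0 < 1 - t := by linarith [ht.2]
  have b1 : ∀ θ : ℝ, ∀ x < 1, ‖lfac θ (t * w)‖ ^ (x - 1 : ℝ) ≤ (1 - t) ^ (x - 1) := fun θ x hx =>
    Real.rpow_le_rpow_of_nonpos ht1 (one_sub_le_norm_lfac hw ht.1.le θ) (by linarith)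
  have b2 : ∀ θ : ℝ, ∀ x < 1, δ ≤ ‖lfac θ (t * w)‖ → ‖lfac θ (t * w)‖ ^ (x - 1 : ℝ) ≤ δ ^ (x - 1) :=
    fun θ x hx h => Real.rpow_le_rpow_of_nonpos hδ h (by linarith)
  rw [scDeriv, norm_mul, norm_mul, norm_cpow_real, norm_cpow_real, norm_cpow_real]
  set A := ‖lfac a (t * w)‖ ^ (α - 1)
  set B := ‖lfac b (t * w)‖ ^ (β - 1)
  set C := ‖lfac c (t * w)‖ ^ (γ - 1)
  have hA : 0 ≤ A := by positivity
  have hB : 0 ≤ B := by positivity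
  have hC : 0 ≤ C := by positivity
  have p1 : 0 ≤ (1 - t) ^ (α - 1) := by positivity
  have p2 : 0 ≤ (1 - t) ^ (β - 1) := by positivity
  have p3 : 0 ≤ (1 - t) ^ (γ - 1) := by positivity
  have q1 : 0 ≤ δ ^ (α - 1) := by positivity
  have q2 : 0 ≤ δ ^ (β - 1) := by positivity
  have q3 : 0 ≤ δ ^ (γ - 1) := by positivity
  have r1 := b1 a α (by linarith)
  have r2 := b1 b β (by linarith)
  have r3 := b1 c γ (by linarith)
  set u1 := (1 - t) ^ (α - 1)
  set u2 := (1 - t) ^ (β - 1)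
  set u3 := (1 - t) ^ (γ - 1)
  have s1 := b2 a α (by linarith)
  have s2 := b2 b β (by linarith)
  have s3 := b2 c γ (by linarith)
  set v1 := δ ^ (α - 1)
  set v2 := δ ^ (β - 1)
  set v3 := δ ^ (γ - 1)
  have fin : ∀ X, X ≤ v1 * v2 * u3 ∨ X ≤ v2 * v3 * u1 ∨ X ≤ v1 * v3 * u2 →
      X ≤ (v1 * v2 + v2 * v3 + v1 * v3) * (u1 + u2 + u3) := by
    intro X hX
    have n1 := mul_nonneg q1 q2
    have n2 := mul_nonneg q2 q3
    have n3 := mul_nonneg q1 q3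
    have := mul_nonneg n1 p1; have := mul_nonneg n1 p2; have := mul_nonneg n1 p3
    have := mul_nonneg n2 p1; have := mul_nonneg n2 p2; have := mul_nonneg n2 p3
    have := mul_nonneg n3 p1; have := mul_nonneg n3 p2; have := mul_nonneg n3 p3
    rcases hX with h | h | h <;> linarith
  apply fin
  rcases far a b e1 (t * w) with h1 | h1
  · rcases far b c e2 (t * w) with h2 | h2
    · left
      have := s1 h1; have := s2 h2
      gcongr
    · right; right
      have := s1 h1; have := s3 h2
      calc A * B * C ≤ v1 * u2 * v3 := by gcongr
        _ = _ := by ring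
  · rcases far a c e3 (t * w) with h2 | h2
    · left
      have := s1 h2; have := s2 h1
      gcongr
    · right; left
      have := s2 h1; have := s3 h2
      calc A * B * C ≤ u1 * v2 * v3 := by gcongr
        _ = _ := by ring

theorem integrableOn_one_sub_rpow {x : ℝ} (hx : 0 < x) :
    IntegrableOn (fun t : ℝ => (1 - t) ^ (x - 1)) (Ioo 0 1) := by
  have h : IntervalIntegrable (fun t : ℝ => t ^ (x - 1)) volume 0 1 :=
    intervalIntegral.intervalIntegrable_rpow' (by linarith)
  have h2 := h.comp_sub_left 1
  simp only [sub_zero, sub_self] at h2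
  rw [← integrableOn_Icc_iff_integrableOn_Ioo, ← intervalIntegrable_iff_integrableOn_Icc_of_le zero_le_one]
  exact h2.symm

/-- The Schwarz-Christoffel map. -/
theorem exists_scPrimitive {a b c : ℝ} (hab : a < b) (hbc : b < c)
    (hca : c < a + 2 * Real.pi) {α β γ : ℝ} (hα : 0 < α) (hβ : 0 < β) (hγ : 0 < γ)
    (hsum : α + β + γ = 1) :
    ∃ F : ℂ → ℂ, ContinuousOn F (closedBall 0 1) ∧
      ∀ w ∈ pdisk a b c, HasDerivWithinAt F (scDeriv a b c α β γ w) (pdisk a b c) w := by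
  set p := scDeriv a b c α β γ
  have hp : ContDiffOn ℂ 1 p (pdisk a b c) := contDiffOn_scDeriv a b c α β γ
  obtain ⟨g, hg⟩ := (convex_pdisk a b c).exists_forall_hasDerivWithinAt
    (hp.differentiableOn one_ne_zero)
  have hpc : ContinuousOn p (pdisk a b c) := hp.continuousOn
  have hball : ∀ w : ℂ, ‖w‖ ≤ 1 → ∀ t ∈ Ioo (0 : ℝ) 1, (t * w : ℂ) ∈ ball (0 : ℂ) 1 := by
    intro w hw t ht
    rw [mem_ball_zero_iff, norm_mul, Complex.norm_of_nonneg ht.1.le]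
    nlinarith [ht.1, ht.2, norm_nonneg w]
  have hpb : ContinuousOn p (ball 0 1) := hpc.mono (ball_subset_pdisk a b c)
  obtain ⟨M, hM⟩ := exists_norm_scDeriv_le hab hbc hca hα hβ hγ hsum
  set bd : ℝ → ℝ := fun t => M * ((1 - t) ^ (α - 1) + (1 - t) ^ (β - 1) + (1 - t) ^ (γ - 1))
  have hbd : IntegrableOn bd (Ioo 0 1) :=
    (((integrableOn_one_sub_rpow hα).add (integrableOn_one_sub_rpow hβ)).add
      (integrableOn_one_sub_rpow hγ)).const_mul M
  have hcont_t : ∀ w : ℂ, ‖w‖ ≤ 1 → ContinuousOn (fun t : ℝ => w * p (t * w)) (Ioo 0 1) :=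
    fun w hw => continuousOn_const.mul
      (hpb.comp (by fun_prop) fun t ht => hball w hw t ht)
  have hbound : ∀ w : ℂ, ‖w‖ ≤ 1 → ∀ t ∈ Ioo (0 : ℝ) 1, ‖w * p (t * w)‖ ≤ bd t := by
    intro w hw t ht
    rw [norm_mul]
    exact (mul_le_of_le_one_left (norm_nonneg _) hw).trans (hM w hw t ht)
  -- The radial integral makes sense at the three corners too, and the bound uniform in w gives
  -- continuity on the closed disk by dominated convergence. On the punctured disk it is the
  -- primitive g minus g(0), whence the derivative.
  refine ⟨fun w => ∫ t in Ioo (0 : ℝ) 1, w * p (t * w), ?_, ?_⟩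
  · refine continuousOn_of_dominated (bound := bd) ?_ ?_ hbd ?_
    · intro w hw
      exact (hcont_t w (by simpa using hw)).aestronglyMeasurable measurableSet_Ioo
    · intro w hw
      exact ae_restrict_of_forall_mem measurableSet_Ioo (hbound w (by simpa using hw))
    · refine ae_restrict_of_forall_mem measurableSet_Ioo fun t ht => ?_
      exact continuousOn_id.mul (hpb.comp (by fun_prop) fun w hw => hball w (by simpa using hw) t ht)
  · have hF : ∀ w ∈ pdisk a b c, ∫ t in Ioo (0 : ℝ) 1, w * p (t * w) = g w - g 0 := by
      intro w hw
      have hw1 := (mem_pdisk hw).1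
      have hmem : ∀ t ∈ Icc (0 : ℝ) 1, (t * w : ℂ) ∈ pdisk a b c := by
        intro t ht
        rcases eq_or_lt_of_le ht.2 with rfl | h1
        · simpa using hw
        · refine ball_subset_pdisk a b c ?_
          rw [mem_ball_zero_iff, norm_mul, Complex.norm_of_nonneg ht.1]
          nlinarith [ht.1, norm_nonneg w]
      have hgc : ContinuousOn g (pdisk a b c) := fun v hv => (hg v hv).continuousWithinAt
      have e := intervalIntegral.integral_eq_sub_of_hasDerivAt_of_le (a := 0) (b := 1)
        (f := fun t : ℝ => g (t * w)) (f' := fun t => w * p (t * w)) zero_le_one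
        (hgc.comp (by fun_prop) hmem) ?_ ?_
      · simp only [ofReal_one, one_mul, ofReal_zero, zero_mul] at e
        rw [← e, intervalIntegral.integral_of_le zero_le_one, integral_Ioc_eq_integral_Ioo]
      · intro t ht
        have h1 : HasDerivAt g (p (t * w)) (t * w) :=
          (hg _ (ball_subset_pdisk a b c (hball w hw1 t ht))).hasDerivAt
            (mem_of_superset (isOpen_ball.mem_nhds (hball w hw1 t ht)) (ball_subset_pdisk a b c))
        have h2 : HasDerivAt (fun t : ℝ => (t * w : ℂ)) w t := by
          simpa using (Complex.ofRealCLM.hasDerivAt (x := t)).mul_const w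
        exact h1.scomp t h2
      · rw [intervalIntegrable_iff_integrableOn_Ioo_of_le zero_le_one]
        exact Integrable.mono' hbd ((hcont_t w hw1).aestronglyMeasurable measurableSet_Ioo)
          (ae_restrict_of_forall_mem measurableSet_Ioo (hbound w hw1))
    intro w hw
    exact ((hg w hw).sub_const (g 0)).congr hF (hF w hw)

/-- The direction of the edge of the Schwarz-Christoffel triangle between `e^{ia}` and `e^{ib}`. -/
def edgeAngle (a b c α β γ : ℝ) : ℝ :=
  (Real.pi + (α - 1) * (-a - Real.pi) + (β - 1) * (Real.pi - b) + (γ - 1) * (Real.pi - c)) / 2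

/-- Along the circle the argument of each factor is affine in τ with slope 1/2. The exponents add up
to -2, so the product turns at rate -1, which cancels the rotation of the tangent vector i e^{iτ};
the image of the arc has constant direction. -/
theorem scDeriv_cis {a b c : ℝ} (hbc : b < c)
    (hca : c < a + 2 * Real.pi) {α β γ : ℝ} (hsum : α + β + γ = 1) {τ : ℝ} (hτ : τ ∈ Ioo a b) :
    ∃ R : ℝ, 0 < R ∧ I * cis τ * scDeriv a b c α β γ (cis τ) =
      R * cis (edgeAngle a b c α β γ) := by
  obtain ⟨h1, h2⟩ := hτ
  have l1 := lfac_cis h1 (by linarith)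
  -- The angles b and c lie ahead of τ, so they are lowered by a full turn to bring τ - θ into (0,
  -- 2π), where the formula for the logarithm holds.
  have l2 := lfac_cis (θ := b - 2 * Real.pi) (τ := τ) (by linarith) (by linarith)
  have l3 := lfac_cis (θ := c - 2 * Real.pi) (τ := τ) (by linarith) (by linarith)
  rw [← lfac_add_two_pi (b - 2 * Real.pi), sub_add_cancel] at l2
  rw [← lfac_add_two_pi (c - 2 * Real.pi), sub_add_cancel] at l3
  have n1 : lfac a (cis τ) ≠ 0 := by
    rw [Ne, lfac_eq_zero_iff]; exact (cis_ne_of_lt h1 (by linarith)).symm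
  have n2 : lfac b (cis τ) ≠ 0 := by
    rw [Ne, lfac_eq_zero_iff]; exact cis_ne_of_lt h2 (by linarith)
  have n3 : lfac c (cis τ) ≠ 0 := by
    rw [Ne, lfac_eq_zero_iff]; exact cis_ne_of_lt (h2.trans hbc) (by linarith)
  refine ⟨Real.exp ((α - 1) * Real.log (2 * Real.sin ((τ - a) / 2)) +
    (β - 1) * Real.log (2 * Real.sin ((τ - (b - 2 * Real.pi)) / 2)) +
    (γ - 1) * Real.log (2 * Real.sin ((τ - (c - 2 * Real.pi)) / 2))), Real.exp_pos _, ?_⟩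
  have hI : I = Complex.exp ((Real.pi / 2 : ℝ) * I) := by
    push_cast; exact Complex.exp_pi_div_two_mul_I.symm
  rw [scDeriv, Complex.cpow_def_of_ne_zero n1, Complex.cpow_def_of_ne_zero n2,
    Complex.cpow_def_of_ne_zero n3, l1.2, l2.2, l3.2]
  nth_rewrite 1 [hI]
  rw [cis, cis, Complex.ofReal_exp, ← Complex.exp_add, ← Complex.exp_add, ← Complex.exp_add,
    ← Complex.exp_add, ← Complex.exp_add, edgeAngle]
  congr 1
  have hγ : γ = 1 - α - β := by linarith
  subst hγ
  push_cast
  ring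

theorem scPrimitive_edge {a b c : ℝ} (hab : a < b) (hbc : b < c)
    (hca : c < a + 2 * Real.pi) {α β γ : ℝ} (hsum : α + β + γ = 1) {F : ℂ → ℂ}
    (hF : ContinuousOn F (closedBall 0 1))
    (hF' : ∀ w ∈ pdisk a b c, HasDerivWithinAt F (scDeriv a b c α β γ w) (pdisk a b c) w) :
    ∃ ρ : ℝ → ℝ, StrictMonoOn ρ (Icc a b) ∧ ρ a = 0 ∧ ∀ τ ∈ Icc a b,
      F (cis τ) = F (cis a) + ρ τ * cis (edgeAngle a b c α β γ) := by
  set δ := edgeAngle a b c α β γ with hδ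
  -- Rotating by the edge direction makes the derivative along the arc a positive real: the
  -- imaginary part is constant and the real part strictly increasing.
  set G : ℝ → ℂ := fun τ => cis (-δ) * F (cis τ) with hG
  have hmem : ∀ τ ∈ Ioo a b, cis τ ∈ pdisk a b c := by
    intro τ hτ
    refine ⟨by simp [norm_cis], ?_⟩
    simp only [mem_insert_iff, mem_singleton_iff, not_or]
    exact ⟨(cis_ne_of_lt hτ.1 (by linarith [hτ.2])).symm, cis_ne_of_lt hτ.2 (by linarith [hτ.1]),
      cis_ne_of_lt (hτ.2.trans hbc) (by linarith [hτ.1])⟩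
  have hGc : Continuous G := by
    refine continuous_const.mul (hF.comp_continuous continuous_cis fun τ => ?_)
    simp [norm_cis]
  have hGd : ∀ τ ∈ Ioo a b, ∃ R : ℝ, 0 < R ∧ HasDerivAt G (R : ℂ) τ := by
    intro τ hτ
    obtain ⟨R, hR, e⟩ := scDeriv_cis hbc hca hsum hτ
    refine ⟨R, hR, ?_⟩
    have h1 : HasDerivAt cis (I * cis τ) τ := by
      have h2 : HasDerivAt (fun t : ℝ => (t : ℂ) * I) I τ := by
        simpa using (Complex.ofRealCLM.hasDerivAt (x := τ)).mul_const I
      have := (Complex.hasDerivAt_exp ((τ : ℂ) * I)).comp τ h2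
      rw [mul_comm]
      exact this
    have h3 : HasDerivWithinAt (fun t => F (cis t)) (I * cis τ * scDeriv a b c α β γ (cis τ))
        (Ioo a b) τ := by
      exact (hF' _ (hmem τ hτ)).scomp τ h1.hasDerivWithinAt (s := Ioo a b) hmem
    have h4 := (h3.hasDerivAt (isOpen_Ioo.mem_nhds hτ)).const_mul (cis (-δ))
    have e2 : cis (-δ) * (R * cis δ) = R := by
      have := cis_mul_neg δ
      linear_combination (R : ℂ) * this
    rwa [e, e2] at h4
  have hre : ∀ τ ∈ Ioo a b, ∃ R : ℝ, 0 < R ∧ HasDerivAt (fun t => (G t).re) R τ ∧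
      HasDerivAt (fun t => (G t).im) 0 τ := by
    intro τ hτ
    obtain ⟨R, hR, h⟩ := hGd τ hτ
    refine ⟨R, hR, ?_, ?_⟩
    · exact Complex.reCLM.hasFDerivAt.comp_hasDerivAt τ h
    · exact Complex.imCLM.hasFDerivAt.comp_hasDerivAt τ h
  have mono : StrictMonoOn (fun t => (G t).re) (Icc a b) := by
    refine strictMonoOn_of_deriv_pos (convex_Icc a b) (by fun_prop) fun τ hτ => ?_
    rw [interior_Icc] at hτ
    obtain ⟨R, hR, h, -⟩ := hre τ hτ
    rwa [h.deriv]
  have him : ∀ τ ∈ Icc a b, (G τ).im = (G a).im := by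
    have m1 : MonotoneOn (fun t => (G t).im) (Icc a b) := by
      refine monotoneOn_of_deriv_nonneg (convex_Icc a b) (by fun_prop) ?_ fun τ hτ => ?_
      · intro τ hτ
        rw [interior_Icc] at hτ
        obtain ⟨R, -, -, h⟩ := hre τ hτ
        exact h.differentiableAt.differentiableWithinAt
      · rw [interior_Icc] at hτ
        obtain ⟨R, -, -, h⟩ := hre τ hτ
        rw [h.deriv]
    have m2 : AntitoneOn (fun t => (G t).im) (Icc a b) := by
      refine antitoneOn_of_deriv_nonpos (convex_Icc a b) (by fun_prop) ?_ fun τ hτ => ?_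
      · intro τ hτ
        rw [interior_Icc] at hτ
        obtain ⟨R, -, -, h⟩ := hre τ hτ
        exact h.differentiableAt.differentiableWithinAt
      · rw [interior_Icc] at hτ
        obtain ⟨R, -, -, h⟩ := hre τ hτ
        rw [h.deriv]
    intro τ hτ
    have ha : a ∈ Icc a b := left_mem_Icc.2 hab.le
    exact le_antisymm (m2 ha hτ hτ.1) (m1 ha hτ hτ.1)
  refine ⟨fun τ => (G τ).re - (G a).re, ?_, by simp, ?_⟩
  · intro x hx y hy hxy
    have := mono hx hy hxy
    simp only at this ⊢
    linarith
  · intro τ hτ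
    have e1 : G τ - G a = (((G τ).re - (G a).re : ℝ) : ℂ) := by
      apply Complex.ext <;> simp [him τ hτ]
    rw [← e1, hG]
    have := cis_mul_neg δ
    linear_combination (F (cis a) - F (cis τ)) * this

end TorusFloer
end

/-! ### Every Euclidean triangle is a Schwarz-Christoffel image -/

noncomputable section
namespace TorusFloer

open Complex Set Filter Topology MeasureTheory Metric

/-- Twice the signed area of the triangle `P, Q, w`. -/
def cr (P Q w : ℂ) : ℝ := (Q.re - P.re) * (w.im - P.im) - (Q.im - P.im) * (w.re - P.re)

theorem cr_eq_im (P Q w : ℂ) : cr P Q w = ((w - Q) * (starRingEnd ℂ) (Q - P)).im := by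
  simp [cr]; ring

theorem cr_rotate (P Q R : ℂ) : cr Q R P = cr P Q R := by simp only [cr]; ring

/-- A conformal map of the disk whose boundary values trace out the edges of the triangle
`A₀, A₁, A₂` monotonically, with the vertices at `e^{ia}`, `e^{ib}`, `e^{ic}`. -/
structure IsTriangleMap (F : ℂ → ℂ) (a b c : ℝ) (A₀ A₁ A₂ : ℂ) : Prop where
  cont : ContinuousOn F (closedBall 0 1)
  smooth : ContDiffOn ℝ ((⊤ : ℕ∞) : WithTop ℕ∞) F (pdisk a b c)
  deriv : ∀ w ∈ ball (0 : ℂ) 1, ∃ F' : ℂ, F' ≠ 0 ∧ HasDerivAt F F' w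
  edge₀ : ∃ ρ : ℝ → ℝ, StrictMonoOn ρ (Icc a b) ∧ ρ a = 0 ∧ ρ b = 1 ∧
    ∀ τ ∈ Icc a b, F (cis τ) = A₀ + ρ τ * (A₁ - A₀)
  edge₁ : ∃ ρ : ℝ → ℝ, StrictMonoOn ρ (Icc b c) ∧ ρ b = 0 ∧ ρ c = 1 ∧
    ∀ τ ∈ Icc b c, F (cis τ) = A₁ + ρ τ * (A₂ - A₁)
  edge₂ : ∃ ρ : ℝ → ℝ, StrictMonoOn ρ (Icc c (a + 2 * Real.pi)) ∧ ρ c = 0 ∧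
    ρ (a + 2 * Real.pi) = 1 ∧
    ∀ τ ∈ Icc c (a + 2 * Real.pi), F (cis τ) = A₂ + ρ τ * (A₀ - A₂)

theorem im_div_pos_of_cr_pos {P Q R : ℂ} (h : 0 < cr P Q R) : 0 < ((R - Q) / (Q - P)).im := by
  have hne : Q - P ≠ 0 := by
    intro h0
    rw [cr_eq_im, h0] at h; simp at h
  have : ((R - Q) / (Q - P)).im = cr P Q R / Complex.normSq (Q - P) := by
    rw [cr_eq_im, div_eq_mul_inv, Complex.inv_def, ← mul_assoc, mul_comm (_ * _) (((_)⁻¹ : ℝ) : ℂ),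
      Complex.im_ofReal_mul]
    ring
  rw [this]
  exact div_pos h (Complex.normSq_pos.2 hne)

theorem arg_mem_Ioo_of_im_pos {z : ℂ} (h : 0 < z.im) : z.arg ∈ Ioo 0 Real.pi := by
  refine ⟨lt_of_le_of_ne (Complex.arg_nonneg_iff.2 h.le) ?_, lt_of_le_of_ne (Complex.arg_le_pi z) ?_⟩
  · intro h0
    have := (Complex.arg_eq_zero_iff.1 h0.symm).2
    linarith
  · intro h0
    have := (Complex.arg_eq_pi_iff.1 h0).2
    linarith

theorem eq_norm_mul_cis_arg (z : ℂ) : z = ‖z‖ * cis z.arg :=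
  (Complex.norm_mul_exp_arg_mul_I z).symm

/-- The angles of a positively oriented triangle. -/
theorem exists_angles {A₀ A₁ A₂ : ℂ} (h : 0 < cr A₀ A₁ A₂) :
    ∃ α β γ : ℝ, 0 < α ∧ 0 < β ∧ 0 < γ ∧ α + β + γ = 1 ∧ ∃ r s : ℝ, 0 < r ∧ 0 < s ∧
      A₂ - A₁ = (A₁ - A₀) * (r * cis (Real.pi * (1 - β))) ∧
      A₀ - A₂ = (A₁ - A₀) * (r * cis (Real.pi * (1 - β))) * (s * cis (Real.pi * (1 - γ))) ∧
      0 < (cis (Real.pi * (1 - β))).im := by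
  have h1 : 0 < cr A₁ A₂ A₀ := by rwa [cr_rotate]
  have h2 : 0 < cr A₂ A₀ A₁ := by rwa [cr_rotate]
  have i1 := im_div_pos_of_cr_pos h
  have i2 := im_div_pos_of_cr_pos h1
  have i0 := im_div_pos_of_cr_pos h2
  set q1 := (A₂ - A₁) / (A₁ - A₀) with hq1
  set q2 := (A₀ - A₂) / (A₂ - A₁) with hq2
  set q0 := (A₁ - A₀) / (A₀ - A₂) with hq0
  have nz : ∀ z : ℂ, 0 < z.im → z ≠ 0 := by rintro z hz rfl; simp at hz
  have z1 := nz _ i1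
  have z2 := nz _ i2
  have z0 := nz _ i0
  have n0 : A₁ - A₀ ≠ 0 := by rintro h0; rw [h0] at hq0; simp at hq0; exact z0 hq0
  have n1 : A₂ - A₁ ≠ 0 := by rintro h0; rw [h0] at hq1; simp at hq1; exact z1 hq1
  have n2 : A₀ - A₂ ≠ 0 := by rintro h0; rw [h0] at hq2; simp at hq2; exact z2 hq2
  obtain ⟨a1, b1⟩ := arg_mem_Ioo_of_im_pos i1
  obtain ⟨a2, b2⟩ := arg_mem_Ioo_of_im_pos i2
  obtain ⟨a0, b0⟩ := arg_mem_Ioo_of_im_pos i0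
  have hprod : q0 * q1 * q2 = 1 := by rw [hq0, hq1, hq2]; field_simp
  have hc : cis (q0.arg + q1.arg + q2.arg) = 1 := by
    rw [eq_norm_mul_cis_arg q0, eq_norm_mul_cis_arg q1, eq_norm_mul_cis_arg q2] at hprod
    have hn : (‖q0‖ * ‖q1‖ * ‖q2‖ : ℂ) * cis (q0.arg + q1.arg + q2.arg) = 1 := by
      rw [cis_add, cis_add, ← hprod]; ring
    have hn' := congrArg norm hn
    rw [norm_mul, norm_cis, mul_one, norm_one] at hn'
    have : (‖q0‖ * ‖q1‖ * ‖q2‖ : ℂ) = 1 := by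
      have e : (‖q0‖ * ‖q1‖ * ‖q2‖ : ℂ) = ((‖q0‖ * ‖q1‖ * ‖q2‖ : ℝ) : ℂ) := by push_cast; rfl
      rw [e, Complex.norm_of_nonneg (by positivity)] at hn'
      rw [e, hn']; simp
    rwa [this, one_mul] at hn
  obtain ⟨n, hn⟩ := Complex.exp_eq_one_iff.1 hc
  have hn2 : q0.arg + q1.arg + q2.arg = n * (2 * Real.pi) := by
    have := congrArg Complex.im hn
    simpa using this
  have hp := Real.pi_pos
  -- The arguments of the quotients of consecutive edge vectors are the exterior angles, each in (0,
  -- π). Their sum is a multiple of 2π strictly between 0 and 3π, hence 2π, so the interior angles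
  -- add up to π.
  have hn1 : n = 1 := by
    have l : (0 : ℝ) < n := by
      by_contra! hcon
      nlinarith
    have u : (n : ℝ) < 2 := by
      by_contra! hcon
      nlinarith
    have : 0 < n := by exact_mod_cast l
    have : n < 2 := by exact_mod_cast u
    omega
  rw [hn1] at hn2
  have e1 : Real.pi * (1 - (1 - q1.arg / Real.pi)) = q1.arg := by field_simp; ring
  have e2 : Real.pi * (1 - (1 - q2.arg / Real.pi)) = q2.arg := by field_simp; ring
  refine ⟨1 - q0.arg / Real.pi, 1 - q1.arg / Real.pi, 1 - q2.arg / Real.pi,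
    by rw [sub_pos, div_lt_one hp]; exact b0, by rw [sub_pos, div_lt_one hp]; exact b1,
    by rw [sub_pos, div_lt_one hp]; exact b2, ?_, ‖q1‖, ‖q2‖, norm_pos_iff.2 z1,
    norm_pos_iff.2 z2, ?_, ?_, ?_⟩
  · field_simp; push_cast at hn2; linarith
  · rw [e1, ← eq_norm_mul_cis_arg, hq1]; field_simp
  · rw [e1, e2, ← eq_norm_mul_cis_arg, ← eq_norm_mul_cis_arg, hq1, hq2]; field_simp
  · rw [e1]
    have := eq_norm_mul_cis_arg q1
    rw [this, Complex.im_ofReal_mul] at i1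
    exact pos_of_mul_pos_right i1 (norm_nonneg _)

/-- Cyclic symmetry of the marked points; together with the same symmetry of the integrand it lets
the computation for one edge serve for all three. -/
theorem pdisk_rotate (a b c : ℝ) : pdisk b c (a + 2 * Real.pi) = pdisk a b c := by
  unfold pdisk
  rw [cis_add_two_pi]
  congr 1
  ext w; simp only [mem_insert_iff, mem_singleton_iff]; tauto

theorem scDeriv_rotate (a b c α β γ : ℝ) :
    scDeriv b c (a + 2 * Real.pi) β γ α = scDeriv a b c α β γ := by
  ext w
  simp only [scDeriv, lfac_add_two_pi]
  ring

theorem edge_rescale {F : ℂ → ℂ} {a b δ : ℝ} (hab : a < b) {ρ : ℝ → ℝ}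
    (hρ : StrictMonoOn ρ (Icc a b)) (h0 : ρ a = 0)
    (h : ∀ τ ∈ Icc a b, F (cis τ) = F (cis a) + ρ τ * cis δ) {P Q A k : ℂ}
    (hk : k * (ρ b * cis δ) = Q - P) (hA : A + k * F (cis a) = P) :
    ∃ ρ : ℝ → ℝ, StrictMonoOn ρ (Icc a b) ∧ ρ a = 0 ∧ ρ b = 1 ∧
      ∀ τ ∈ Icc a b, A + k * F (cis τ) = P + ρ τ * (Q - P) := by
  have hpos : 0 < ρ b := by
    rw [← h0]; exact hρ (left_mem_Icc.2 hab.le) (right_mem_Icc.2 hab.le) hab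
  have hne : (ρ b : ℂ) ≠ 0 := by exact_mod_cast hpos.ne'
  refine ⟨fun τ => ρ τ / ρ b, ?_, by simp [h0], div_self hpos.ne', ?_⟩
  · intro x hx y hy hxy
    exact div_lt_div_of_pos_right (hρ hx hy hxy) hpos
  · intro τ hτ
    rw [h τ hτ, ← hk, ← hA]
    push_cast
    field_simp
    ring

/-- Every positively oriented triangle is the image of a Schwarz-Christoffel map. -/
theorem exists_isTriangleMap {a b c : ℝ} (hab : a < b) (hbc : b < c)
    (hca : c < a + 2 * Real.pi) {A₀ A₁ A₂ : ℂ} (hA : 0 < cr A₀ A₁ A₂) :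
    ∃ F, IsTriangleMap F a b c A₀ A₁ A₂ := by
  obtain ⟨α, β, γ, hα, hβ, hγ, hsum, r, s, hr, hs, e1, e2, him⟩ := exists_angles hA
  obtain ⟨F, hF, hF'⟩ := exists_scPrimitive hab hbc hca hα hβ hγ hsum
  obtain ⟨ρ₀, m0, z0, f0⟩ := scPrimitive_edge hab hbc hca hsum hF hF'
  obtain ⟨ρ₁, m1, z1, f1⟩ := scPrimitive_edge (a := b) (b := c) (c := a + 2 * Real.pi)
    (α := β) (β := γ) (γ := α) hbc hca (by linarith) (by linarith) hF (by
      rwa [pdisk_rotate, scDeriv_rotate])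
  obtain ⟨ρ₂, m2, z2, f2⟩ := scPrimitive_edge (a := c) (b := a + 2 * Real.pi)
    (c := b + 2 * Real.pi) (α := γ) (β := α) (γ := β) hca (by linarith) (by linarith)
    (by linarith) hF (by
      rwa [pdisk_rotate, scDeriv_rotate, pdisk_rotate, scDeriv_rotate])
  set δ := edgeAngle a b c α β γ with hδ
  have hδ1 : edgeAngle b c (a + 2 * Real.pi) β γ α = δ + Real.pi * (1 - β) := by
    rw [hδ, edgeAngle, edgeAngle]
    have : γ = 1 - α - β := by linarith
    subst this; ring
  have hδ2 : edgeAngle c (a + 2 * Real.pi) (b + 2 * Real.pi) γ α β =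
      δ + Real.pi * (1 - β) + Real.pi * (1 - γ) := by
    rw [hδ, edgeAngle, edgeAngle]
    have : γ = 1 - α - β := by linarith
    subst this; ring
  rw [hδ1] at f1
  rw [hδ2] at f2
  set u := cis δ
  set v := cis (Real.pi * (1 - β))
  set x := cis (Real.pi * (1 - γ))
  have hu : u ≠ 0 := cis_ne_zero _
  have hv : v ≠ 0 := cis_ne_zero _
  have pos : ∀ {p q : ℝ} {ρ : ℝ → ℝ}, p < q → StrictMonoOn ρ (Icc p q) → ρ p = 0 → 0 < ρ q := by
    intro p q ρ hpq hm h0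
    rw [← h0]; exact hm (left_mem_Icc.2 hpq.le) (right_mem_Icc.2 hpq.le) hpq
  have p0 := pos hab m0 z0
  have p1 := pos hbc m1 z1
  have p2 := pos hca m2 z2
  have g0 := f0 b (right_mem_Icc.2 hab.le)
  have g1 := f1 c (right_mem_Icc.2 hbc.le)
  have g2 := f2 (a + 2 * Real.pi) (right_mem_Icc.2 hca.le)
  rw [cis_add_two_pi] at g2
  have c1 : cis (δ + Real.pi * (1 - β)) = u * v := cis_add _ _
  have c2 : cis (δ + Real.pi * (1 - β) + Real.pi * (1 - γ)) = u * v * x := by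
    rw [cis_add, c1]
  rw [c1] at g1
  rw [c2] at g2
  -- the two closed polygons have the same directions
  have hn : A₁ - A₀ ≠ 0 := by
    intro h0
    rw [cr_eq_im, h0] at hA; simp at hA
  have clA : 1 + r * v + r * v * (s * x) = 0 := by
    have : (A₁ - A₀) * (1 + r * v + r * v * (s * x)) = 0 := by linear_combination -e1 - e2
    exact (mul_eq_zero.1 this).resolve_left hn
  have clB : ρ₀ b + ρ₁ c * v + ρ₂ (a + 2 * Real.pi) * (v * x) = 0 := by
    have : u * (ρ₀ b + ρ₁ c * v + ρ₂ (a + 2 * Real.pi) * (v * x)) = 0 := by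
      linear_combination -g0 - g1 - g2
    exact (mul_eq_zero.1 this).resolve_left hu
  -- Eliminating the third direction from the two closing relations leaves a real linear relation
  -- between 1 and v. Since v has positive imaginary part both coefficients vanish: equal angles
  -- force proportional sides.
  have hlin : ((ρ₀ b - ρ₂ (a + 2 * Real.pi) / (r * s) : ℝ) : ℂ) +
      ((ρ₁ c - ρ₂ (a + 2 * Real.pi) / s : ℝ) : ℂ) * v = 0 := by
    have hrc : (r : ℂ) ≠ 0 := by exact_mod_cast hr.ne'
    have hsc : (s : ℂ) ≠ 0 := by exact_mod_cast hs.ne'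
    push_cast
    field_simp
    linear_combination (r * s : ℂ) * clB - (ρ₂ (a + 2 * Real.pi) : ℂ) * clA
  have hr1 : ρ₁ c = ρ₂ (a + 2 * Real.pi) / s := by
    have h := congrArg Complex.im hlin
    rw [add_im, ofReal_im, Complex.im_ofReal_mul, zero_im, zero_add] at h
    have := (mul_eq_zero.1 h).resolve_right him.ne'
    linarith
  have hr0 : ρ₀ b = ρ₂ (a + 2 * Real.pi) / (r * s) := by
    have h := congrArg Complex.re hlin
    rw [hr1, sub_self, ofReal_zero, zero_mul, add_zero, ofReal_re, zero_re] at h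
    linarith
  have q2 : ρ₂ (a + 2 * Real.pi) = ρ₀ b * (r * s) := by rw [hr0]; field_simp
  have q1 : ρ₁ c = ρ₀ b * r := by rw [hr1, q2]; field_simp
  have h0c : (ρ₀ b : ℂ) ≠ 0 := by exact_mod_cast p0.ne'
  set k : ℂ := (A₁ - A₀) / (ρ₀ b * u) with hk
  have hkne : k ≠ 0 := div_ne_zero hn (mul_ne_zero h0c hu)
  have hkm : k * (ρ₀ b * u) = A₁ - A₀ := div_mul_cancel₀ _ (mul_ne_zero h0c hu)
  set D : ℂ := A₀ - k * F (cis a)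
  have v0 : D + k * F (cis a) = A₀ := by simp [D]
  have v1 : D + k * F (cis b) = A₁ := by rw [g0]; linear_combination v0 + hkm
  have k1 : k * (ρ₁ c * (u * v)) = A₂ - A₁ := by
    rw [q1, e1, ← hkm]; push_cast; ring
  have v2 : D + k * F (cis c) = A₂ := by rw [g1]; linear_combination v1 + k1
  have k2 : k * (ρ₂ (a + 2 * Real.pi) * (u * v * x)) = A₀ - A₂ := by
    rw [q2, e2, ← hkm]; push_cast; ring
  refine ⟨fun w => D + k * F w, ⟨continuousOn_const.add (continuousOn_const.mul hF), ?_, ?_,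
    edge_rescale hab m0 z0 f0 hkm v0, edge_rescale hbc m1 z1 f1 (by rw [c1]; exact k1) v1,
    edge_rescale hca m2 z2 f2 (by rw [c2]; exact k2) v2⟩⟩
  · have hu : UniqueDiffOn ℂ (pdisk a b c) := (uniqueDiffOn_pdisk a b c).mono_field
    have hs : ContDiffOn ℂ ((⊤ : ℕ∞) : WithTop ℕ∞) F (pdisk a b c) := by
      -- The first derivative is the explicit integrand, which is already known to be smooth up to
      -- the punctured boundary.
      rw [contDiffOn_infty_iff_derivWithin hu]
      refine ⟨fun w hw => (hF' w hw).differentiableWithinAt, ?_⟩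
      exact (contDiffOn_scDeriv a b c α β γ).congr fun w hw => (hF' w hw).derivWithin (hu w hw)
    exact contDiffOn_const.add (contDiffOn_const.mul (hs.restrict_scalars ℝ))
  · intro w hw
    refine ⟨k * scDeriv a b c α β γ w,
      mul_ne_zero hkne (scDeriv_ne_zero (ball_subset_pdisk a b c hw)), ?_⟩
    have h := (hF' w (ball_subset_pdisk a b c hw)).hasDerivAt
      (mem_of_superset (isOpen_ball.mem_nhds hw) (ball_subset_pdisk a b c))
    exact (h.const_mul k).const_add D

end TorusFloer
end

/-! ### Confinement of holomorphic disks with boundary on three lines -/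

noncomputable section
namespace TorusFloer

open Complex Set Filter Topology MeasureTheory Metric

/-- The open triangle with vertices `A₀, A₁, A₂` in counterclockwise order. -/
def openTri (A₀ A₁ A₂ : ℂ) : Set ℂ := {w | 0 < cr A₀ A₁ w ∧ 0 < cr A₁ A₂ w ∧ 0 < cr A₂ A₀ w}

/-- The closed triangle with vertices `A₀, A₁, A₂` in counterclockwise order. -/
def closedTri (A₀ A₁ A₂ : ℂ) : Set ℂ := {w | 0 ≤ cr A₀ A₁ w ∧ 0 ≤ cr A₁ A₂ w ∧ 0 ≤ cr A₂ A₀ w}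

theorem openTri_subset_closedTri (A₀ A₁ A₂ : ℂ) : openTri A₀ A₁ A₂ ⊆ closedTri A₀ A₁ A₂ :=
  fun _ h => ⟨h.1.le, h.2.1.le, h.2.2.le⟩

theorem continuous_cr (P Q : ℂ) : Continuous (cr P Q) := by unfold cr; fun_prop

theorem isOpen_openTri (A₀ A₁ A₂ : ℂ) : IsOpen (openTri A₀ A₁ A₂) :=
  (isOpen_lt continuous_const (continuous_cr _ _)).inter
    ((isOpen_lt continuous_const (continuous_cr _ _)).inter
      (isOpen_lt continuous_const (continuous_cr _ _)))

theorem convex_openTri (A₀ A₁ A₂ : ℂ) : Convex ℝ (openTri A₀ A₁ A₂) := by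
  have key : ∀ P Q : ℂ, Convex ℝ {w | 0 < cr P Q w} := by
    intro P Q x hx y hy s t hs ht hst
    have : cr P Q (s • x + t • y) = s * cr P Q x + t * cr P Q y := by
      have : s = 1 - t := by linarith
      subst this
      simp [cr]; ring
    simp only [Set.mem_ofPred_eq] at hx hy ⊢
    rw [this]
    rcases hs.eq_or_lt with rfl | hs
    · have : t = 1 := by linarith
      subst this; simpa using hy
    · exact add_pos_of_pos_of_nonneg (mul_pos hs hx) (mul_nonneg ht hy.le)
  exact (key _ _).inter ((key _ _).inter (key _ _))

theorem cr_sum (A₀ A₁ A₂ w : ℂ) : cr A₀ A₁ w + cr A₁ A₂ w + cr A₂ A₀ w = cr A₀ A₁ A₂ := by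
  simp only [cr]; ring

theorem eq_barycentric (A₀ A₁ A₂ w : ℂ) (h : cr A₀ A₁ A₂ ≠ 0) :
    w = A₀ + (cr A₂ A₀ w / cr A₀ A₁ A₂ : ℝ) * (A₁ - A₀) +
      (cr A₀ A₁ w / cr A₀ A₁ A₂ : ℝ) * (A₂ - A₀) := by
  have hc : (cr A₀ A₁ A₂ : ℂ) ≠ 0 := by exact_mod_cast h
  apply Complex.ext
  · simp only [add_re, mul_re, ofReal_re, ofReal_im, zero_mul, sub_zero, sub_re]
    field_simp
    simp only [cr]; ring
  · simp only [add_im, mul_im, ofReal_re, ofReal_im, zero_mul, add_zero, sub_im]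
    field_simp
    simp only [cr]; ring

/-- The image of the disk meets no point that can be connected to infinity by a ray disjoint from
the image of the boundary. -/
theorem notMem_image_of_ray {F : ℂ → ℂ} (hF : ContinuousOn F (closedBall 0 1))
    (hopen : IsOpen (F '' ball 0 1)) {N : Set ℂ} (hN : ∀ w, ‖w‖ = 1 → F w ∈ N) {p d : ℂ}
    (hd : d ≠ 0) (h : ∀ t : ℝ, 0 ≤ t → p + t * d ∉ N) : p ∉ F '' closedBall 0 1 := by
  intro hp
  have hK : IsCompact (F '' closedBall 0 1) := (isCompact_closedBall 0 1).image_of_continuousOn hF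
  set r : ℝ → ℂ := fun t => p + t * d
  have hr : Continuous r := by fun_prop
  set S : Set ℝ := Ici 0 ∩ r ⁻¹' (F '' closedBall 0 1)
  have hSc : IsClosed S := isClosed_Ici.inter (hK.isClosed.preimage hr)
  obtain ⟨M, hM⟩ := hK.isBounded.exists_norm_le
  have hdn : 0 < ‖d‖ := norm_pos_iff.2 hd
  have hSb : S ⊆ Icc 0 ((M + ‖p‖) / ‖d‖) := by
    rintro t ⟨ht, hts⟩
    refine ⟨ht, ?_⟩
    rw [le_div_iff₀ hdn]
    have h1 := hM _ hts
    have h2 : ‖(t : ℂ) * d‖ = t * ‖d‖ := by rw [norm_mul, Complex.norm_of_nonneg ht]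
    have h3 := norm_sub_le (r t) p
    have h4 : r t - p = t * d := by simp [r]
    rw [h4, h2] at h3
    linarith
  have hS : IsCompact S := isCompact_Icc.of_isClosed_subset hSc hSb
  -- Take the last point of the ray in the compact image. It is not the image of a boundary point,
  -- so it lies in the open image of the ball, and the ray stays in the image a little longer: a
  -- contradiction.
  obtain ⟨t, ⟨ht0, w, hw, hwt⟩, htmax⟩ := hS.exists_isGreatest ⟨0, by simp, by simpa [r] using hp⟩
  have hwb : w ∈ ball (0 : ℂ) 1 := by
    rw [mem_closedBall_zero_iff] at hw
    rw [mem_ball_zero_iff]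
    refine lt_of_le_of_ne hw fun h1 => h t ht0 ?_
    rw [← show F w = p + t * d from hwt]; exact hN w h1
  have hev : ∀ᶠ s in 𝓝[>] t, r s ∈ F '' ball 0 1 :=
    nhdsWithin_le_nhds (hr.continuousAt.eventually_mem
      (hopen.mem_nhds ⟨w, hwb, hwt⟩))
  obtain ⟨s, hs, hst⟩ := (hev.and self_mem_nhdsWithin).exists
  have : s ∈ S := ⟨(mem_Ici.1 ht0).trans hst.le, image_mono ball_subset_closedBall hs⟩
  exact absurd (htmax this) (not_le.2 hst)

theorem isOpen_image_ball {F : ℂ → ℂ} (hF' : DifferentiableOn ℂ F (ball 0 1))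
    (hne : ¬ ∃ v, ∀ w ∈ ball (0 : ℂ) 1, F w = v) : IsOpen (F '' ball 0 1) := by
  rcases (hF'.analyticOnNhd isOpen_ball).is_constant_or_isOpen
    (convex_ball _ _).isPreconnected with h | h
  · exact absurd h hne
  · exact h _ le_rfl isOpen_ball

/-- A general position device: moving a point slightly in a suitable direction takes it off a given
line. -/
theorem eventually_affine_ne_zero {x y : ℝ} (h : x ≠ 0 ∨ y ≠ 0) :
    ∀ᶠ t : ℝ in 𝓝[>] 0, x + t * y ≠ 0 := by
  by_cases hx : x = 0
  · filter_upwards [self_mem_nhdsWithin] with t ht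
    rw [hx, zero_add]
    exact mul_ne_zero (ne_of_gt ht) (h.resolve_left (not_not.2 hx))
  · have hc : ContinuousAt (fun t : ℝ => x + t * y) 0 := by fun_prop
    exact nhdsWithin_le_nhds (hc.eventually_ne (by simpa using hx))

/-- An image point on the wrong side of the line A₀A₁ could escape to infinity: after a small
perturbation, the ray leaving it radially from A₂ avoids all three lines, contradicting
`notMem_image_of_ray`. -/
theorem cr_pos_of_mem_image {F : ℂ → ℂ} (hF : ContinuousOn F (closedBall 0 1))
    (hopen : IsOpen (F '' ball 0 1)) {A₀ A₁ A₂ : ℂ} (hA : 0 < cr A₀ A₁ A₂)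
    (hN : ∀ w, ‖w‖ = 1 → cr A₀ A₁ (F w) = 0 ∨ cr A₁ A₂ (F w) = 0 ∨ cr A₂ A₀ (F w) = 0)
    {p : ℂ} (hp : p ∈ F '' ball 0 1) : 0 < cr A₀ A₁ p := by
  by_contra! hcon
  -- This direction points from A₂ across the opposite edge. It strictly lowers the functional of
  -- A₀A₁ and changes the other two at nonzero rates, so a generic small step makes all three
  -- nonzero while staying in the open image.
  set d := A₀ + A₁ - 2 * A₂
  have l0 : ∀ t : ℝ, cr A₀ A₁ (p + t * d) = cr A₀ A₁ p - 2 * t * cr A₀ A₁ A₂ := by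
    intro t; simp [cr, d]; ring
  have l1 : ∀ t : ℝ, cr A₁ A₂ (p + t * d) = cr A₁ A₂ p + t * cr A₀ A₁ A₂ := by
    intro t; simp [cr, d]; ring
  have l2 : ∀ t : ℝ, cr A₂ A₀ (p + t * d) = cr A₂ A₀ p + t * cr A₀ A₁ A₂ := by
    intro t; simp [cr, d]; ring
  have hev : ∀ᶠ t : ℝ in 𝓝[>] 0, p + t * d ∈ F '' ball 0 1 := by
    have hr : Continuous fun t : ℝ => p + t * d := by fun_prop
    exact nhdsWithin_le_nhds (hr.continuousAt.eventually_mem (hopen.mem_nhds (by simpa using hp)))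
  obtain ⟨t, ⟨⟨h1, h2⟩, h3⟩, h4⟩ := (((eventually_affine_ne_zero (x := cr A₁ A₂ p) (Or.inr hA.ne')).and
    (eventually_affine_ne_zero (x := cr A₂ A₀ p) (Or.inr hA.ne'))).and hev).and
      self_mem_nhdsWithin |>.exists
  have ht : 0 < t := h4
  set q := p + t * d
  rw [← l1] at h1
  rw [← l2] at h2
  have h0 : cr A₀ A₁ q < 0 := by rw [l0]; nlinarith
  -- On the ray from A₂ through q, the functionals of the two lines through A₂ are only scaled by 1
  -- + s, and that of A₀A₁ becomes still more negative.
  refine notMem_image_of_ray hF hopen (N := {w | cr A₀ A₁ w = 0 ∨ cr A₁ A₂ w = 0 ∨ cr A₂ A₀ w = 0})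
    hN (p := q) (d := q - A₂) ?_ ?_ (image_mono ball_subset_closedBall h3)
  · intro hd
    rw [sub_eq_zero] at hd
    rw [hd] at h0; linarith
  · intro s hs
    have e0 : cr A₀ A₁ (q + s * (q - A₂)) = (1 + s) * cr A₀ A₁ q - s * cr A₀ A₁ A₂ := by
      simp [cr]; ring
    have e1 : cr A₁ A₂ (q + s * (q - A₂)) = (1 + s) * cr A₁ A₂ q := by simp [cr]; ring
    have e2 : cr A₂ A₀ (q + s * (q - A₂)) = (1 + s) * cr A₂ A₀ q := by simp [cr]; ring
    rintro (h | h | h)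
    · rw [e0] at h; nlinarith
    · rw [e1] at h
      rcases mul_eq_zero.1 h with h | h
      · linarith
      · exact h1 h
    · rw [e2] at h
      rcases mul_eq_zero.1 h with h | h
      · linarith
      · exact h2 h

/-- A holomorphic disk with boundary on the three lines through a nondegenerate triangle maps its
interior to the interior of the triangle. -/
theorem mapsTo_openTri {F : ℂ → ℂ} (hF : ContinuousOn F (closedBall 0 1))
    (hF' : DifferentiableOn ℂ F (ball 0 1)) (hne : ¬ ∃ v, ∀ w ∈ ball (0 : ℂ) 1, F w = v)
    {A₀ A₁ A₂ : ℂ} (hA : 0 < cr A₀ A₁ A₂)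
    (hN : ∀ w, ‖w‖ = 1 → cr A₀ A₁ (F w) = 0 ∨ cr A₁ A₂ (F w) = 0 ∨ cr A₂ A₀ (F w) = 0) :
    MapsTo F (ball 0 1) (openTri A₀ A₁ A₂) := by
  have ho := isOpen_image_ball hF' hne
  intro w hw
  have hm := mem_image_of_mem F hw
  refine ⟨cr_pos_of_mem_image hF ho hA hN hm, ?_, ?_⟩
  · exact cr_pos_of_mem_image hF ho (A₂ := A₀) (by rwa [cr_rotate]) (fun w hw => by
      have := hN w hw; tauto) hm
  · exact cr_pos_of_mem_image hF ho (A₂ := A₁) (by rwa [cr_rotate, cr_rotate]) (fun w hw => by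
      have := hN w hw; tauto) hm

/-- A holomorphic disk with boundary on three concurrent lines is constant. -/
theorem exists_const_of_concurrent {F : ℂ → ℂ} (hF : ContinuousOn F (closedBall 0 1))
    (hF' : DifferentiableOn ℂ F (ball 0 1)) {A v₀ v₁ v₂ : ℂ} (h₀ : v₀ ≠ 0) (h₁ : v₁ ≠ 0)
    (h₂ : v₂ ≠ 0) (hN : ∀ w, ‖w‖ = 1 → cr A (A + v₀) (F w) = 0 ∨ cr A (A + v₁) (F w) = 0 ∨
      cr A (A + v₂) (F w) = 0) :
    ∃ v, ∀ w ∈ ball (0 : ℂ) 1, F w = v := by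
  by_contra hne
  have ho := isOpen_image_ball hF' hne
  have key : ∀ v : ℂ, v ≠ 0 → ∀ᶠ t : ℝ in 𝓝[>] 0, -v.im + t * v.re ≠ 0 := by
    intro v hv
    apply eventually_affine_ne_zero
    by_contra! hcon
    exact hv (Complex.ext hcon.2 (by simpa using hcon.1))
  -- A direction 1 + t i parallel to none of the three lines. A small step along it moves the image
  -- point off all of them, and the ray leaving it radially from A then avoids them, since their
  -- functionals are merely scaled.
  obtain ⟨t, ⟨t0, t1⟩, t2⟩ := (((key v₀ h₀).and (key v₁ h₁)).and (key v₂ h₂)).exists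
  set d : ℂ := 1 + t * I
  set p := F 0
  have hp : p ∈ F '' ball 0 1 := ⟨0, by simp, rfl⟩
  have hev : ∀ᶠ t : ℝ in 𝓝[>] 0, p + t * d ∈ F '' ball 0 1 := by
    have hr : Continuous fun t : ℝ => p + t * d := by fun_prop
    exact nhdsWithin_le_nhds (hr.continuousAt.eventually_mem (ho.mem_nhds (by simpa using hp)))
  have l : ∀ (v : ℂ) (s : ℝ), cr A (A + v) (p + s * d) = cr A (A + v) p + s * (-v.im + t * v.re) := by
    intro v s; simp [cr, d]; ring
  obtain ⟨s, ⟨⟨s0, s1⟩, s2⟩, hs⟩ := ((((eventually_affine_ne_zero (x := cr A (A + v₀) p)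
    (Or.inr t0)).and (eventually_affine_ne_zero (x := cr A (A + v₁) p) (Or.inr t1))).and
    (eventually_affine_ne_zero (x := cr A (A + v₂) p) (Or.inr t2))).and hev).exists
  rw [← l] at s0 s1 s2
  set q := p + s * d
  refine notMem_image_of_ray hF ho (N := {w | cr A (A + v₀) w = 0 ∨ cr A (A + v₁) w = 0 ∨
    cr A (A + v₂) w = 0}) hN (p := q) (d := q - A) ?_ ?_ (image_mono ball_subset_closedBall hs)
  · intro hd
    rw [sub_eq_zero] at hd
    rw [hd] at s0; simp [cr] at s0
  · intro r hr
    have e : ∀ v : ℂ, cr A (A + v) (q + r * (q - A)) = (1 + r) * cr A (A + v) q := by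
      intro v; simp [cr]; ring
    have e' : ∀ v : ℂ, cr A (A + v) q ≠ 0 → cr A (A + v) (q + r * (q - A)) ≠ 0 := by
      intro v hv
      rw [e]
      exact mul_ne_zero (by linarith) hv
    rintro (h | h | h)
    · exact e' _ s0 h
    · exact e' _ s1 h
    · exact e' _ s2 h

/-- `K` is a conformal inverse of `F`, from the triangle to the disk. -/
structure IsTriangleInverse (F K : ℂ → ℂ) (A₀ A₁ A₂ : ℂ) : Prop where
  mapsTo : MapsTo F (ball 0 1) (openTri A₀ A₁ A₂)
  mapsTo_closed : MapsTo F (closedBall 0 1) (closedTri A₀ A₁ A₂)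
  inv_mapsTo : MapsTo K (openTri A₀ A₁ A₂) (ball 0 1)
  inv_mapsTo_closed : MapsTo K (closedTri A₀ A₁ A₂) (closedBall 0 1)
  inv_cont : ContinuousOn K (closedTri A₀ A₁ A₂)
  inv_diff : DifferentiableOn ℂ K (openTri A₀ A₁ A₂)
  left_inv : ∀ w ∈ closedBall (0 : ℂ) 1, K (F w) = w
  right_inv : ∀ q ∈ closedTri A₀ A₁ A₂, F (K q) = q

theorem isLocalHomeomorphOn_of_hasDerivAt {F : ℂ → ℂ} {s : Set Disk}
    (hF : ∀ w ∈ ball (0 : ℂ) 1, ∃ F' : ℂ, F' ≠ 0 ∧ HasDerivAt F F' w)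
    (hs : ∀ w ∈ s, (w : ℂ) ∈ ball (0 : ℂ) 1) :
    IsLocalHomeomorphOn (fun w : Disk => F w) s := by
  have hd : DifferentiableOn ℂ F (ball 0 1) := fun w hw => by
    obtain ⟨F', -, h⟩ := hF w hw
    exact h.differentiableAt.differentiableWithinAt
  have hstrict : ∀ w ∈ ball (0 : ℂ) 1, ∃ F' : ℂ, F' ≠ 0 ∧ HasStrictDerivAt F F' w := by
    intro w hw
    obtain ⟨F', hne, h⟩ := hF w hw
    refine ⟨F', hne, ?_⟩
    have := (hd.analyticOnNhd isOpen_ball w hw).hasStrictDerivAt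
    rwa [h.deriv] at this
  rw [isLocalHomeomorphOn_iff_isOpenEmbedding_restrict]
  intro x hx
  obtain ⟨F', hne, h⟩ := hstrict x (hs x hx)
  set φ := (h.hasStrictFDerivAt_equiv hne).toOpenPartialHomeomorph F
  have hxs : (x : ℂ) ∈ φ.source := (h.hasStrictFDerivAt_equiv hne).mem_toOpenPartialHomeomorph_source
  set U : Set Disk := Subtype.val ⁻¹' (φ.source ∩ ball 0 1)
  have hU : IsOpen U := (φ.open_source.inter isOpen_ball).preimage continuous_subtype_val
  refine ⟨U, hU.mem_nhds ⟨hxs, hs x hx⟩, ?_⟩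
  refine .of_continuous_injective_isOpenMap ?_ ?_ ?_
  · have : ContinuousOn F (ball 0 1) := hd.continuousOn
    exact this.comp_continuous (by fun_prop) fun y => y.2.2
  · intro y z hyz
    apply Subtype.ext
    apply Subtype.ext
    exact φ.injOn y.2.1 z.2.1 hyz
  · rw [isOpenMap_iff_nhds_le]
    intro y
    obtain ⟨F', hne, h⟩ := hstrict y.1 y.2.2
    have e1 : map (Subtype.val : U → Disk) (𝓝 y) = 𝓝 y.1 := hU.isOpenEmbedding_subtypeVal.map_nhds_eq y
    have e2 : map (Subtype.val : Disk → ℂ) (𝓝 y.1) = 𝓝 (y.1 : ℂ) :=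
      map_nhds_subtype_coe_eq_nhds _
        (mem_of_superset (isOpen_ball.mem_nhds y.2.2) ball_subset_closedBall)
    have e3 := h.map_nhds_eq hne
    rw [← e2, ← e1, map_map, map_map] at e3
    exact e3.symm.le

end TorusFloer
end

/-! ### Triangle maps are homeomorphisms onto the triangle -/

noncomputable section
namespace TorusFloer

open Complex Set Filter Topology MeasureTheory Metric

theorem cis_mem_closedBall (τ : ℝ) : cis τ ∈ closedBall (0 : ℂ) 1 := by simp [norm_cis]

theorem edge_surj {F : ℂ → ℂ} (hF : ContinuousOn F (closedBall 0 1)) {a b : ℝ} (hab : a < b)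
    {P Q : ℂ} (hPQ : P ≠ Q) {ρ : ℝ → ℝ} (h0 : ρ a = 0) (h1 : ρ b = 1)
    (h : ∀ τ ∈ Icc a b, F (cis τ) = P + ρ τ * (Q - P)) {s : ℝ} (hs : s ∈ Icc (0 : ℝ) 1) :
    ∃ τ ∈ Icc a b, F (cis τ) = P + s * (Q - P) := by
  have hne : Q - P ≠ 0 := sub_ne_zero.2 hPQ.symm
  have hc : ContinuousOn ρ (Icc a b) := by
    have h2 : ContinuousOn (fun τ => ((F (cis τ) - P) / (Q - P)).re) (Icc a b) := by
      have h3 : Continuous fun τ => F (cis τ) :=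
        hF.comp_continuous continuous_cis cis_mem_closedBall
      exact (Complex.continuous_re.comp ((h3.sub continuous_const).div_const _)).continuousOn
    refine h2.congr fun τ hτ => ?_
    simp only [h τ hτ]
    rw [ add_sub_cancel_left, mul_div_cancel_right₀ _ hne, ofReal_re]
  have := intermediate_value_Icc hab.le hc
  rw [h0, h1] at this
  obtain ⟨τ, hτ, e⟩ := this hs
  exact ⟨τ, hτ, by rw [h τ hτ, e]⟩

theorem cr_edge (P Q R : ℂ) (s : ℝ) :
    cr P Q (P + s * (Q - P)) = 0 ∧ cr Q R (P + s * (Q - P)) = (1 - s) * cr P Q R ∧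
      cr R P (P + s * (Q - P)) = s * cr P Q R := by
  refine ⟨?_, ?_, ?_⟩ <;> simp [cr] <;> ring

theorem ne_of_cr_pos {P Q R : ℂ} (h : 0 < cr P Q R) : P ≠ Q := by
  rintro rfl
  simp [cr] at h

/-- The edge is taken half-open. On it the edge's own functional vanishes while the next one is
positive; this pair of conditions tells the three edges apart, so injectivity on the circle reduces
to injectivity on each arc. -/
theorem edge_values {F : ℂ → ℂ} {a b : ℝ} {P Q R : ℂ} (hA : 0 < cr P Q R) {ρ : ℝ → ℝ}
    (hρ : StrictMonoOn ρ (Icc a b)) (h0 : ρ a = 0) (h1 : ρ b = 1)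
    (h : ∀ τ ∈ Icc a b, F (cis τ) = P + ρ τ * (Q - P)) :
    (∀ τ ∈ Ico a b, F (cis τ) ∈ closedTri P Q R ∧ cr P Q (F (cis τ)) = 0 ∧
      0 < cr Q R (F (cis τ))) ∧ InjOn (fun τ => F (cis τ)) (Ico a b) := by
  refine ⟨fun τ hτ => ?_, ?_⟩
  · have hτ' := Ico_subset_Icc_self hτ
    have hab : a ≤ b := hτ.1.trans hτ.2.le
    have l0 : 0 ≤ ρ τ := by
      rw [← h0]; exact hρ.monotoneOn (left_mem_Icc.2 hab) hτ' hτ.1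
    have l1 : ρ τ < 1 := by
      rw [← h1]; exact hρ hτ' (right_mem_Icc.2 hab) hτ.2
    obtain ⟨e0, e1, e2⟩ := cr_edge P Q R (ρ τ)
    rw [← h τ hτ'] at e0 e1 e2
    have p1 : 0 < cr Q R (F (cis τ)) := by rw [e1]; exact mul_pos (by linarith) hA
    exact ⟨⟨e0.ge, p1.le, by rw [e2]; positivity⟩, e0, p1⟩
  · intro x hx y hy hxy
    have hne : Q - P ≠ 0 := sub_ne_zero.2 (ne_of_cr_pos hA).symm
    simp only [h x (Ico_subset_Icc_self hx), h y (Ico_subset_Icc_self hy), add_right_inj] at hxy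
    have := mul_right_cancel₀ hne hxy
    exact hρ.injOn (Ico_subset_Icc_self hx) (Ico_subset_Icc_self hy) (by exact_mod_cast this)

theorem exists_arc {w : ℂ} (hw : ‖w‖ = 1) (a b c : ℝ) :
    ∃ τ, w = cis τ ∧ (τ ∈ Ico a b ∨ τ ∈ Ico b c ∨ τ ∈ Ico c (a + 2 * Real.pi)) := by
  obtain ⟨τ, hτ, rfl⟩ := exists_cis_of_norm hw a
  refine ⟨τ, rfl, ?_⟩
  by_cases h1 : τ < b
  · exact Or.inl ⟨hτ.1, h1⟩
  · by_cases h2 : τ < c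
    · exact Or.inr (Or.inl ⟨not_lt.1 h1, h2⟩)
    · exact Or.inr (Or.inr ⟨not_lt.1 h2, hτ.2⟩)

theorem closedTri_rotate (A₀ A₁ A₂ : ℂ) : closedTri A₁ A₂ A₀ = closedTri A₀ A₁ A₂ := by
  ext w; simp only [closedTri, Set.mem_ofPred_eq]; tauto

/-- The point of the closed triangle where the functional of the first edge vanishes lie on it. -/
theorem mem_edge_of_cr_eq_zero {P Q R q : ℂ} (hA : 0 < cr P Q R) (hq : q ∈ closedTri P Q R)
    (h : cr P Q q = 0) : ∃ s ∈ Icc (0 : ℝ) 1, q = P + s * (Q - P) := by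
  refine ⟨cr R P q / cr P Q R, ⟨div_nonneg hq.2.2 hA.le, ?_⟩, ?_⟩
  · rw [div_le_one hA]
    have := cr_sum P Q R q
    linarith [hq.2.1]
  · have := eq_barycentric P Q R q hA.ne'
    rw [h] at this
    simpa using this

namespace IsTriangleMap

variable {F : ℂ → ℂ} {a b c : ℝ} {A₀ A₁ A₂ : ℂ}

theorem differentiableOn (h : IsTriangleMap F a b c A₀ A₁ A₂) :
    DifferentiableOn ℂ F (ball 0 1) := fun w hw => by
  obtain ⟨F', -, h⟩ := h.deriv w hw
  exact h.differentiableAt.differentiableWithinAt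

theorem sphere (h : IsTriangleMap F a b c A₀ A₁ A₂) (hA : 0 < cr A₀ A₁ A₂) :
    (∀ w, ‖w‖ = 1 → F w ∈ closedTri A₀ A₁ A₂ ∧ F w ∉ openTri A₀ A₁ A₂) ∧
      InjOn F (sphere 0 1) := by
  obtain ⟨ρ₀, m0, z0, o0, f0⟩ := h.edge₀
  obtain ⟨ρ₁, m1, z1, o1, f1⟩ := h.edge₁
  obtain ⟨ρ₂, m2, z2, o2, f2⟩ := h.edge₂
  have hA1 : 0 < cr A₁ A₂ A₀ := by rwa [cr_rotate]
  have hA2 : 0 < cr A₂ A₀ A₁ := by rwa [cr_rotate]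
  obtain ⟨v0, i0⟩ := edge_values hA m0 z0 o0 f0
  obtain ⟨v1, i1⟩ := edge_values hA1 m1 z1 o1 f1
  obtain ⟨v2, i2⟩ := edge_values hA2 m2 z2 o2 f2
  rw [closedTri_rotate] at v1
  rw [closedTri_rotate, closedTri_rotate] at v2
  refine ⟨fun w hw => ?_, ?_⟩
  · obtain ⟨τ, rfl, hτ | hτ | hτ⟩ := exists_arc hw a b c
    · exact ⟨(v0 τ hτ).1, fun hc => by have := hc.1; rw [(v0 τ hτ).2.1] at this; exact this.false⟩
    · exact ⟨(v1 τ hτ).1, fun hc => by have := hc.2.1; rw [(v1 τ hτ).2.1] at this; exact this.false⟩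
    · exact ⟨(v2 τ hτ).1, fun hc => by have := hc.2.2; rw [(v2 τ hτ).2.1] at this; exact this.false⟩
  · intro x hx y hy hxy
    obtain ⟨τ, rfl, hτ⟩ := exists_arc (mem_sphere_zero_iff_norm.1 hx) a b c
    obtain ⟨σ, rfl, hσ⟩ := exists_arc (mem_sphere_zero_iff_norm.1 hy) a b c
    rcases hτ with hτ | hτ | hτ <;> rcases hσ with hσ | hσ | hσ
    · rw [i0 hτ hσ hxy]
    · have h1 := (v0 τ hτ).2.2; have h2 := (v1 σ hσ).2.1; rw [hxy] at h1; linarith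
    · have h1 := (v2 σ hσ).2.2; have h2 := (v0 τ hτ).2.1; rw [hxy] at h2; linarith
    · have h1 := (v0 σ hσ).2.2; have h2 := (v1 τ hτ).2.1; rw [hxy] at h2; linarith
    · rw [i1 hτ hσ hxy]
    · have h1 := (v1 τ hτ).2.2; have h2 := (v2 σ hσ).2.1; rw [hxy] at h1; linarith
    · have h1 := (v2 τ hτ).2.2; have h2 := (v0 σ hσ).2.1; rw [hxy] at h1; linarith
    · have h1 := (v1 σ hσ).2.2; have h2 := (v2 τ hτ).2.1; rw [hxy] at h2; linarith
    · rw [i2 hτ hσ hxy]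

theorem mapsTo_openTri (h : IsTriangleMap F a b c A₀ A₁ A₂) (hA : 0 < cr A₀ A₁ A₂) :
    MapsTo F (ball 0 1) (openTri A₀ A₁ A₂) := by
  refine TorusFloer.mapsTo_openTri h.cont h.differentiableOn ?_ hA ?_
  · rintro ⟨v, hv⟩
    obtain ⟨F', hne, hd⟩ := h.deriv 0 (by simp)
    refine hne (hd.unique ?_)
    refine (hasDerivAt_const (0 : ℂ) v).congr_of_eventuallyEq ?_
    filter_upwards [isOpen_ball.mem_nhds (show (0 : ℂ) ∈ ball (0 : ℂ) 1 by simp)] with w hw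
    exact hv w hw
  · intro w hw
    obtain ⟨h1, h2⟩ := (h.sphere hA).1 w hw
    by_contra! hcon
    exact h2 ⟨lt_of_le_of_ne h1.1 hcon.1.symm, lt_of_le_of_ne h1.2.1 hcon.2.1.symm,
      lt_of_le_of_ne h1.2.2 hcon.2.2.symm⟩

/-- The section over the open triangle given by covering space theory. -/
theorem bijOn_ball (h : IsTriangleMap F a b c A₀ A₁ A₂) (hA : 0 < cr A₀ A₁ A₂) :
    BijOn F (ball 0 1) (openTri A₀ A₁ A₂) := by
  have hm := h.mapsTo_openTri hA
  set T := openTri A₀ A₁ A₂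
  set f : Disk → ℂ := fun w => F w
  have hf : Continuous f := h.cont.comp_continuous continuous_subtype_val fun w => w.2
  have hint : ∀ w : Disk, f w ∈ T → (w : ℂ) ∈ ball (0 : ℂ) 1 := by
    intro w hw
    rw [mem_ball_zero_iff]
    refine lt_of_le_of_ne (mem_closedBall_zero_iff.1 w.2) fun h1 => ((h.sphere hA).1 w h1).2 hw
  -- The closed disk is compact and all preimages of the open triangle are interior, where the
  -- derivative is nonzero; hence a covering over the triangle.
  have hcov : IsCoveringMapOn f T :=
    IsCoveringMapOn.of_isLocalHomeomorphOn hf (isLocalHomeomorphOn_of_hasDerivAt h.deriv hint)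
  have hT : F 0 ∈ T := hm (by simp)
  have : ContractibleSpace T := (convex_openTri _ _ _).contractibleSpace ⟨_, hT⟩
  have : LocallyPathConnectedSpace T := (isOpen_openTri _ _ _).locallyPathConnectedSpace
  obtain ⟨σ, ⟨hσ0, hσ⟩, -⟩ := hcov.existsUnique_continuousMap_lifts
    (f := ⟨(Subtype.val : T → ℂ), continuous_subtype_val⟩) (a₀ := ⟨F 0, hT⟩)
    (e₀ := ⟨0, by simp⟩) rfl fun q => q.2
  have hσ' : ∀ q : T, F (σ q) = q := fun q => congrFun hσ q
  set B := ball (0 : ℂ) 1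
  have : ContractibleSpace B := (convex_ball _ _).contractibleSpace ⟨0, by simp⟩
  have : LocallyPathConnectedSpace B := isOpen_ball.locallyPathConnectedSpace
  have hFB : ContinuousOn F B := h.cont.mono ball_subset_closedBall
  obtain ⟨g, -, huniq⟩ := hcov.existsUnique_continuousMap_lifts
    (f := ⟨fun w : B => F w, hFB.domRestrict⟩) (a₀ := ⟨0, by simp [B]⟩)
    (e₀ := ⟨0, by simp⟩) rfl fun w => hm w.2
  -- The inclusion of the ball and σ ∘ F both lift F and agree at 0, so they coincide. Thus σ is a
  -- left inverse as well as a section, which gives injectivity and surjectivity.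
  have e1 := huniq ⟨fun w => ⟨w, ball_subset_closedBall w.2⟩, by fun_prop⟩ ⟨rfl, rfl⟩
  have e2 := huniq ⟨fun w => σ ⟨F w, hm w.2⟩,
    σ.continuous.comp (hFB.domRestrict.subtype_mk _)⟩ ⟨hσ0, funext fun w => hσ' _⟩
  refine ⟨hm, ?_, fun q hq => ⟨σ ⟨q, hq⟩, hint _ (by simp only [f, hσ' ⟨q, hq⟩]; exact hq), hσ' _⟩⟩
  have key : ∀ w : B, ((σ ⟨F w, hm w.2⟩ : Disk) : ℂ) = w := by
    intro w
    have := congrArg (fun k : C(B, Disk) => ((k w : Disk) : ℂ)) (e2.trans e1.symm)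
    exact this
  intro x hx y hy hxy
  have h1 := key ⟨x, hx⟩
  have h2 := key ⟨y, hy⟩
  simp only [hxy] at h1
  exact h1.symm.trans h2

theorem bijOn_closedBall (h : IsTriangleMap F a b c A₀ A₁ A₂) (hab : a < b) (hbc : b < c)
    (hca : c < a + 2 * Real.pi) (hA : 0 < cr A₀ A₁ A₂) :
    BijOn F (closedBall 0 1) (closedTri A₀ A₁ A₂) := by
  have hb := h.bijOn_ball hA
  obtain ⟨hs, hinj⟩ := h.sphere hA
  have cases : ∀ w ∈ closedBall (0 : ℂ) 1, w ∈ ball (0 : ℂ) 1 ∨ ‖w‖ = 1 := by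
    intro w hw
    rw [mem_closedBall_zero_iff] at hw
    rw [mem_ball_zero_iff]
    exact hw.lt_or_eq
  refine ⟨fun w hw => ?_, fun x hx y hy hxy => ?_, fun q hq => ?_⟩
  · rcases cases w hw with h1 | h1
    · exact openTri_subset_closedTri _ _ _ (hb.mapsTo h1)
    · exact (hs w h1).1
  · rcases cases x hx with h1 | h1 <;> rcases cases y hy with h2 | h2
    · exact hb.injOn h1 h2 hxy
    · exact absurd (hxy ▸ hb.mapsTo h1) (hs y h2).2
    · exact absurd (hxy.symm ▸ hb.mapsTo h2) (hs x h1).2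
    · exact hinj (by simpa using h1) (by simpa using h2) hxy
  · have hA1 : 0 < cr A₁ A₂ A₀ := by rwa [cr_rotate]
    have hA2 : 0 < cr A₂ A₀ A₁ := by rwa [cr_rotate]
    by_cases hqo : q ∈ openTri A₀ A₁ A₂
    · obtain ⟨w, hw, rfl⟩ := hb.surjOn hqo
      exact ⟨w, ball_subset_closedBall hw, rfl⟩
    · have hz : cr A₀ A₁ q = 0 ∨ cr A₁ A₂ q = 0 ∨ cr A₂ A₀ q = 0 := by
        by_contra! hcon
        exact hqo ⟨lt_of_le_of_ne hq.1 hcon.1.symm, lt_of_le_of_ne hq.2.1 hcon.2.1.symm,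
          lt_of_le_of_ne hq.2.2 hcon.2.2.symm⟩
      rcases hz with h0 | h0 | h0
      · obtain ⟨s, hs, rfl⟩ := mem_edge_of_cr_eq_zero hA hq h0
        obtain ⟨ρ, -, z, o, f⟩ := h.edge₀
        obtain ⟨τ, -, e⟩ := edge_surj h.cont hab (ne_of_cr_pos hA) z o f hs
        exact ⟨cis τ, cis_mem_closedBall τ, e⟩
      · rw [← closedTri_rotate] at hq
        obtain ⟨s, hs, rfl⟩ := mem_edge_of_cr_eq_zero hA1 hq h0
        obtain ⟨ρ, -, z, o, f⟩ := h.edge₁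
        obtain ⟨τ, -, e⟩ := edge_surj h.cont hbc (ne_of_cr_pos hA1) z o f hs
        exact ⟨cis τ, cis_mem_closedBall τ, e⟩
      · rw [← closedTri_rotate, ← closedTri_rotate] at hq
        obtain ⟨s, hs, rfl⟩ := mem_edge_of_cr_eq_zero hA2 hq h0
        obtain ⟨ρ, -, z, o, f⟩ := h.edge₂
        obtain ⟨τ, -, e⟩ := edge_surj h.cont hca (ne_of_cr_pos hA2) z o f hs
        exact ⟨cis τ, cis_mem_closedBall τ, e⟩

/-- A triangle map has a conformal inverse. -/
theorem exists_inverse (h : IsTriangleMap F a b c A₀ A₁ A₂) (hab : a < b) (hbc : b < c)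
    (hca : c < a + 2 * Real.pi) (hA : 0 < cr A₀ A₁ A₂) :
    ∃ K, IsTriangleInverse F K A₀ A₁ A₂ := by
  have hb := h.bijOn_ball hA
  have hc := h.bijOn_closedBall hab hbc hca hA
  set K := Function.invFunOn F (closedBall 0 1)
  have hinv : InvOn K F (closedBall 0 1) (closedTri A₀ A₁ A₂) := hc.invOn_invFunOn
  have hKc : MapsTo K (closedTri A₀ A₁ A₂) (closedBall 0 1) := hc.surjOn.mapsTo_invFunOn
  have hKo : MapsTo K (openTri A₀ A₁ A₂) (ball 0 1) := by
    intro q hq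
    obtain ⟨w, hw, rfl⟩ := hb.surjOn hq
    rwa [hinv.1 (ball_subset_closedBall hw)]
  -- A continuous bijection from a compact space to a Hausdorff space is a homeomorphism.
  have hcont : ContinuousOn K (closedTri A₀ A₁ A₂) := by
    let e : Disk ≃ closedTri A₀ A₁ A₂ := hc.equiv
    have he : Continuous e := by
      refine Continuous.subtype_mk (f := fun w : Disk => F w) ?_ _
      exact h.cont.comp_continuous continuous_subtype_val fun w => w.2
    let e' : Disk ≃ₜ closedTri A₀ A₁ A₂ := Continuous.homeoOfEquivCompactToT2 (f := e) he
    rw [continuousOn_iff_continuous_domRestrict]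
    have : (closedTri A₀ A₁ A₂).domRestrict K = fun q => ((e'.symm q : Disk) : ℂ) := by
      funext q
      have h1 : e' (e'.symm q) = q := e'.apply_symm_apply q
      have h2 : F (e'.symm q : Disk) = q := congrArg Subtype.val h1
      have h3 := hinv.1 (e'.symm q).2
      rw [h2] at h3
      exact h3
    rw [this]
    exact continuous_subtype_val.comp e'.symm.continuous
  refine ⟨K, hb.mapsTo, hc.mapsTo, hKo, hKc, hcont, fun q hq => ?_, hinv.1, hinv.2⟩
  obtain ⟨F', hne, hd⟩ := h.deriv _ (hKo hq)
  have hnhds := (isOpen_openTri A₀ A₁ A₂).mem_nhds hq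
  have hca : ContinuousAt K q := hcont.continuousAt
    (mem_of_superset hnhds (openTri_subset_closedTri _ _ _))
  refine (HasDerivAt.of_local_left_inverse hca hd hne ?_).differentiableAt.differentiableWithinAt
  filter_upwards [hnhds] with y hy
  exact hinv.2 (openTri_subset_closedTri _ _ _ hy)

end IsTriangleMap

end TorusFloer
end

/-! ### Uniqueness by the maximum principle -/

noncomputable section
namespace TorusFloer

open Complex Set Filter Topology MeasureTheory Metric

theorem arg_lfac_cis {θ τ : ℝ} (h : θ < τ) (h' : τ < θ + 2 * Real.pi) :
    (lfac θ (cis τ)).arg = (τ - θ - Real.pi) / 2 := by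
  have := congrArg Complex.im (lfac_cis h h').2
  rw [Complex.log_im] at this
  rw [this]; simp

/-- The argument of the Möbius transform `(1 - w/e^{ia}) / (1 - w/e^{ib})` is constant on the two
arcs between `e^{ia}` and `e^{ib}`. -/
theorem arg_lfac_sub {a b τ : ℝ} (hb : b < a + 2 * Real.pi) :
    (τ ∈ Ioo a b → (lfac a (cis τ)).arg - (lfac b (cis τ)).arg = (b - a) / 2 - Real.pi) ∧
    (τ ∈ Ioo b (a + 2 * Real.pi) → a < b →
      (lfac a (cis τ)).arg - (lfac b (cis τ)).arg = (b - a) / 2) := by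
  constructor
  · rintro ⟨h1, h2⟩
    rw [arg_lfac_cis h1 (by linarith), ← sub_add_cancel b (2 * Real.pi), lfac_add_two_pi,
      arg_lfac_cis (by linarith) (by linarith)]
    ring
  · rintro ⟨h1, h2⟩ hab
    rw [arg_lfac_cis (by linarith) h2, arg_lfac_cis h1 (by linarith)]
    ring

theorem exists_const_of_im_eq_zero {f : ℂ → ℂ} (hf : DifferentiableOn ℂ f (ball 0 1))
    (h : ∀ w ∈ ball (0 : ℂ) 1, (f w).im = 0) : ∃ v, ∀ w ∈ ball (0 : ℂ) 1, f w = v := by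
  by_contra hne
  have ho := isOpen_image_ball hf hne
  obtain ⟨r, hr, hsub⟩ := Metric.isOpen_iff.1 ho (f 0) ⟨0, by simp, rfl⟩
  have hm : f 0 + (r / 2 : ℝ) * I ∈ ball (f 0) r := by
    rw [mem_ball_iff_norm, add_sub_cancel_left, norm_mul, norm_I, mul_one, Complex.norm_of_nonneg (by positivity)]
    linarith
  obtain ⟨w, hw, e⟩ := hsub hm
  have h1 := h w hw
  rw [e] at h1
  simp [h 0 (by simp)] at h1
  exact hr.ne' h1

/-- The power with exponent of positive real part extends continuously by 0 at the zeros of the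
factor. This is what the small real part ε in the exponents of `barrier` is for. -/
theorem continuousOn_lfac_cpow {φ : ℂ → ℂ} (hφ : ContinuousOn φ (closedBall 0 1))
    (hm : MapsTo φ (closedBall 0 1) (closedBall 0 1)) (θ : ℝ) {s : ℂ} (hs : 0 < s.re) :
    ContinuousOn (fun w => lfac θ (φ w) ^ s) (closedBall 0 1) := by
  intro w hw
  have h1 : ContinuousAt (fun x : ℂ => x ^ s) (lfac θ (φ w)) :=
    continuousAt_cpow_const_of_re_pos (Or.inl (lfac_re_nonneg (by simpa using hm hw) θ)) hs
  exact ContinuousAt.comp_continuousWithinAt (f := fun w => lfac θ (φ w)) h1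
    ((continuous_lfac θ).comp_continuousOn hφ w hw)

theorem ne_cis_of_norm_lt {w : ℂ} (hw : ‖w‖ < 1) (θ : ℝ) : w ≠ cis θ := by
  rintro rfl; rw [norm_cis] at hw; exact hw.false

theorem differentiableOn_lfac_cpow {φ : ℂ → ℂ} (hφ : DifferentiableOn ℂ φ (ball 0 1))
    (hm : MapsTo φ (ball 0 1) (ball 0 1)) (θ : ℝ) (s : ℂ) :
    DifferentiableOn ℂ (fun w => lfac θ (φ w) ^ s) (ball 0 1) := by
  intro w hw
  have h1 : ‖φ w‖ < 1 := by simpa using hm hw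
  exact (((differentiable_lfac θ) _).comp_differentiableWithinAt w (hφ w hw)).cpow_const
    (lfac_mem_slitPlane h1.le (ne_cis_of_norm_lt h1 θ))

theorem differentiableOn_log_lfac {φ : ℂ → ℂ} (hφ : DifferentiableOn ℂ φ (ball 0 1))
    (hm : MapsTo φ (ball 0 1) (ball 0 1)) (θ : ℝ) :
    DifferentiableOn ℂ (fun w => Complex.log (lfac θ (φ w))) (ball 0 1) := by
  intro w hw
  have h1 : ‖φ w‖ < 1 := by simpa using hm hw
  exact (((differentiable_lfac θ) _).comp_differentiableWithinAt w (hφ w hw)).clog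
    (lfac_mem_slitPlane h1.le (ne_cis_of_norm_lt h1 θ))

/-- The difference of the arguments of two boundary-compatible Möbius coordinates. -/
def argDefect (φ : ℂ → ℂ) (a b : ℝ) (w : ℂ) : ℝ :=
  (lfac a (φ w)).arg - (lfac b (φ w)).arg - (lfac a w).arg + (lfac b w).arg

/-- The auxiliary function to which the maximum principle is applied. -/
def barrier (φ : ℂ → ℂ) (a b σ ε : ℝ) (w : ℂ) : ℂ :=
  lfac a (φ w) ^ (ε - σ * I : ℂ) * lfac b (φ w) ^ (ε + σ * I : ℂ) *
    (lfac a w ^ (ε + σ * I : ℂ) * lfac b w ^ (ε - σ * I : ℂ))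

/-- An imaginary exponent turns an argument into a modulus. The part left over, with exponent ε,
tends to 1 at interior points as ε tends to 0. -/
theorem norm_barrier {φ : ℂ → ℂ} {a b σ ε : ℝ} {w : ℂ} (h1 : lfac a (φ w) ≠ 0)
    (h2 : lfac b (φ w) ≠ 0) (h3 : lfac a w ≠ 0) (h4 : lfac b w ≠ 0) :
    ‖barrier φ a b σ ε w‖ = ‖lfac a (φ w)‖ ^ ε * ‖lfac b (φ w)‖ ^ ε *
      (‖lfac a w‖ ^ ε * ‖lfac b w‖ ^ ε) * Real.exp (σ * argDefect φ a b w) := by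
  rw [barrier, norm_mul, norm_mul, norm_mul, norm_cpow_of_ne_zero h1, norm_cpow_of_ne_zero h2,
    norm_cpow_of_ne_zero h3, norm_cpow_of_ne_zero h4]
  have e1 : ((ε : ℂ) - σ * I).re = ε := by simp
  have e2 : ((ε : ℂ) - σ * I).im = -σ := by simp
  have e3 : ((ε : ℂ) + σ * I).re = ε := by simp
  have e4 : ((ε : ℂ) + σ * I).im = σ := by simp
  rw [e1, e2, e3, e4]
  have : Real.exp (σ * argDefect φ a b w) = (Real.exp ((lfac a (φ w)).arg * -σ))⁻¹ *
      (Real.exp ((lfac b (φ w)).arg * σ))⁻¹ * ((Real.exp ((lfac a w).arg * σ))⁻¹ *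
      (Real.exp ((lfac b w).arg * -σ))⁻¹) := by
    rw [← Real.exp_neg, ← Real.exp_neg, ← Real.exp_neg, ← Real.exp_neg, ← Real.exp_add,
      ← Real.exp_add, ← Real.exp_add, argDefect]
    congr 1; ring
  rw [this]
  simp only [div_eq_mul_inv]
  ring

/-- On each arc the argument of the Möbius coordinate is constant, and φ preserves the two arcs, so
the defect vanishes on the circle except possibly where one of the four factors is zero. The factors
with exponent ε tame those points: the maximum principle bounds the modulus by 16^ε, and ε → 0 gives
exp(σ · defect) ≤ 1. Both signs of σ are needed later to conclude that the defect is zero. -/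
theorem argDefect_nonpos {φ : ℂ → ℂ} (hφ : ContinuousOn φ (closedBall 0 1))
    (hφ' : DifferentiableOn ℂ φ (ball 0 1)) (hm : MapsTo φ (ball 0 1) (ball 0 1))
    (hmc : MapsTo φ (closedBall 0 1) (closedBall 0 1)) {a b : ℝ} (hab : a < b)
    (hb : b < a + 2 * Real.pi) (h0 : ∀ τ ∈ Icc a b, φ (cis τ) ∈ cis '' Icc a b)
    (h1 : ∀ τ ∈ Icc b (a + 2 * Real.pi), φ (cis τ) ∈ cis '' Icc b (a + 2 * Real.pi)) (σ : ℝ)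
    {w : ℂ} (hw : w ∈ ball (0 : ℂ) 1) : σ * argDefect φ a b w ≤ 0 := by
  have hpow : ∀ {x ε : ℝ}, 0 ≤ x → x ≤ 2 → 0 < ε → x ^ ε ≤ 2 ^ ε := fun h1 h2 h3 =>
    Real.rpow_le_rpow h1 h2 h3.le
  have bound : ∀ ε > 0, ‖barrier φ a b σ ε w‖ ≤ 2 ^ ε * 2 ^ ε * (2 ^ ε * 2 ^ ε) := by
    intro ε hε
    have r1 : 0 < ((ε : ℂ) - σ * I).re := by simpa
    have r2 : 0 < ((ε : ℂ) + σ * I).re := by simpa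
    have hd : DiffContOnCl ℂ (barrier φ a b σ ε) (ball 0 1) := by
      constructor
      · exact ((differentiableOn_lfac_cpow hφ' hm a _).mul (differentiableOn_lfac_cpow hφ' hm b _)).mul
          ((differentiableOn_lfac_cpow differentiableOn_id (mapsTo_id _) a _).mul
            (differentiableOn_lfac_cpow differentiableOn_id (mapsTo_id _) b _))
      · rw [closure_ball _ one_ne_zero]
        exact ((continuousOn_lfac_cpow hφ hmc a r1).mul (continuousOn_lfac_cpow hφ hmc b r2)).mul
          ((continuousOn_lfac_cpow continuousOn_id (mapsTo_id _) a r2).mul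
            (continuousOn_lfac_cpow continuousOn_id (mapsTo_id _) b r1))
    refine norm_le_of_forall_mem_frontier_norm_le isBounded_ball hd ?_ (subset_closure hw)
    intro v hv
    rw [frontier_ball _ one_ne_zero, mem_sphere_zero_iff_norm] at hv
    have n1 : ((ε : ℂ) - σ * I) ≠ 0 := fun h => by rw [h] at r1; simp at r1
    have n2 : ((ε : ℂ) + σ * I) ≠ 0 := fun h => by rw [h] at r2; simp at r2
    have hφv : ‖φ v‖ ≤ 1 := by simpa using hmc (mem_closedBall_zero_iff.2 hv.le)
    have pos : (0 : ℝ) ≤ 2 ^ ε * 2 ^ ε * (2 ^ ε * 2 ^ ε) := by positivity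
    -- At the exceptional boundary points one factor of the barrier is zero to a nonzero power, so
    -- the barrier itself vanishes.
    by_cases z1 : lfac a (φ v) = 0
    · rw [barrier, z1, zero_cpow n1]; simpa using pos
    by_cases z2 : lfac b (φ v) = 0
    · rw [barrier, z2, zero_cpow n2]; simpa using pos
    by_cases z3 : lfac a v = 0
    · rw [barrier, z3, zero_cpow n2]; simpa using pos
    by_cases z4 : lfac b v = 0
    · rw [barrier, z4, zero_cpow n1]; simpa using pos
    have hdef : argDefect φ a b v = 0 := by
      rw [lfac_eq_zero_iff] at z1 z2 z3 z4
      obtain ⟨τ, hτ, rfl⟩ := exists_cis_of_norm hv a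
      have ha : a < τ := lt_of_le_of_ne hτ.1 fun h => z3 (by rw [h])
      rcases lt_trichotomy τ b with hτb | hτb | hτb
      · obtain ⟨s, hs, e⟩ := h0 τ ⟨ha.le, hτb.le⟩
        rw [← e] at z1 z2
        have hs' : s ∈ Ioo a b := ⟨lt_of_le_of_ne hs.1 fun h => z1 (by rw [h]),
          lt_of_le_of_ne hs.2 fun h => z2 (by rw [h])⟩
        have e1 := (arg_lfac_sub (τ := s) hb).1 hs'
        have e2 := (arg_lfac_sub (τ := τ) hb).1 ⟨ha, hτb⟩
        rw [argDefect, ← e]; linarith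
      · exact absurd (by rw [hτb]) z4
      · obtain ⟨s, hs, e⟩ := h1 τ ⟨hτb.le, hτ.2.le⟩
        rw [← e] at z1 z2
        have hs' : s ∈ Ioo b (a + 2 * Real.pi) := ⟨lt_of_le_of_ne hs.1 fun h => z2 (by rw [h]),
          lt_of_le_of_ne hs.2 fun h => z1 (by rw [h, cis_add_two_pi])⟩
        have e1 := (arg_lfac_sub (τ := s) hb).2 hs' hab
        have e2 := (arg_lfac_sub (τ := τ) hb).2 ⟨hτb, hτ.2⟩ hab
        rw [argDefect, ← e]; linarith
    rw [norm_barrier z1 z2 z3 z4, hdef, mul_zero, Real.exp_zero, mul_one]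
    have b1 := hpow (norm_nonneg _) (norm_lfac_le hφv a) hε
    have b2 := hpow (norm_nonneg _) (norm_lfac_le hφv b) hε
    have b3 := hpow (norm_nonneg _) (norm_lfac_le hv.le a) hε
    have b4 := hpow (norm_nonneg _) (norm_lfac_le hv.le b) hε
    gcongr
  have hw1 : ‖w‖ < 1 := by simpa using hw
  have hw2 : ‖φ w‖ < 1 := by simpa using hm hw
  have nz : ∀ {v : ℂ}, ‖v‖ < 1 → ∀ θ, lfac θ v ≠ 0 := fun hv θ h =>
    ne_cis_of_norm_lt hv θ (lfac_eq_zero_iff.1 h)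
  have nb : ∀ ε, ‖barrier φ a b σ ε w‖ = _ := fun ε =>
    norm_barrier (nz hw2 a) (nz hw2 b) (nz hw1 a) (nz hw1 b)
  have lim : ∀ x : ℝ, x ≠ 0 → Tendsto (fun ε : ℝ => x ^ ε) (𝓝[>] 0) (𝓝 1) := by
    intro x hx
    have := (Real.continuousAt_const_rpow (b := 0) hx).tendsto
    rw [Real.rpow_zero] at this
    exact this.mono_left nhdsWithin_le_nhds
  have hl : Tendsto (fun ε => ‖barrier φ a b σ ε w‖) (𝓝[>] 0)
      (𝓝 (Real.exp (σ * argDefect φ a b w))) := by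
    simp only [nb]
    have n : ∀ {v : ℂ}, ‖v‖ < 1 → ∀ θ, ‖lfac θ v‖ ≠ 0 := fun hv θ => norm_ne_zero_iff.2 (nz hv θ)
    have := (((lim _ (n hw2 a)).mul (lim _ (n hw2 b))).mul
      ((lim _ (n hw1 a)).mul (lim _ (n hw1 b)))).mul_const (Real.exp (σ * argDefect φ a b w))
    simpa using this
  have hr : Tendsto (fun ε : ℝ => (2 : ℝ) ^ ε * 2 ^ ε * (2 ^ ε * 2 ^ ε)) (𝓝[>] 0) (𝓝 1) := by
    have l2 := lim 2 two_ne_zero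
    simpa using (l2.mul l2).mul (l2.mul l2)
  have := le_of_tendsto_of_tendsto hl hr (by
    filter_upwards [self_mem_nhdsWithin] with ε hε using bound ε hε)
  rwa [Real.exp_le_one_iff] at this

/-- A holomorphic self-map of the disk that preserves three boundary arcs and fixes one of their
endpoints is the identity. -/
theorem eqOn_id_of_arcs {φ : ℂ → ℂ} (hφ : ContinuousOn φ (closedBall 0 1))
    (hφ' : DifferentiableOn ℂ φ (ball 0 1)) (hm : MapsTo φ (ball 0 1) (ball 0 1))
    (hmc : MapsTo φ (closedBall 0 1) (closedBall 0 1)) {a b c : ℝ} (hab : a < b) (hbc : b < c)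
    (hca : c < a + 2 * Real.pi) (h0 : ∀ τ ∈ Icc a b, φ (cis τ) ∈ cis '' Icc a b)
    (h1 : ∀ τ ∈ Icc b c, φ (cis τ) ∈ cis '' Icc b c)
    (h2 : ∀ τ ∈ Icc c (a + 2 * Real.pi), φ (cis τ) ∈ cis '' Icc c (a + 2 * Real.pi))
    (hc : φ (cis c) = cis c) : EqOn φ id (closedBall 0 1) := by
  have h12 : ∀ τ ∈ Icc b (a + 2 * Real.pi), φ (cis τ) ∈ cis '' Icc b (a + 2 * Real.pi) := by
    intro τ hτ
    rcases le_total τ c with h | h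
    · exact image_mono (Icc_subset_Icc_right hca.le) (h1 τ ⟨hτ.1, h⟩)
    · exact image_mono (Icc_subset_Icc_left hbc.le) (h2 τ ⟨h, hτ.2⟩)
  set h : ℂ → ℂ := fun w => Complex.log (lfac a (φ w)) - Complex.log (lfac b (φ w)) -
    Complex.log (lfac a w) + Complex.log (lfac b w)
  have hd : DifferentiableOn ℂ h (ball 0 1) :=
    (((differentiableOn_log_lfac hφ' hm a).sub (differentiableOn_log_lfac hφ' hm b)).sub
      (differentiableOn_log_lfac differentiableOn_id (mapsTo_id _) a)).add
      (differentiableOn_log_lfac differentiableOn_id (mapsTo_id _) b)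
  -- A holomorphic function with vanishing imaginary part is constant, so φ preserves the Möbius
  -- coordinate up to the factor e^v. The fixed point e^{ic} then forces e^v = 1.
  obtain ⟨v, hv⟩ := exists_const_of_im_eq_zero hd fun w hw => by
    have e1 := argDefect_nonpos hφ hφ' hm hmc hab (by linarith) h0 h12 1 hw
    have e2 := argDefect_nonpos hφ hφ' hm hmc hab (by linarith) h0 h12 (-1) hw
    have e3 : (h w).im = argDefect φ a b w := by simp [h, argDefect, Complex.log_im]
    linarith
  have nz : ∀ {v : ℂ}, v ∈ ball (0 : ℂ) 1 → ∀ θ, lfac θ v ≠ 0 := fun hv θ h =>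
    ne_cis_of_norm_lt (by simpa using hv) θ (lfac_eq_zero_iff.1 h)
  have e1 : EqOn (fun w => lfac a (φ w) * lfac b w)
      (fun w => Complex.exp v * (lfac b (φ w) * lfac a w)) (ball 0 1) := by
    intro w hw
    simp only [← hv w hw, h]
    rw [Complex.exp_add, Complex.exp_sub, Complex.exp_sub, Complex.exp_log (nz (hm hw) a),
      Complex.exp_log (nz (hm hw) b), Complex.exp_log (nz hw a), Complex.exp_log (nz hw b)]
    have := nz (hm hw) b
    have := nz hw a
    field_simp
  have cl : ∀ {ψ : ℂ → ℂ}, ContinuousOn ψ (closedBall 0 1) → ∀ θ,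
      ContinuousOn (fun w => lfac θ (ψ w)) (closedBall 0 1) := fun hψ θ =>
    (continuous_lfac θ).comp_continuousOn hψ
  have e2 := e1.of_subset_closure ((cl hφ a).mul (cl continuousOn_id b))
    (continuousOn_const.mul ((cl hφ b).mul (cl continuousOn_id a))) ball_subset_closedBall
    (by rw [closure_ball _ one_ne_zero])
  have na : lfac a (cis c) ≠ 0 := by
    rw [Ne, lfac_eq_zero_iff]; exact (cis_ne_of_lt (hab.trans hbc) hca).symm
  have nb : lfac b (cis c) ≠ 0 := by
    rw [Ne, lfac_eq_zero_iff]; exact (cis_ne_of_lt hbc (by linarith)).symm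
  have hexp : Complex.exp v = 1 := by
    have e3 := e2 (cis_mem_closedBall c)
    simp only [hc] at e3
    have : (Complex.exp v - 1) * (lfac a (cis c) * lfac b (cis c)) = 0 := by
      linear_combination -e3
    have := (mul_eq_zero.1 this).resolve_right (mul_ne_zero na nb)
    linear_combination this
  intro w hw
  have e3 := e2 hw
  simp only [hexp, one_mul, id, lfac] at e3 ⊢
  have hne : cis (-b) - cis (-a) ≠ 0 := by
    rw [sub_ne_zero]
    have := cis_ne_of_lt (a := -b) (b := -a) (by linarith) (by linarith)
    exact this
  have : (φ w - w) * (cis (-b) - cis (-a)) = 0 := by linear_combination e3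
  exact sub_eq_zero.1 ((mul_eq_zero.1 this).resolve_right hne)

/-- A holomorphic disk with vertices `A₀, A₁, A₂` and boundary on the lines through them. -/
structure IsHolTriangle (F : ℂ → ℂ) (a b c : ℝ) (A₀ A₁ A₂ : ℂ) : Prop where
  cont : ContinuousOn F (closedBall 0 1)
  diff : DifferentiableOn ℂ F (ball 0 1)
  vert₀ : F (cis a) = A₀
  vert₁ : F (cis b) = A₁
  vert₂ : F (cis c) = A₂
  edge₀ : ∀ τ ∈ Icc a b, cr A₀ A₁ (F (cis τ)) = 0
  edge₁ : ∀ τ ∈ Icc b c, cr A₁ A₂ (F (cis τ)) = 0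
  edge₂ : ∀ τ ∈ Icc c (a + 2 * Real.pi), cr A₂ A₀ (F (cis τ)) = 0

theorem IsTriangleMap.vert {F : ℂ → ℂ} {a b c : ℝ} {A₀ A₁ A₂ : ℂ}
    (h : IsTriangleMap F a b c A₀ A₁ A₂) (hab : a < b) (hbc : b < c) :
    F (cis a) = A₀ ∧ F (cis b) = A₁ ∧ F (cis c) = A₂ := by
  obtain ⟨ρ₀, m0, z0, o0, f0⟩ := h.edge₀
  obtain ⟨ρ₁, m1, z1, o1, f1⟩ := h.edge₁
  refine ⟨?_, ?_, ?_⟩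
  · rw [f0 a (left_mem_Icc.2 hab.le), z0]; simp
  · rw [f0 b (right_mem_Icc.2 hab.le), o0]; simp
  · rw [f1 c (right_mem_Icc.2 hbc.le), o1]; simp

theorem isClosed_closedTri (A₀ A₁ A₂ : ℂ) : IsClosed (closedTri A₀ A₁ A₂) :=
  (isClosed_le continuous_const (continuous_cr _ _)).inter
    ((isClosed_le continuous_const (continuous_cr _ _)).inter
      (isClosed_le continuous_const (continuous_cr _ _)))

/-- Holomorphic triangles are unique. -/
theorem IsHolTriangle.eqOn {F F₀ : ℂ → ℂ} {a b c : ℝ} {A₀ A₁ A₂ : ℂ}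
    (h : IsHolTriangle F a b c A₀ A₁ A₂) (h₀ : IsTriangleMap F₀ a b c A₀ A₁ A₂) (hab : a < b)
    (hbc : b < c) (hca : c < a + 2 * Real.pi) (hA : 0 < cr A₀ A₁ A₂) :
    EqOn F F₀ (closedBall 0 1) := by
  obtain ⟨K, hK⟩ := h₀.exists_inverse hab hbc hca hA
  have hA1 : 0 < cr A₁ A₂ A₀ := by rwa [cr_rotate]
  have hA2 : 0 < cr A₂ A₀ A₁ := by rwa [cr_rotate]
  have hm : MapsTo F (ball 0 1) (openTri A₀ A₁ A₂) := by
    refine mapsTo_openTri h.cont h.diff ?_ hA ?_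
    · rintro ⟨v, hv⟩
      have : EqOn F (fun _ => v) (closedBall 0 1) :=
        (show EqOn F (fun _ => v) (ball 0 1) from hv).of_subset_closure h.cont continuousOn_const
          ball_subset_closedBall (by rw [closure_ball _ one_ne_zero])
      refine ne_of_cr_pos hA ?_
      rw [← h.vert₀, ← h.vert₁, this (cis_mem_closedBall a), this (cis_mem_closedBall b)]
    · intro w hw
      obtain ⟨τ, rfl, hτ | hτ | hτ⟩ := exists_arc hw a b c
      · exact Or.inl (h.edge₀ τ (Ico_subset_Icc_self hτ))
      · exact Or.inr (Or.inl (h.edge₁ τ (Ico_subset_Icc_self hτ)))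
      · exact Or.inr (Or.inr (h.edge₂ τ (Ico_subset_Icc_self hτ)))
  have hmc : MapsTo F (closedBall 0 1) (closedTri A₀ A₁ A₂) := by
    have := (hm.mono_right (openTri_subset_closedTri A₀ A₁ A₂)).closure_of_continuousOn
      (by rw [closure_ball _ one_ne_zero]; exact h.cont)
    rwa [closure_ball _ one_ne_zero, (isClosed_closedTri _ _ _).closure_eq] at this
  obtain ⟨ρ₀, m0, z0, o0, f0⟩ := h₀.edge₀
  obtain ⟨ρ₁, m1, z1, o1, f1⟩ := h₀.edge₁
  obtain ⟨ρ₂, m2, z2, o2, f2⟩ := h₀.edge₂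
  have arc : ∀ {p q : ℝ} {P Q R : ℂ} {ρ : ℝ → ℝ}, p < q → 0 < cr P Q R → ρ p = 0 → ρ q = 1 →
      (∀ τ ∈ Icc p q, F₀ (cis τ) = P + ρ τ * (Q - P)) → closedTri P Q R = closedTri A₀ A₁ A₂ →
      ∀ τ, cr P Q (F (cis τ)) = 0 → (K ∘ F) (cis τ) ∈ cis '' Icc p q := by
    intro p q P Q R ρ hpq hP z o f hT τ hτ
    obtain ⟨s, hs, e⟩ := mem_edge_of_cr_eq_zero hP (hT ▸ hmc (cis_mem_closedBall τ)) hτ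
    obtain ⟨σ, hσ, e'⟩ := edge_surj h₀.cont hpq (ne_of_cr_pos hP) z o f hs
    refine ⟨σ, hσ, ?_⟩
    rw [Function.comp_apply, e, ← e', hK.left_inv _ (cis_mem_closedBall σ)]
  -- The map F is only known to send the arcs into lines; being confined to the closed triangle, it
  -- sends them into the edges, so K ∘ F preserves the three arcs.
  have := eqOn_id_of_arcs (φ := K ∘ F) (hK.inv_cont.comp h.cont hmc)
    (hK.inv_diff.comp h.diff hm) (hK.inv_mapsTo.comp hm) (hK.inv_mapsTo_closed.comp hmc) hab hbc hca
    (fun τ hτ => arc hab hA z0 o0 f0 rfl τ (h.edge₀ τ hτ))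
    (fun τ hτ => arc hbc hA1 z1 o1 f1 (closedTri_rotate _ _ _) τ (h.edge₁ τ hτ))
    (fun τ hτ => arc hca hA2 z2 o2 f2 (by rw [closedTri_rotate, closedTri_rotate]) τ (h.edge₂ τ hτ))
    (by rw [Function.comp_apply, h.vert₂, ← (h₀.vert hab hbc).2.2,
      hK.left_inv _ (cis_mem_closedBall c)])
  intro w hw
  have e := this hw
  simp only [Function.comp_apply, id] at e
  rw [← hK.right_inv _ (hmc hw), e]

end TorusFloer
end

noncomputable section
namespace TorusFloer

open Complex Set Filter Topology MeasureTheory Metric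

/-! ### Points of the torus -/

theorem coe_eq_coe_iff {x y : ℝ} : (x : UnitAddCircle) = y ↔ ∃ n : ℤ, x = y + n := by
  rw [← sub_eq_zero, ← AddCircle.coe_sub, AddCircle.coe_eq_zero_iff]
  constructor
  · rintro ⟨n, hn⟩
    exact ⟨n, by rw [zsmul_eq_mul, mul_one] at hn; linarith⟩
  · rintro ⟨n, hn⟩
    exact ⟨n, by rw [zsmul_eq_mul, mul_one]; linarith⟩

theorem pt_eq_pt_iff {p q : ℝ × ℝ} :
    pt p = pt q ↔ (∃ n : ℤ, p.1 = q.1 + n) ∧ ∃ n : ℤ, p.2 = q.2 + n := by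
  rw [pt, pt, Prod.mk.injEq, coe_eq_coe_iff, coe_eq_coe_iff]

theorem pt_mem_Lag_iff {p : ℝ × ℝ} {m : ℤ} : pt p ∈ Lag m ↔ ∃ n : ℤ, p.2 + m * p.1 = n := by
  constructor
  · rintro ⟨x, hx⟩
    obtain ⟨⟨i, hi⟩, j, hj⟩ := pt_eq_pt_iff.1 hx
    refine ⟨-j - m * i, ?_⟩
    simp only at hi hj
    push_cast
    rw [hi] at hj
    linarith
  · rintro ⟨n, hn⟩
    exact ⟨p.1, pt_eq_pt_iff.2 ⟨⟨0, by simp⟩, -n, by push_cast; linarith⟩⟩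

theorem dehn_iterate_pt (n : ℕ) (x y : ℝ) : dehn^[n] (pt (x, y)) = pt (x, y - n * x) := by
  induction n with
  | zero => simp
  | succ n ih =>
    rw [Function.iterate_succ_apply', ih]
    simp only [dehn, pt, Prod.mk.injEq, true_and]
    rw [← AddCircle.coe_sub]
    congr 1
    push_cast
    ring

theorem coe_xGen (m : ℕ) (k : ℤ) : (xGen m k : Torus) = pt ((k : ℝ) / m, 0) := rfl

theorem coe_twistedGen (m₁ m₂ : ℕ) (k : ℤ) :
    (twistedGen m₁ m₂ k : Torus) = pt ((k : ℝ) / m₂, -(m₁ * ((k : ℝ) / m₂))) := by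
  change dehn^[m₁] (xGen m₂ k : Torus) = _
  rw [coe_xGen, dehn_iterate_pt, zero_sub]

/-- A continuous function with integral values is constant on connected sets. -/
theorem eq_of_integral_values {X : Type*} [TopologicalSpace X] {S : Set X} (hS : IsPreconnected S)
    {f : X → ℝ} (hf : ContinuousOn f S) (h : ∀ x ∈ S, ∃ n : ℤ, f x = n) {x y : X} (hx : x ∈ S)
    (hy : y ∈ S) : f x = f y := by
  wlog hlt : f x < f y generalizing x y
  · rcases lt_trichotomy (f x) (f y) with h1 | h1 | h1
    · exact this hx hy h1
    · exact h1
    · exact (this hy hx h1).symm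
  obtain ⟨n, hn⟩ := h x hx
  obtain ⟨m, hm⟩ := h y hy
  have hnm : n + 1 ≤ m := by
    rw [hn, hm] at hlt
    have : n < m := by exact_mod_cast hlt
    omega
  have hnm' : (n : ℝ) + 1 ≤ m := by exact_mod_cast hnm
  have ho := (hS.image f hf).ordConnected.out (mem_image_of_mem f hx) (mem_image_of_mem f hy)
  obtain ⟨z, hz, e⟩ := ho (show (n : ℝ) + 1 / 2 ∈ Icc (f x) (f y) by
    rw [hn, hm]; constructor <;> linarith)
  obtain ⟨k, hk⟩ := h z hz
  rw [hk] at e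
  have : (2 * k : ℤ) = 2 * n + 1 := by
    have : (2 * k : ℝ) = 2 * n + 1 := by linarith
    exact_mod_cast this
  omega

/-! ### The linear isomorphism with the complex plane -/

namespace CxStructure

variable (𝒥 : CxStructure)

theorem im_pos : 0 < (𝒥.J (1, 0)).2 := by
  have := 𝒥.pos (1, 0) (by simp)
  simpa using this

/-- The image of `(0, 1)` under the complex linear isomorphism `ℝ² → ℂ` with `(1, 0) ↦ 1`. -/
def tau : ℂ := (-((𝒥.J (1, 0)).1 : ℂ) + I) / ((𝒥.J (1, 0)).2 : ℝ)

theorem tau_im : 𝒥.tau.im = 1 / (𝒥.J (1, 0)).2 := by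
  rw [tau, Complex.div_ofReal_im]; simp

theorem tau_im_pos : 0 < 𝒥.tau.im := by
  rw [tau_im]; exact one_div_pos.2 𝒥.im_pos

/-- The complex linear isomorphism `ℝ² → ℂ` with `(1, 0) ↦ 1`. -/
def toComplex : (ℝ × ℝ) ≃L[ℝ] ℂ :=
  LinearEquiv.toContinuousLinearEquiv
  { toFun := fun v => v.1 + 𝒥.tau * v.2
    map_add' := fun v w => by simp only [Prod.fst_add, Prod.snd_add]; push_cast; ring
    map_smul' := fun r v => by simp; ring
    invFun := fun z => (z.re - 𝒥.tau.re * (z.im / 𝒥.tau.im), z.im / 𝒥.tau.im)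
    left_inv := fun v => by
      have := 𝒥.tau_im_pos.ne'
      ext
      · simp; field_simp; ring
      · simp; field_simp
    right_inv := fun z => by
      have := 𝒥.tau_im_pos.ne'
      apply Complex.ext
      · simp
      · simp; field_simp }

theorem toComplex_apply (v : ℝ × ℝ) : 𝒥.toComplex v = v.1 + 𝒥.tau * v.2 := rfl

theorem toComplex_J (v : ℝ × ℝ) : 𝒥.toComplex (𝒥.J v) = I * 𝒥.toComplex v := by
  obtain ⟨p, q, hpq⟩ : ∃ p q : ℝ, 𝒥.J (1, 0) = (p, q) := ⟨_, _, rfl⟩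
  have hq : 0 < q := by have := 𝒥.im_pos; rwa [hpq] at this
  have hqc : (q : ℂ) ≠ 0 := by exact_mod_cast hq.ne'
  have htau : 𝒥.tau = (-(p : ℂ) + I) / q := by rw [tau, hpq]
  have dec : ∀ x y : ℝ, ((x, y) : ℝ × ℝ) = x • (1, 0) + y • (0, 1) := by intro x y; simp
  -- Write J(1, 0) = (p, q). Applying J once more and using J² = -1 determines the second column.
  have h2 : 𝒥.J (0, 1) = ((-1 - p ^ 2) / q, -p) := by
    have h := 𝒥.sq (1, 0)
    rw [hpq, dec p q, map_add, map_smul, map_smul, hpq] at h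
    have h1 := congrArg Prod.fst h
    have h2 := congrArg Prod.snd h
    simp only [Prod.smul_mk, Prod.fst_add, Prod.snd_add, smul_eq_mul, Prod.smul_fst, Prod.smul_snd,
      Prod.neg_mk] at h1 h2
    ext
    · simp only; field_simp; linarith
    · simp only
      have : q * (𝒥.J (0, 1)).2 = q * (-p) := by linarith
      exact mul_left_cancel₀ hq.ne' this
  obtain ⟨x, y⟩ := v
  rw [dec x y, map_add, map_smul, map_smul, map_add, map_add, map_smul, map_smul, map_smul, map_smul,
    hpq, h2]
  simp only [toComplex_apply, htau, Complex.real_smul]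
  push_cast
  field_simp
  linear_combination (-y : ℂ) * I_sq

/-- Twice the signed area of a triangle in `ℝ²`. -/
def _root_.TorusFloer.cr2 (P Q w : ℝ × ℝ) : ℝ :=
  (Q.1 - P.1) * (w.2 - P.2) - (Q.2 - P.2) * (w.1 - P.1)

theorem cr_toComplex (P Q w : ℝ × ℝ) :
    cr (𝒥.toComplex P) (𝒥.toComplex Q) (𝒥.toComplex w) = 𝒥.tau.im * cr2 P Q w := by
  simp only [cr, cr2, toComplex_apply]
  simp
  ring

/-- A real differentiable map with `J`-linear differential becomes holomorphic. -/
theorem hasDerivAt_toComplex {U : ℂ → ℝ × ℝ} {w : ℂ} (hd : DifferentiableAt ℝ U w)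
    (h : ∀ v : ℂ, fderiv ℝ U w (I * v) = 𝒥.J (fderiv ℝ U w v)) :
    HasDerivAt (fun z => 𝒥.toComplex (U z)) (𝒥.toComplex (fderiv ℝ U w 1)) w := by
  have h1 : HasFDerivAt (fun z => 𝒥.toComplex (U z))
      ((𝒥.toComplex : (ℝ × ℝ) →L[ℝ] ℂ).comp (fderiv ℝ U w)) w :=
    (𝒥.toComplex : (ℝ × ℝ) →L[ℝ] ℂ).hasFDerivAt.comp w hd.hasFDerivAt
  rw [hasDerivAt_iff_hasFDerivAt]
  refine hasFDerivAt_of_restrictScalars ℝ h1 ?_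
  ext v
  have h2 := h 1
  rw [mul_one] at h2
  have h3 : v = v.re • (1 : ℂ) + v.im • I := by
    simp only [Complex.real_smul, mul_one]; exact (Complex.re_add_im v).symm
  have h4 : 𝒥.toComplex (fderiv ℝ U w v) = v * 𝒥.toComplex (fderiv ℝ U w 1) := by
    rw [h3]
    rw [map_add, map_add, map_smul, map_smul, map_smul, map_smul, h2, toComplex_J]
    simp only [Complex.real_smul]
    ring
  simp [h4]

end CxStructure

end TorusFloer
end

noncomputable section
namespace TorusFloer

open Complex Set Filter Topology MeasureTheory Metric

/-! ### Arcs -/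

theorem ccwArc_exp {a b : ℝ} (hab : a < b) (hb : b < a + 2 * Real.pi) :
    ccwArc (Circle.exp a) (Circle.exp b) = Circle.exp '' Icc a b := by
  ext w
  constructor
  · rintro ⟨α, β, θ, hα, hβ, rfl, h1, h2, h3⟩
    obtain ⟨n, hn⟩ := Circle.exp_eq_exp.1 hα
    obtain ⟨k, hk⟩ := Circle.exp_eq_exp.1 hβ
    have hp := Real.two_pi_pos
    -- Both angular gaps, β - α and b - a, lie in [0, 2π) and differ by a multiple of 2π, so the two
    -- endpoints are shifted by the same number of turns.
    have hkn : k = n := by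
      have l : ((k : ℝ) - n - 1) * (2 * Real.pi) < 0 := by nlinarith
      have u : 0 < ((k : ℝ) - n + 1) * (2 * Real.pi) := by nlinarith
      have l' : (k : ℝ) - n - 1 < 0 := by
        by_contra! hc; nlinarith
      have u' : 0 < (k : ℝ) - n + 1 := by
        by_contra! hc; nlinarith
      have : k - n - 1 < 0 := by exact_mod_cast l'
      have : 0 < k - n + 1 := by exact_mod_cast u'
      omega
    subst hkn
    refine ⟨θ - k * (2 * Real.pi), ⟨by linarith, by linarith⟩, ?_⟩
    exact Circle.exp_eq_exp.2 ⟨-k, by push_cast; ring⟩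
  · rintro ⟨τ, hτ, rfl⟩
    exact ⟨a, b, τ, rfl, rfl, rfl, hτ.1, hτ.2, hb⟩

theorem exp_eq_exp_of_mem_Icc {a b x y : ℝ} (hb : b < a + 2 * Real.pi) (hx : x ∈ Icc a b)
    (hy : y ∈ Icc a b) (h : Circle.exp x = Circle.exp y) : x = y := by
  have h' : cis x = cis y := by rw [← circle_exp_eq_cis, h, circle_exp_eq_cis]
  exact cis_injOn a ⟨hx.1, hx.2.trans_lt hb⟩ ⟨hy.1, hy.2.trans_lt hb⟩ h'

theorem circle_exp_add_two_pi (a : ℝ) : Circle.exp (a + 2 * Real.pi) = Circle.exp a :=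
  Circle.exp_eq_exp.2 ⟨1, by push_cast; ring⟩

theorem exists_circle_exp (w : Circle) (a : ℝ) :
    ∃ τ ∈ Ico a (a + 2 * Real.pi), Circle.exp τ = w := by
  obtain ⟨τ, hτ, h⟩ := exists_cis_of_norm (Circle.norm_coe w) a
  exact ⟨τ, hτ, Circle.ext (by rw [circle_exp_eq_cis, h])⟩

theorem coe_bdry_exp (τ : ℝ) : ((bdry (Circle.exp τ) : Disk) : ℂ) = cis τ := circle_exp_eq_cis τ

theorem HolTriangle.exists_angles {𝒥 : CxStructure} {L : Fin 3 → Set Torus} {x : Fin 3 → Torus}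
    (s : HolTriangle 𝒥 L x) : ∃ a b c : ℝ, a < b ∧ b < c ∧ c < a + 2 * Real.pi ∧
      Circle.exp a = s.z 0 ∧ Circle.exp b = s.z 1 ∧ Circle.exp c = s.z 2 := by
  obtain ⟨a, -, ha⟩ := exists_circle_exp (s.z 0) 0
  obtain ⟨b, hb, hb'⟩ := exists_circle_exp (s.z 1) a
  obtain ⟨c, hc, hc'⟩ := exists_circle_exp (s.z 2) a
  have n01 : a ≠ b := by
    rintro rfl
    exact absurd (s.inj (ha.symm.trans hb')) (by decide)
  have hab : a < b := lt_of_le_of_ne hb.1 n01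
  refine ⟨a, b, c, hab, ?_, hc.2, ha, hb', hc'⟩
  by_contra! hcb
  have h := s.ccw 0 2
  rw [zero_add, ← ha, ← hb', ccwArc_exp hab hb.2] at h
  have := h ⟨c, ⟨hc.1, hcb⟩, hc'⟩
  revert this
  decide

/-- The marked points with given angles are in counterclockwise order. -/
theorem ccw_of_angles {a b c : ℝ} (hab : a < b) (hbc : b < c) (hca : c < a + 2 * Real.pi)
    (z : Fin 3 → Circle) (h0 : z 0 = Circle.exp a) (h1 : z 1 = Circle.exp b)
    (h2 : z 2 = Circle.exp c) :
    Function.Injective z ∧ ∀ i k, z k ∈ ccwArc (z i) (z (i + 1)) → k = i ∨ k = i + 1 := by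
  have key : ∀ {p q r : ℝ}, p < q → q < r → r < p + 2 * Real.pi →
      Circle.exp r ∉ ccwArc (Circle.exp p) (Circle.exp q) := by
    intro p q r h1 h2 h3
    rw [ccwArc_exp h1 (by linarith)]
    rintro ⟨τ, hτ, e⟩
    have := exp_eq_exp_of_mem_Icc h3 (x := τ) (y := r) ⟨hτ.1, by linarith [hτ.2]⟩
      ⟨by linarith, le_rfl⟩ e
    linarith [hτ.2]
  have ne : ∀ {p q : ℝ}, p < q → q < p + 2 * Real.pi → Circle.exp p ≠ Circle.exp q := by
    intro p q h1 h2 e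
    have := exp_eq_exp_of_mem_Icc h2 (left_mem_Icc.2 h1.le) (right_mem_Icc.2 h1.le) e
    linarith
  have n01 : z 0 ≠ z 1 := by rw [h0, h1]; exact ne hab (by linarith)
  have n12 : z 1 ≠ z 2 := by rw [h1, h2]; exact ne hbc (by linarith)
  have n02 : z 0 ≠ z 2 := by rw [h0, h2]; exact ne (hab.trans hbc) hca
  constructor
  · intro i j hij
    fin_cases i <;> fin_cases j
    exacts [rfl, absurd hij n01, absurd hij n02, absurd hij.symm n01, rfl, absurd hij n12,
      absurd hij.symm n02, absurd hij.symm n12, rfl]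
  · have k0 : z 2 ∉ ccwArc (z 0) (z 1) := by rw [h0, h1, h2]; exact key hab hbc hca
    have k1 : z 0 ∉ ccwArc (z 1) (z 2) := by
      rw [h0, h1, h2, ← circle_exp_add_two_pi a]; exact key hbc hca (by linarith)
    have k2 : z 1 ∉ ccwArc (z 2) (z 0) := by
      rw [h0, h1, h2, ← circle_exp_add_two_pi a, ← circle_exp_add_two_pi b]
      exact key hca (by linarith) (by linarith)
    intro i k h
    fin_cases i <;> fin_cases k
    exacts [Or.inl rfl, Or.inr rfl, absurd h k0, absurd h k1, Or.inl rfl, Or.inr rfl, Or.inr rfl,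
      absurd h k2, Or.inl rfl]

/-! ### Normalized lifts -/

/-- Triangles that contribute to the product of the theorem. -/
abbrev ProductTriangle (𝒥 : CxStructure) (m₁ m₂ : ℕ) (k₁ k₂ : ℤ) (y : Torus) : Type :=
  Triangle 𝒥 0 m₁ ((m₁ : ℤ) + m₂) ![y, xGen m₁ k₁, twistedGen m₁ m₂ k₂]

/-- The first vertex of the lifted triangle. -/
def vert₀ (m₁ m₂ : ℕ) (u v : ℝ) : ℝ × ℝ := (Efun m₁ m₂ u v, 0)

/-- The second vertex of the lifted triangle. -/
def vert₁ (u : ℝ) : ℝ × ℝ := (u, 0)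

/-- The third vertex of the lifted triangle. -/
def vert₂ (m₁ : ℕ) (u v : ℝ) : ℝ × ℝ := (v, m₁ * (u - v))

/-- `W` maps the disk to the plane with the marked points at angles `a, b, c` going to the vertices
and the boundary arcs to the lines through them. -/
structure IsPlaneTriangle (𝒥 : CxStructure) (m₁ m₂ : ℕ) (u v : ℝ) (a b c : ℝ) (W : ℂ → ℝ × ℝ) :
    Prop where
  hab : a < b
  hbc : b < c
  hca : c < a + 2 * Real.pi
  cont : ContinuousOn W (closedBall 0 1)
  diff : DifferentiableOn ℂ (fun w => 𝒥.toComplex (W w)) (ball 0 1)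
  vert₀ : W (cis a) = vert₀ m₁ m₂ u v
  vert₁ : W (cis b) = vert₁ u
  vert₂ : W (cis c) = vert₂ m₁ u v
  edge₀ : ∀ τ ∈ Icc a b, (W (cis τ)).2 = 0
  edge₁ : ∀ τ ∈ Icc b c, (W (cis τ)).2 + m₁ * (W (cis τ)).1 = m₁ * u
  edge₂ : ∀ τ ∈ Icc c (a + 2 * Real.pi),
    (W (cis τ)).2 + (m₁ + m₂) * (W (cis τ)).1 = m₁ * u + m₂ * v

theorem HolTriangle.isHolLift {𝒥 : CxStructure} {L : Fin 3 → Set Torus} {x : Fin 3 → Torus}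
    (s : HolTriangle 𝒥 L x) : IsHolLift 𝒥 s.z s.u s.lift := Classical.choose_spec s.hol

theorem ball_subset_compl_marked (z : Fin 3 → Circle) :
    ball (0 : ℂ) 1 ⊆ closedBall 0 1 \ range fun i => (z i : ℂ) := by
  intro w hw
  refine ⟨ball_subset_closedBall hw, ?_⟩
  rintro ⟨i, rfl⟩
  rw [mem_ball_zero_iff, Circle.norm_coe] at hw
  exact hw.false

theorem IsHolLift.differentiableAt {𝒥 : CxStructure} {z : Fin 3 → Circle} {u : C(Disk, Torus)}
    {U : ℂ → ℝ × ℝ} (h : IsHolLift 𝒥 z u U) {w : ℂ} (hw : w ∈ ball (0 : ℂ) 1) :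
    DifferentiableAt ℝ U w :=
  (h.smooth.contDiffAt (mem_of_superset (isOpen_ball.mem_nhds hw)
    (ball_subset_compl_marked z))).differentiableAt (by simp)

theorem IsHolLift.hasDerivAt {𝒥 : CxStructure} {z : Fin 3 → Circle} {u : C(Disk, Torus)}
    {U : ℂ → ℝ × ℝ} (h : IsHolLift 𝒥 z u U) {w : ℂ} (hw : w ∈ ball (0 : ℂ) 1) :
    HasDerivAt (fun z => 𝒥.toComplex (U z)) (𝒥.toComplex (fderiv ℝ U w 1)) w :=
  𝒥.hasDerivAt_toComplex (h.differentiableAt hw) (h.hol w hw)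

/-- The quantity `y + m x` is constant along a boundary arc that is mapped to `Lag m`. -/
theorem lift_arc_const {u : Disk → Torus} {W : ℂ → ℝ × ℝ} (hW : ContinuousOn W (closedBall 0 1))
    (hlift : ∀ w : Disk, pt (W w) = u w) {m : ℤ} {p q : ℝ}
    (h : ∀ τ ∈ Icc p q, u (bdry (Circle.exp τ)) ∈ Lag m) {x y : ℝ} (hx : x ∈ Icc p q)
    (hy : y ∈ Icc p q) :
    (W (cis x)).2 + m * (W (cis x)).1 = (W (cis y)).2 + m * (W (cis y)).1 := by
  have hc : Continuous fun τ => W (cis τ) := hW.comp_continuous continuous_cis cis_mem_closedBall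
  refine eq_of_integral_values (f := fun τ => (W (cis τ)).2 + m * (W (cis τ)).1)
    (isPreconnected_Icc (a := p) (b := q))
    ((continuous_snd.comp hc).add (continuous_const.mul (continuous_fst.comp hc))).continuousOn
    ?_ hx hy
  intro τ hτ
  have := h τ hτ
  rw [← hlift, coe_bdry_exp] at this
  exact pt_mem_Lag_iff.1 this

/-- The lift is translated so that the second vertex is exactly (k₁/m₁, 0). Constancy of y + m x
along the arcs then places every edge on a definite line; ℓ records the remaining freedom in the
third vertex, and the first vertex is the intersection of two of the lines. -/
theorem exists_isPlaneTriangle {𝒥 : CxStructure} {m₁ m₂ : ℕ} (hm₁ : 0 < m₁) (hm₂ : 0 < m₂)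
    {k₁ k₂ : ℤ} {y : Torus} (s : ProductTriangle 𝒥 m₁ m₂ k₁ k₂ y) :
    ∃ (a b c : ℝ) (ℓ : ℤ) (W : ℂ → ℝ × ℝ),
      IsPlaneTriangle 𝒥 m₁ m₂ ((k₁ : ℝ) / m₁) ((k₂ : ℝ) / m₂ + ℓ) a b c W ∧
      Circle.exp a = s.z 0 ∧ Circle.exp b = s.z 1 ∧ Circle.exp c = s.z 2 ∧
      ∃ i j : ℤ, ∀ w, W w = s.lift w + ((i : ℝ), (j : ℝ)) := by
  obtain ⟨a, b, c, hab, hbc, hca, ha, hb, hc⟩ := s.exists_angles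
  have hU := s.isHolLift
  set U := s.lift
  have hm₁' : (m₁ : ℝ) ≠ 0 := by positivity
  have hm₂' : (m₂ : ℝ) ≠ 0 := by positivity
  have hv1 := s.vertex 1
  have hv2 := s.vertex 2
  simp only [Matrix.cons_val_one, Matrix.cons_val_zero, Matrix.cons_val] at hv1 hv2
  rw [← hb, ← hU.lift, coe_bdry_exp, coe_xGen] at hv1
  obtain ⟨⟨i, hi⟩, j, hj⟩ := pt_eq_pt_iff.1 hv1
  simp only at hi hj
  set W : ℂ → ℝ × ℝ := fun w => U w + (((-i : ℤ) : ℝ), ((-j : ℤ) : ℝ)) with hWdef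
  have hWlift : ∀ w : Disk, pt (W w) = s.u w := by
    intro w
    rw [← hU.lift]
    exact pt_eq_pt_iff.2 ⟨⟨-i, rfl⟩, -j, rfl⟩
  have hWc : ContinuousOn W (closedBall 0 1) := hU.cont.add continuousOn_const
  have hb1 : W (cis b) = vert₁ ((k₁ : ℝ) / m₁) := by
    ext
    · simp [W, hi, vert₁]
    · simp [W, hj, vert₁]
  rw [← hc, ← hWlift, coe_bdry_exp, coe_twistedGen] at hv2
  obtain ⟨⟨ℓ, hℓ⟩, -⟩ := pt_eq_pt_iff.1 hv2
  simp only at hℓ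
  have a0 : ∀ τ ∈ Icc a b, s.u (bdry (Circle.exp τ)) ∈ Lag 0 := by
    intro τ hτ
    refine s.edge 0 _ ?_
    rw [zero_add, ← ha, ← hb, ccwArc_exp hab (by linarith)]
    exact mem_image_of_mem _ hτ
  have a1 : ∀ τ ∈ Icc b c, s.u (bdry (Circle.exp τ)) ∈ Lag m₁ := by
    intro τ hτ
    refine s.edge 1 _ ?_
    rw [show (1 : Fin 3) + 1 = 2 from rfl, ← hb, ← hc, ccwArc_exp hbc (by linarith)]
    exact mem_image_of_mem _ hτ
  have a2 : ∀ τ ∈ Icc c (a + 2 * Real.pi), s.u (bdry (Circle.exp τ)) ∈ Lag ((m₁ : ℤ) + m₂) := by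
    intro τ hτ
    refine s.edge 2 _ ?_
    rw [show (2 : Fin 3) + 1 = 0 from rfl, ← ha, ← hc, ← circle_exp_add_two_pi a,
      ccwArc_exp hca (by linarith)]
    exact mem_image_of_mem _ hτ
  have e0 : ∀ τ ∈ Icc a b, (W (cis τ)).2 = 0 := by
    intro τ hτ
    have := lift_arc_const hWc hWlift a0 hτ (right_mem_Icc.2 hab.le)
    simpa [hb1, vert₁] using this
  have e1 : ∀ τ ∈ Icc b c, (W (cis τ)).2 + m₁ * (W (cis τ)).1 = m₁ * ((k₁ : ℝ) / m₁) := by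
    intro τ hτ
    have := lift_arc_const hWc hWlift a1 hτ (left_mem_Icc.2 hbc.le)
    simpa [hb1, vert₁] using this
  have hc1 : W (cis c) = vert₂ m₁ ((k₁ : ℝ) / m₁) ((k₂ : ℝ) / m₂ + ℓ) := by
    have := e1 c (right_mem_Icc.2 hbc.le)
    ext
    · exact hℓ
    · simp only [vert₂]
      rw [hℓ] at this
      linarith
  have e2 : ∀ τ ∈ Icc c (a + 2 * Real.pi), (W (cis τ)).2 + (m₁ + m₂) * (W (cis τ)).1 =
      m₁ * ((k₁ : ℝ) / m₁) + m₂ * ((k₂ : ℝ) / m₂ + ℓ) := by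
    intro τ hτ
    have := lift_arc_const hWc hWlift a2 hτ (left_mem_Icc.2 hca.le)
    rw [hc1] at this
    push_cast at this
    rw [this, vert₂]
    ring
  refine ⟨a, b, c, ℓ, W, ⟨hab, hbc, hca, hWc, ?_, ?_, hb1, hc1, e0, e1, e2⟩, ha, hb, hc, -i, -j,
    fun w => rfl⟩
  · intro w hw
    have h1 := hU.hasDerivAt hw
    have : (fun z => 𝒥.toComplex (W z)) = fun z => 𝒥.toComplex (U z) +
        𝒥.toComplex (((-i : ℤ) : ℝ), ((-j : ℤ) : ℝ)) := by
      funext z; simp [W]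
    rw [this]
    exact (h1.differentiableAt.add_const _).differentiableWithinAt
  · have h1 := e0 a (left_mem_Icc.2 hab.le)
    have h2 := e2 (a + 2 * Real.pi) (right_mem_Icc.2 hca.le)
    rw [cis_add_two_pi, h1] at h2
    have hpos : (m₁ : ℝ) + m₂ ≠ 0 := by positivity
    ext
    · simp only [vert₀, Efun]
      rw [eq_div_iff hpos]
      linarith
    · exact h1

end TorusFloer
end

noncomputable section
namespace TorusFloer

open Complex Set Filter Topology MeasureTheory Metric

/-! ### Classification of plane triangles -/

theorem Efun_sub {m₁ m₂ : ℕ} (hm : 0 < m₁) (u v : ℝ) :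
    (m₁ + m₂) * (u - Efun m₁ m₂ u v) = m₂ * (u - v) := by
  have : (m₁ : ℝ) + m₂ ≠ 0 := by positivity
  rw [Efun]; field_simp; ring

theorem Efun_sub' {m₁ m₂ : ℕ} (hm : 0 < m₁) (u v : ℝ) :
    (m₁ + m₂) * (Efun m₁ m₂ u v - v) = m₁ * (u - v) := by
  have : (m₁ : ℝ) + m₂ ≠ 0 := by positivity
  rw [Efun]; field_simp; ring

theorem cr2_edge₀ (m₁ m₂ : ℕ) (u v : ℝ) (p : ℝ × ℝ) :
    cr2 (vert₀ m₁ m₂ u v) (vert₁ u) p = (u - Efun m₁ m₂ u v) * p.2 := by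
  simp [cr2, vert₀, vert₁]

theorem cr2_edge₁ (m₁ : ℕ) (u v : ℝ) (p : ℝ × ℝ) :
    cr2 (vert₁ u) (vert₂ m₁ u v) p = (v - u) * (p.2 + m₁ * p.1 - m₁ * u) := by
  simp [cr2, vert₂, vert₁]; ring

theorem cr2_edge₂ {m₁ m₂ : ℕ} (hm : 0 < m₁) (u v : ℝ) (p : ℝ × ℝ) :
    cr2 (vert₂ m₁ u v) (vert₀ m₁ m₂ u v) p =
      (Efun m₁ m₂ u v - v) * (p.2 + (m₁ + m₂) * p.1 - (m₁ * u + m₂ * v)) := by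
  have := Efun_sub' (m₂ := m₂) hm u v
  simp only [cr2, vert₂, vert₀]
  linear_combination (-(p.1 - v)) * this

/-- Twice the area of the lifted triangle. -/
theorem cr2_verts {m₁ m₂ : ℕ} (hm : 0 < m₁) (u v : ℝ) :
    cr2 (vert₀ m₁ m₂ u v) (vert₁ u) (vert₂ m₁ u v) = m₁ * m₂ / (m₁ + m₂) * (u - v) ^ 2 := by
  have h : (m₁ : ℝ) + m₂ ≠ 0 := by positivity
  have e : u - Efun m₁ m₂ u v = m₂ * (u - v) / (m₁ + m₂) := by
    rw [eq_div_iff h, ← Efun_sub hm u v, mul_comm]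
  rw [cr2_edge₀, vert₂, e]
  ring

/-- The signed area is a positive multiple of (u - v)², so the vertices are in counterclockwise
order whether u < v or u > v. Every ℓ with u ≠ v therefore contributes. -/
theorem cr_verts_pos (𝒥 : CxStructure) {m₁ m₂ : ℕ} (hm₁ : 0 < m₁) (hm₂ : 0 < m₂) {u v : ℝ}
    (huv : u ≠ v) : 0 < cr (𝒥.toComplex (vert₀ m₁ m₂ u v)) (𝒥.toComplex (vert₁ u))
      (𝒥.toComplex (vert₂ m₁ u v)) := by
  rw [𝒥.cr_toComplex, cr2_verts hm₁]
  have h1 : 0 < (u - v) ^ 2 := by have := sub_ne_zero.2 huv; positivity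
  have := 𝒥.tau_im_pos
  positivity

namespace IsPlaneTriangle

variable {𝒥 : CxStructure} {m₁ m₂ : ℕ} {u v a b c : ℝ} {W : ℂ → ℝ × ℝ}

theorem isHolTriangle (h : IsPlaneTriangle 𝒥 m₁ m₂ u v a b c W) (hm₁ : 0 < m₁) :
    IsHolTriangle (fun w => 𝒥.toComplex (W w)) a b c (𝒥.toComplex (TorusFloer.vert₀ m₁ m₂ u v))
      (𝒥.toComplex (TorusFloer.vert₁ u)) (𝒥.toComplex (TorusFloer.vert₂ m₁ u v)) where
  cont := 𝒥.toComplex.continuous.comp_continuousOn h.cont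
  diff := h.diff
  vert₀ := by rw [h.vert₀]
  vert₁ := by rw [h.vert₁]
  vert₂ := by rw [h.vert₂]
  edge₀ τ hτ := by rw [𝒥.cr_toComplex, cr2_edge₀, h.edge₀ τ hτ]; simp
  edge₁ τ hτ := by rw [𝒥.cr_toComplex, cr2_edge₁, h.edge₁ τ hτ]; simp
  edge₂ τ hτ := by rw [𝒥.cr_toComplex, cr2_edge₂ hm₁, h.edge₂ τ hτ]; simp

/-- Nondegenerate plane triangles are Schwarz-Christoffel maps. -/
theorem exists_isTriangleMap (h : IsPlaneTriangle 𝒥 m₁ m₂ u v a b c W) (hm₁ : 0 < m₁)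
    (hm₂ : 0 < m₂) (huv : u ≠ v) :
    ∃ F, IsTriangleMap F a b c (𝒥.toComplex (TorusFloer.vert₀ m₁ m₂ u v))
      (𝒥.toComplex (TorusFloer.vert₁ u)) (𝒥.toComplex (TorusFloer.vert₂ m₁ u v)) ∧
      EqOn (fun w => 𝒥.toComplex (W w)) F (closedBall 0 1) := by
  have hA := cr_verts_pos 𝒥 hm₁ hm₂ huv
  obtain ⟨F, hF⟩ := TorusFloer.exists_isTriangleMap h.hab h.hbc h.hca hA
  exact ⟨F, hF, (h.isHolTriangle hm₁).eqOn hF h.hab h.hbc h.hca hA⟩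

/-- Degenerate plane triangles are constant. -/
theorem eq_const (h : IsPlaneTriangle 𝒥 m₁ m₂ u v a b c W) (hm₁ : 0 < m₁) (huv : u = v) :
    ∀ w ∈ closedBall (0 : ℂ) 1, W w = (u, 0) := by
  subst huv
  have hpos : (m₁ : ℝ) + m₂ ≠ 0 := by positivity
  set F : ℂ → ℂ := fun w => 𝒥.toComplex (W w)
  have hFc : ContinuousOn F (closedBall 0 1) := 𝒥.toComplex.continuous.comp_continuousOn h.cont
  set A := 𝒥.toComplex (u, 0)
  have hne : ∀ v : ℝ × ℝ, v.1 ≠ 0 → 𝒥.toComplex v ≠ 0 := by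
    intro v hv h0
    rw [ContinuousLinearEquiv.map_eq_zero_iff] at h0
    rw [h0] at hv; simp at hv
  -- When u = v all three edges lie on lines through (u, 0), so the concurrent case applies.
  have hcr : ∀ (r : ℝ) (p : ℝ × ℝ), cr A (A + 𝒥.toComplex (1, -r)) (𝒥.toComplex p) =
      𝒥.tau.im * (p.2 + r * p.1 - r * u) := by
    intro r p
    rw [← map_add, 𝒥.cr_toComplex, cr2]
    simp; left; ring
  obtain ⟨x, hx⟩ := exists_const_of_concurrent hFc h.diff (A := A) (hne (1, -0) (by simp))
    (hne (1, -m₁) (by simp)) (hne (1, -(m₁ + m₂ : ℝ)) (by simp)) (by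
      intro w hw
      obtain ⟨τ, rfl, hτ | hτ | hτ⟩ := exists_arc hw a b c
      · left
        rw [hcr, h.edge₀ τ (Ico_subset_Icc_self hτ)]; simp
      · right; left
        rw [hcr, h.edge₁ τ (Ico_subset_Icc_self hτ)]; simp
      · right; right
        rw [hcr, h.edge₂ τ (Ico_subset_Icc_self hτ)]; ring)
  have heq : EqOn F (fun _ => x) (closedBall 0 1) :=
    (show EqOn F (fun _ => x) (ball 0 1) from hx).of_subset_closure hFc continuousOn_const
      ball_subset_closedBall (by rw [closure_ball _ one_ne_zero])
  intro w hw
  have h1 : F w = F (cis b) := (heq hw).trans (heq (cis_mem_closedBall b)).symm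
  have h2 := 𝒥.toComplex.injective h1
  rw [h2, h.vert₁, TorusFloer.vert₁]

end IsPlaneTriangle

/-- Two conformal parametrizations of a triangle differ by a biholomorphism of the disk. -/
theorem exists_isBihol {F F' : ℂ → ℂ} {a b c a' b' c' : ℝ} {A₀ A₁ A₂ : ℂ}
    (hF : IsTriangleMap F a b c A₀ A₁ A₂) (hF' : IsTriangleMap F' a' b' c' A₀ A₁ A₂)
    (hab : a < b) (hbc : b < c) (hca : c < a + 2 * Real.pi)
    (hab' : a' < b') (hbc' : b' < c') (hca' : c' < a' + 2 * Real.pi) (hA : 0 < cr A₀ A₁ A₂) :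
    ∃ g : Disk ≃ₜ Disk, IsBihol g ∧ g (bdry (Circle.exp a)) = bdry (Circle.exp a') ∧
      g (bdry (Circle.exp b)) = bdry (Circle.exp b') ∧
      g (bdry (Circle.exp c)) = bdry (Circle.exp c') ∧ ∀ w : Disk, F w = F' (g w) := by
  obtain ⟨K, hK⟩ := hF.exists_inverse hab hbc hca hA
  obtain ⟨K', hK'⟩ := hF'.exists_inverse hab' hbc' hca' hA
  have cont : ∀ {F K F' K' : ℂ → ℂ}, ContinuousOn F (closedBall 0 1) →
      IsTriangleInverse F K A₀ A₁ A₂ → (hK' : IsTriangleInverse F' K' A₀ A₁ A₂) →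
      ∀ hm : (∀ w : Disk, K' (F w) ∈ closedBall (0 : ℂ) 1),
      Continuous fun w : Disk => (⟨K' (F w), hm w⟩ : Disk) := by
    intro F K F' K' h1 h2 h3 hm
    refine Continuous.subtype_mk ?_ _
    exact (h3.inv_cont.comp h1 h2.mapsTo_closed).comp_continuous continuous_subtype_val fun w => w.2
  have hm : ∀ w : Disk, K' (F w) ∈ closedBall (0 : ℂ) 1 := fun w =>
    hK'.inv_mapsTo_closed (hK.mapsTo_closed w.2)
  have hm' : ∀ w : Disk, K (F' w) ∈ closedBall (0 : ℂ) 1 := fun w =>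
    hK.inv_mapsTo_closed (hK'.mapsTo_closed w.2)
  let g : Disk ≃ₜ Disk :=
    { toFun := fun w => ⟨K' (F w), hm w⟩
      invFun := fun w => ⟨K (F' w), hm' w⟩
      left_inv := fun w => Subtype.ext (by
        change K (F' (K' (F w))) = w
        rw [hK'.right_inv _ (hK.mapsTo_closed w.2), hK.left_inv _ w.2])
      right_inv := fun w => Subtype.ext (by
        change K' (F (K (F' w))) = w
        rw [hK.right_inv _ (hK'.mapsTo_closed w.2), hK'.left_inv _ w.2])
      continuous_toFun := cont hF.cont hK hK' hm
      continuous_invFun := cont hF'.cont hK' hK hm' }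
  have hg : ∀ w : Disk, ((g w : Disk) : ℂ) = K' (F w) := fun w => rfl
  have hgs : ∀ w : Disk, ((g.symm w : Disk) : ℂ) = K (F' w) := fun w => rfl
  have int1 : ∀ w : Disk, ‖(w : ℂ)‖ < 1 → ‖((g w : Disk) : ℂ)‖ < 1 := by
    intro w hw
    rw [hg]
    simpa using hK'.inv_mapsTo (hK.mapsTo (mem_ball_zero_iff.2 hw))
  have int2 : ∀ w : Disk, ‖(w : ℂ)‖ < 1 → ‖((g.symm w : Disk) : ℂ)‖ < 1 := by
    intro w hw
    rw [hgs]
    simpa using hK.inv_mapsTo (hK'.mapsTo (mem_ball_zero_iff.2 hw))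
  obtain ⟨v0, v1, v2⟩ := hF.vert hab hbc
  obtain ⟨v0', v1', v2'⟩ := hF'.vert hab' hbc'
  have gv : ∀ {x x' : ℝ} {P : ℂ}, F (cis x) = P → F' (cis x') = P →
      g (bdry (Circle.exp x)) = bdry (Circle.exp x') := by
    intro x x' P h1 h2
    apply Subtype.ext
    rw [hg, coe_bdry_exp, coe_bdry_exp, h1, ← h2, hK'.left_inv _ (cis_mem_closedBall x')]
  refine ⟨g, ⟨fun w => ⟨fun h => ?_, int1 w⟩, ⟨K' ∘ F, hK'.inv_diff.comp hF.differentiableOn hK.mapsTo,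
    fun w _ => rfl⟩, ⟨K ∘ F', hK.inv_diff.comp hF'.differentiableOn hK'.mapsTo, fun w _ => rfl⟩⟩,
    gv v0 v0', gv v1 v1', gv v2 v2', fun w => ?_⟩
  · have := int2 (g w) h
    rwa [g.symm_apply_apply] at this
  · rw [hg, hK'.right_inv _ (hK.mapsTo_closed w.2)]

/-- Plane triangles with the same vertices differ by a biholomorphism of the disk. -/
theorem IsPlaneTriangle.exists_isBihol {𝒥 : CxStructure} {m₁ m₂ : ℕ} {u v a b c a' b' c' : ℝ}
    {W W' : ℂ → ℝ × ℝ} (h : IsPlaneTriangle 𝒥 m₁ m₂ u v a b c W)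
    (h' : IsPlaneTriangle 𝒥 m₁ m₂ u v a' b' c' W') (hm₁ : 0 < m₁) (hm₂ : 0 < m₂) :
    ∃ g : Disk ≃ₜ Disk, IsBihol g ∧ g (bdry (Circle.exp a)) = bdry (Circle.exp a') ∧
      g (bdry (Circle.exp b)) = bdry (Circle.exp b') ∧
      g (bdry (Circle.exp c)) = bdry (Circle.exp c') ∧ ∀ w : Disk, W w = W' (g w) := by
  by_cases huv : u = v
  -- Both maps are constant, so the reparametrization only has to match the marked points. An
  -- auxiliary nondegenerate triangle, uniformized with each set of marked points, supplies it.
  · have hA : 0 < cr 0 1 I := by simp [cr]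
    obtain ⟨F, hF⟩ := TorusFloer.exists_isTriangleMap h.hab h.hbc h.hca hA
    obtain ⟨F', hF'⟩ := TorusFloer.exists_isTriangleMap h'.hab h'.hbc h'.hca hA
    obtain ⟨g, hg, g0, g1, g2, -⟩ :=
      TorusFloer.exists_isBihol hF hF' h.hab h.hbc h.hca h'.hab h'.hbc h'.hca hA
    refine ⟨g, hg, g0, g1, g2, fun w => ?_⟩
    rw [h.eq_const hm₁ huv _ w.2, h'.eq_const hm₁ huv _ (g w).2]
  · obtain ⟨F, hF, e⟩ := h.exists_isTriangleMap hm₁ hm₂ huv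
    obtain ⟨F', hF', e'⟩ := h'.exists_isTriangleMap hm₁ hm₂ huv
    obtain ⟨g, hg, g0, g1, g2, hFF⟩ :=
      TorusFloer.exists_isBihol hF hF' h.hab h.hbc h.hca h'.hab h'.hbc h'.hca
        (cr_verts_pos 𝒥 hm₁ hm₂ huv)
    refine ⟨g, hg, g0, g1, g2, fun w => 𝒥.toComplex.injective ?_⟩
    exact (e w.2).trans ((hFF w).trans (e' (g w).2).symm)

/-! ### Existence of triangles -/

theorem continuous_pt : Continuous pt :=
  ((AddCircle.continuous_mk' 1).comp continuous_fst).prodMk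
    ((AddCircle.continuous_mk' 1).comp continuous_snd)

theorem affine_edge {P Q : ℝ × ℝ} {r k s : ℝ} (hP : P.2 + r * P.1 = k) (hQ : Q.2 + r * Q.1 = k) :
    (P + s • (Q - P)).2 + r * (P + s • (Q - P)).1 = k := by
  simp; linear_combination (1 - s) * hP + s * hQ

/-- A smooth plane triangle with given vertices. -/
theorem exists_plane_triangle (𝒥 : CxStructure) {m₁ m₂ : ℕ} (hm₁ : 0 < m₁) (hm₂ : 0 < m₂)
    (u v : ℝ) {a b c : ℝ} (hab : a < b) (hbc : b < c) (hca : c < a + 2 * Real.pi) :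
    ∃ W : ℂ → ℝ × ℝ, IsPlaneTriangle 𝒥 m₁ m₂ u v a b c W ∧
      ContDiffOn ℝ ((⊤ : ℕ∞) : WithTop ℕ∞) W (pdisk a b c) ∧
      ∀ w ∈ ball (0 : ℂ) 1, ∀ h : ℂ, fderiv ℝ W w (I * h) = 𝒥.J (fderiv ℝ W w h) := by
  have hpos : (m₁ : ℝ) + m₂ ≠ 0 := by positivity
  have hE : (m₁ + m₂) * Efun m₁ m₂ u v = m₁ * u + m₂ * v := by
    rw [Efun]; field_simp
  by_cases huv : u = v
  · have hE' : Efun m₁ m₂ u v = u := by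
      subst huv
      apply mul_left_cancel₀ hpos
      linarith
    refine ⟨fun _ => (u, 0), ⟨hab, hbc, hca, continuousOn_const, differentiableOn_const _, ?_, rfl, ?_,
      fun _ _ => rfl, fun _ _ => by simp, fun _ _ => by rw [← huv]; simp; ring⟩, contDiffOn_const, ?_⟩
    · rw [vert₀, hE']
    · rw [vert₂, huv]; simp
    · intro w _ h
      simp
  · have hA := cr_verts_pos 𝒥 hm₁ hm₂ huv
    obtain ⟨F, hF⟩ := exists_isTriangleMap hab hbc hca hA
    set Ψ := 𝒥.toComplex
    have hedge : ∀ {P Q : ℝ × ℝ} {s : ℝ} {z : ℂ}, z = Ψ P + s * (Ψ Q - Ψ P) →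
        Ψ.symm z = P + s • (Q - P) := by
      intro P Q s z hz
      rw [ContinuousLinearEquiv.symm_apply_eq, hz, map_add, map_smul, map_sub, Complex.real_smul]
    obtain ⟨v0, v1, v2⟩ := hF.vert hab hbc
    obtain ⟨ρ₀, -, -, -, f0⟩ := hF.edge₀
    obtain ⟨ρ₁, -, -, -, f1⟩ := hF.edge₁
    obtain ⟨ρ₂, -, -, -, f2⟩ := hF.edge₂
    refine ⟨fun w => Ψ.symm (F w), ⟨hab, hbc, hca, Ψ.symm.continuous.comp_continuousOn hF.cont, ?_,
      by rw [v0]; simp, by rw [v1]; simp, by rw [v2]; simp, fun τ hτ => ?_, fun τ hτ => ?_,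
      fun τ hτ => ?_⟩, Ψ.symm.contDiff.comp_contDiffOn hF.smooth, ?_⟩
    · refine hF.differentiableOn.congr fun w _ => ?_
      exact Ψ.apply_symm_apply _
    · rw [hedge (f0 τ hτ)]; simp [vert₀, vert₁]
    · rw [hedge (f1 τ hτ)]
      exact affine_edge (by simp [vert₁]) (by simp [vert₂]; ring)
    · rw [hedge (f2 τ hτ)]
      exact affine_edge (by simp [vert₂]; ring) (by simp [vert₀, hE])
    · intro w hw h
      obtain ⟨F', -, hd⟩ := hF.deriv w hw
      have h1 : HasFDerivAt (fun w => Ψ.symm (F w)) _ w :=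
        (Ψ.symm : ℂ →L[ℝ] ℝ × ℝ).hasFDerivAt.comp w (hd.hasFDerivAt.restrictScalars ℝ)
      rw [h1.fderiv]
      apply Ψ.injective
      rw [𝒥.toComplex_J]
      simp [Ψ]
      ring

theorem compl_marked_eq_pdisk {z : Fin 3 → Circle} {a b c : ℝ} (h0 : z 0 = Circle.exp a)
    (h1 : z 1 = Circle.exp b) (h2 : z 2 = Circle.exp c) :
    (closedBall (0 : ℂ) 1 \ range fun i => (z i : ℂ)) = pdisk a b c := by
  unfold pdisk
  congr 1
  ext w
  simp only [mem_range, Fin.exists_fin_succ, mem_insert_iff, mem_singleton_iff, ← circle_exp_eq_cis,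
    ← h0, ← h1, ← h2]
  simp [eq_comm]

/-- Every `ℓ` is realized by a triangle. -/
theorem exists_productTriangle (𝒥 : CxStructure) {m₁ m₂ : ℕ} (hm₁ : 0 < m₁) (hm₂ : 0 < m₂)
    (k₁ k₂ ℓ : ℤ) {y : Torus}
    (hy : xPt (Efun m₁ m₂ ((k₁ : ℝ) / m₁) ((k₂ : ℝ) / m₂ + ℓ)) = y) :
    ∃ (s : ProductTriangle 𝒥 m₁ m₂ k₁ k₂ y) (U : Disk → ℝ × ℝ), Continuous U ∧
      (∀ w, pt (U w) = s.u w) ∧ (U (bdry (s.z 1))).1 = (k₁ : ℝ) / m₁ ∧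
      (U (bdry (s.z 2))).1 = (k₂ : ℝ) / m₂ + ℓ := by
  set u := (k₁ : ℝ) / m₁ with hu
  set v := (k₂ : ℝ) / m₂ + ℓ with hv
  have hm₁' : (m₁ : ℝ) ≠ 0 := by positivity
  have hm₂' : (m₂ : ℝ) ≠ 0 := by positivity
  have hu' : (m₁ : ℝ) * u = k₁ := by rw [hu]; field_simp
  have hv' : (m₂ : ℝ) * v = k₂ + m₂ * ℓ := by rw [hv]; field_simp
  have h01 : (0 : ℝ) < 1 := one_pos
  have h12 : (1 : ℝ) < 2 := one_lt_two
  have h20 : (2 : ℝ) < 0 + 2 * Real.pi := by linarith [Real.pi_gt_three]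
  obtain ⟨W, hW, hsm, hhol⟩ := exists_plane_triangle 𝒥 hm₁ hm₂ u v h01 h12 h20
  -- The choice of angles is immaterial; 0 < 1 < 2 < 2π is enough for the cyclic order.
  set z : Fin 3 → Circle := ![Circle.exp 0, Circle.exp 1, Circle.exp 2] with hz
  have hUc : Continuous fun w : Disk => W w :=
    hW.cont.comp_continuous continuous_subtype_val fun w => w.2
  obtain ⟨hinj, hccw⟩ := ccw_of_angles h01 h12 h20 z rfl rfl rfl
  have a0 : ∀ w ∈ ccwArc (z 0) (z 1), pt (W (bdry w)) ∈ Lag 0 := by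
    intro w hw
    rw [show z 0 = Circle.exp 0 from rfl, show z 1 = Circle.exp 1 from rfl,
      ccwArc_exp h01 (by linarith)] at hw
    obtain ⟨τ, hτ, rfl⟩ := hw
    rw [coe_bdry_exp, pt_mem_Lag_iff]
    exact ⟨0, by rw [hW.edge₀ τ hτ]; simp⟩
  have a1 : ∀ w ∈ ccwArc (z 1) (z 2), pt (W (bdry w)) ∈ Lag m₁ := by
    intro w hw
    rw [show z 1 = Circle.exp 1 from rfl, show z 2 = Circle.exp 2 from rfl,
      ccwArc_exp h12 (by linarith)] at hw
    obtain ⟨τ, hτ, rfl⟩ := hw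
    rw [coe_bdry_exp, pt_mem_Lag_iff]
    exact ⟨k₁, by push_cast; rw [hW.edge₁ τ hτ, hu']⟩
  have a2 : ∀ w ∈ ccwArc (z 2) (z 0), pt (W (bdry w)) ∈ Lag ((m₁ : ℤ) + m₂) := by
    intro w hw
    rw [show z 0 = Circle.exp 0 from rfl, show z 2 = Circle.exp 2 from rfl,
      ← circle_exp_add_two_pi 0, ccwArc_exp h20 (by linarith)] at hw
    obtain ⟨τ, hτ, rfl⟩ := hw
    rw [coe_bdry_exp, pt_mem_Lag_iff]
    exact ⟨k₁ + (k₂ + m₂ * ℓ), by push_cast; rw [hW.edge₂ τ hτ, hu', hv']⟩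
  have b0 : pt (W (bdry (z 0))) = y := by
    rw [show z 0 = Circle.exp 0 from rfl, coe_bdry_exp, hW.vert₀, ← hy]; rfl
  have b1 : W (bdry (z 1)) = (u, 0) := by
    rw [show z 1 = Circle.exp 1 from rfl, coe_bdry_exp, hW.vert₁]; rfl
  have b2 : W (bdry (z 2)) = (v, m₁ * (u - v)) := by
    rw [show z 2 = Circle.exp 2 from rfl, coe_bdry_exp, hW.vert₂]; rfl
  let s : ProductTriangle 𝒥 m₁ m₂ k₁ k₂ y :=
    { z := z
      u := ⟨fun w => pt (W w), continuous_pt.comp hUc⟩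
      inj := hinj
      ccw := hccw
      vertex := by
        rw [Fin.forall_fin_succ, Fin.forall_fin_two]
        refine ⟨b0, ?_, ?_⟩
        · change pt (W (bdry (z 1))) = xGen m₁ k₁
          rw [b1]; rfl
        · change pt (W (bdry (z 2))) = twistedGen m₁ m₂ k₂
          rw [b2, coe_twistedGen, pt_eq_pt_iff]
          refine ⟨⟨ℓ, rfl⟩, k₁ - m₁ * ℓ, ?_⟩
          simp only
          push_cast
          rw [mul_sub, hu', hv]
          ring
      edge := by
        rw [Fin.forall_fin_succ, Fin.forall_fin_two]
        exact ⟨a0, a1, a2⟩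
      hol := ⟨W, fun w => rfl, hW.cont, by
        rw [compl_marked_eq_pdisk (z := z) rfl rfl rfl]; exact hsm, hhol⟩ }
  exact ⟨s, fun w => W w, hUc, fun w => rfl, congrArg Prod.fst b1, congrArg Prod.fst b2⟩

end TorusFloer
end

noncomputable section
namespace TorusFloer

open Complex Set Filter Topology MeasureTheory Metric

/-! ### Classification of triangles up to reparametrization -/

instance : PreconnectedSpace Disk :=
  Subtype.preconnectedSpace (convex_closedBall (0 : ℂ) 1).isPreconnected

theorem lift_sub_const {U U' : Disk → ℝ × ℝ} (hU : Continuous U) (hU' : Continuous U')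
    (h : ∀ w, pt (U w) = pt (U' w)) (x y : Disk) : (U x).1 - (U' x).1 = (U y).1 - (U' y).1 := by
  refine eq_of_integral_values (f := fun w => (U w).1 - (U' w).1) isPreconnected_univ
    ((continuous_fst.comp hU).sub (continuous_fst.comp hU')).continuousOn ?_ (mem_univ x)
    (mem_univ y)
  intro w _
  obtain ⟨⟨n, hn⟩, -⟩ := pt_eq_pt_iff.1 (h w)
  exact ⟨n, by rw [hn]; ring⟩

section Index

variable {𝒥 : CxStructure} {m₁ m₂ : ℕ} {k₁ k₂ : ℤ} {y : Torus}

/-- The normalized lift of the triangle has its third vertex over `κ₂ + ℓ`. -/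
def HasIndex (s : ProductTriangle 𝒥 m₁ m₂ k₁ k₂ y) (ℓ : ℤ) : Prop :=
  ∃ U : Disk → ℝ × ℝ, Continuous U ∧ (∀ w, pt (U w) = s.u w) ∧
    (U (bdry (s.z 1))).1 = (k₁ : ℝ) / m₁ ∧ (U (bdry (s.z 2))).1 = (k₂ : ℝ) / m₂ + ℓ

/-- `W` is a lift of the triangle with marked points at the angles `a, b, c`. -/
structure IsNormalized (s : ProductTriangle 𝒥 m₁ m₂ k₁ k₂ y) (ℓ : ℤ) (a b c : ℝ)
    (W : ℂ → ℝ × ℝ) : Prop where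
  plane : IsPlaneTriangle 𝒥 m₁ m₂ ((k₁ : ℝ) / m₁) ((k₂ : ℝ) / m₂ + ℓ) a b c W
  ha : Circle.exp a = s.z 0
  hb : Circle.exp b = s.z 1
  hc : Circle.exp c = s.z 2
  shift : ∃ i j : ℤ, ∀ w, W w = s.lift w + ((i : ℝ), (j : ℝ))

theorem IsNormalized.lift {s : ProductTriangle 𝒥 m₁ m₂ k₁ k₂ y} {ℓ : ℤ} {a b c : ℝ}
    {W : ℂ → ℝ × ℝ} (h : IsNormalized s ℓ a b c W) (w : Disk) : pt (W w) = s.u w := by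
  obtain ⟨i, j, hW⟩ := h.shift
  rw [← s.isHolLift.lift, hW]
  exact pt_eq_pt_iff.2 ⟨⟨i, rfl⟩, j, rfl⟩

theorem IsNormalized.hasIndex {s : ProductTriangle 𝒥 m₁ m₂ k₁ k₂ y} {ℓ : ℤ} {a b c : ℝ}
    {W : ℂ → ℝ × ℝ} (h : IsNormalized s ℓ a b c W) : HasIndex s ℓ := by
  refine ⟨fun w => W w, h.plane.cont.comp_continuous continuous_subtype_val fun w => w.2, h.lift,
    ?_, ?_⟩
  · beta_reduce
    rw [← h.hb, coe_bdry_exp, h.plane.vert₁]; rfl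
  · beta_reduce
    rw [← h.hc, coe_bdry_exp, h.plane.vert₂]; rfl

/-- Two continuous lifts differ by a constant integral translation, so the difference between the
abscissas of the second and third vertices does not depend on the lift. -/
theorem HasIndex.unique {s : ProductTriangle 𝒥 m₁ m₂ k₁ k₂ y} {ℓ ℓ' : ℤ} (h : HasIndex s ℓ)
    (h' : HasIndex s ℓ') : ℓ = ℓ' := by
  obtain ⟨U, hU, hl, h1, h2⟩ := h
  obtain ⟨U', hU', hl', h1', h2'⟩ := h'
  have := lift_sub_const hU hU' (fun w => (hl w).trans (hl' w).symm) (bdry (s.z 1)) (bdry (s.z 2))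
  rw [h1, h2, h1', h2'] at this
  have h3 : (ℓ : ℝ) = ℓ' := by linarith
  exact_mod_cast h3

theorem exists_isNormalized (hm₁ : 0 < m₁) (hm₂ : 0 < m₂)
    (s : ProductTriangle 𝒥 m₁ m₂ k₁ k₂ y) : ∃ ℓ a b c W, IsNormalized s ℓ a b c W := by
  obtain ⟨a, b, c, ℓ, W, h, ha, hb, hc, hs⟩ := exists_isPlaneTriangle hm₁ hm₂ s
  exact ⟨ℓ, a, b, c, W, h, ha, hb, hc, hs⟩

theorem HasIndex.exists_isNormalized (hm₁ : 0 < m₁) (hm₂ : 0 < m₂)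
    {s : ProductTriangle 𝒥 m₁ m₂ k₁ k₂ y} {ℓ : ℤ} (h : HasIndex s ℓ) :
    ∃ a b c W, IsNormalized s ℓ a b c W := by
  obtain ⟨ℓ', a, b, c, W, h'⟩ := TorusFloer.exists_isNormalized hm₁ hm₂ s
  obtain rfl := h.unique h'.hasIndex
  exact ⟨a, b, c, W, h'⟩

theorem HasIndex.congr {s t : ProductTriangle 𝒥 m₁ m₂ k₁ k₂ y} {ℓ : ℤ}
    (hst : triangleSetoid 𝒥 _ _ s t) (h : HasIndex t ℓ) : HasIndex s ℓ := by
  obtain ⟨g, -, hz, hu⟩ := hst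
  obtain ⟨U, hU, hl, h1, h2⟩ := h
  exact ⟨fun w => U (g w), hU.comp g.continuous, fun w => by rw [hl, hu], by
    beta_reduce; rw [hz, h1], by beta_reduce; rw [hz, h2]⟩

/-- The index fixes all three vertices of the normalized lift, and plane triangles with the same
vertices are reparametrizations of each other. -/
theorem HasIndex.equiv (hm₁ : 0 < m₁) (hm₂ : 0 < m₂)
    {s t : ProductTriangle 𝒥 m₁ m₂ k₁ k₂ y} {ℓ : ℤ} (hs : HasIndex s ℓ) (ht : HasIndex t ℓ) :
    triangleSetoid 𝒥 _ _ s t := by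
  obtain ⟨a, b, c, W, h⟩ := hs.exists_isNormalized hm₁ hm₂
  obtain ⟨a', b', c', W', h'⟩ := ht.exists_isNormalized hm₁ hm₂
  obtain ⟨g, hg, g0, g1, g2, hW⟩ := h.plane.exists_isBihol h'.plane hm₁ hm₂
  refine ⟨g, hg, ?_, fun w => by rw [← h.lift, ← h'.lift, hW]⟩
  rw [Fin.forall_fin_succ, Fin.forall_fin_two]
  refine ⟨?_, ?_, ?_⟩
  · rw [← h.ha, ← h'.ha]; exact g0
  · change g (bdry (s.z 1)) = bdry (t.z 1)
    rw [← h.hb, ← h'.hb]; exact g1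
  · change g (bdry (s.z 2)) = bdry (t.z 2)
    rw [← h.hc, ← h'.hc]; exact g2

/-- The vertex `y` is determined by the index. -/
theorem HasIndex.xPt_eq (hm₁ : 0 < m₁) (hm₂ : 0 < m₂)
    {s : ProductTriangle 𝒥 m₁ m₂ k₁ k₂ y} {ℓ : ℤ} (h : HasIndex s ℓ) :
    xPt (Efun m₁ m₂ ((k₁ : ℝ) / m₁) ((k₂ : ℝ) / m₂ + ℓ)) = y := by
  obtain ⟨a, b, c, W, h⟩ := h.exists_isNormalized hm₁ hm₂
  have h0 : s.u (bdry (s.z 0)) = y := s.vertex 0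
  rw [← h0, ← h.ha, ← h.lift, coe_bdry_exp, h.plane.vert₀]
  rfl


/-- The moduli space of triangles is parametrized by the indices. -/
theorem exists_index (hm₁ : 0 < m₁) (hm₂ : 0 < m₂) (𝒥 : CxStructure) (k₁ k₂ : ℤ) (y : Torus) :
    ∃ f : Moduli 𝒥 (lags 0 m₁ ((m₁ : ℤ) + m₂)) ![y, xGen m₁ k₁, twistedGen m₁ m₂ k₂] → ℤ,
      Function.Injective f ∧ (∀ c, HasIndex c.rep (f c)) ∧
      range f = {ℓ : ℤ | xPt (Efun m₁ m₂ ((k₁ : ℝ) / m₁) ((k₂ : ℝ) / m₂ + ℓ)) = y} := by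
  choose f hf using fun c : Moduli 𝒥 (lags 0 m₁ ((m₁ : ℤ) + m₂))
    ![y, xGen m₁ k₁, twistedGen m₁ m₂ k₂] =>
    show ∃ ℓ, HasIndex c.rep ℓ by
      obtain ⟨ℓ, a, b, c', W, h⟩ := exists_isNormalized hm₁ hm₂ c.rep
      exact ⟨ℓ, h.hasIndex⟩
  refine ⟨f, fun c d hcd => ?_, hf, Subset.antisymm ?_ ?_⟩
  · have h := hf c
    rw [hcd] at h
    exact Quotient.out_equiv_out.1 (h.equiv hm₁ hm₂ (hf d))
  · rintro _ ⟨c, rfl⟩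
    exact (hf c).xPt_eq hm₁ hm₂
  · intro ℓ hℓ
    obtain ⟨s, U, hU, hl, h1, h2⟩ := exists_productTriangle 𝒥 hm₁ hm₂ k₁ k₂ ℓ hℓ
    refine ⟨Quotient.mk _ s, (hf _).unique (HasIndex.congr ?_ ⟨U, hU, hl, h1, h2⟩)⟩
    exact Quotient.mk_out (s := triangleSetoid 𝒥 _ _) s

end Index

end TorusFloer
end

noncomputable section
namespace TorusFloer

open Complex Set Filter Topology MeasureTheory Metric

/-! ### Signs -/

/-- A function that goes up and comes back takes values in a set an even number of times. -/
theorem even_ncard_of_strictMonoOn_of_strictAntiOn {f : ℝ → ℝ} (hf : Continuous f) {p q r : ℝ}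
    (hpq : p < q) (hqr : q < r) (h1 : StrictMonoOn f (Icc p q)) (h2 : StrictAntiOn f (Icc q r))
    (hpr : f p = f r) {P : Set ℝ} (hp : f p ∉ P) (hq : f q ∉ P) :
    Even {τ | τ ∈ Ico p r ∧ f τ ∈ P}.ncard := by
  set S := {τ | τ ∈ Ico p r ∧ f τ ∈ P}
  by_cases hS : S.Finite
  swap
  -- An infinite set has `ncard` equal to 0, which is even.
  · rw [Set.Infinite.ncard hS]; exact ⟨0, rfl⟩
  set S₁ := {τ | τ ∈ Icc p q ∧ f τ ∈ P}
  set S₂ := {τ | τ ∈ Icc q r ∧ f τ ∈ P}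
  have hSU : S = S₁ ∪ S₂ := by
    ext τ
    constructor
    · rintro ⟨⟨h3, h4⟩, h5⟩
      rcases le_total τ q with h | h
      exacts [Or.inl ⟨⟨h3, h⟩, h5⟩, Or.inr ⟨⟨h, h4.le⟩, h5⟩]
    · rintro (⟨⟨h3, h4⟩, h5⟩ | ⟨⟨h3, h4⟩, h5⟩)
      · exact ⟨⟨h3, h4.trans_lt hqr⟩, h5⟩
      · refine ⟨⟨hpq.le.trans h3, lt_of_le_of_ne h4 ?_⟩, h5⟩
        rintro rfl
        exact hp (hpr ▸ h5)
  have hdisj : Disjoint S₁ S₂ := by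
    rw [Set.disjoint_left]
    rintro τ ⟨h3, h4⟩ ⟨h5, -⟩
    exact hq (le_antisymm h3.2 h5.1 ▸ h4)
  -- The ascending and descending pieces sweep out the same interval injectively, so they meet P
  -- equally often; neither turning value belongs to P.
  have hi1 : f '' S₁ = Icc (f p) (f q) ∩ P := by
    ext t
    constructor
    · rintro ⟨τ, ⟨h3, h4⟩, rfl⟩
      exact ⟨⟨h1.monotoneOn (left_mem_Icc.2 hpq.le) h3 h3.1,
        h1.monotoneOn h3 (right_mem_Icc.2 hpq.le) h3.2⟩, h4⟩
    · rintro ⟨h3, h4⟩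
      obtain ⟨τ, hτ, rfl⟩ := intermediate_value_Icc hpq.le hf.continuousOn h3
      exact ⟨τ, ⟨hτ, h4⟩, rfl⟩
  have hi2 : f '' S₂ = Icc (f p) (f q) ∩ P := by
    ext t
    constructor
    · rintro ⟨τ, ⟨h3, h4⟩, rfl⟩
      exact ⟨⟨hpr ▸ h2.antitoneOn h3 (right_mem_Icc.2 hqr.le) h3.2,
        h2.antitoneOn (left_mem_Icc.2 hqr.le) h3 h3.1⟩, h4⟩
    · rintro ⟨h3, h4⟩
      rw [hpr] at h3
      obtain ⟨τ, hτ, rfl⟩ := intermediate_value_Icc' hqr.le hf.continuousOn h3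
      exact ⟨τ, ⟨hτ, h4⟩, rfl⟩
  have hc1 := (h1.injOn.mono (show S₁ ⊆ Icc p q from fun _ h => h.1)).ncard_image
  have hc2 := (h2.injOn.mono (show S₂ ⊆ Icc q r from fun _ h => h.1)).ncard_image
  rw [hSU, ncard_union_eq hdisj (hS.subset (hSU ▸ subset_union_left))
    (hS.subset (hSU ▸ subset_union_right)), ← hc1, ← hc2, hi1, hi2]
  exact ⟨_, rfl⟩

theorem fst_affine (P Q : ℝ × ℝ) (r : ℝ) : (P + r • (Q - P)).1 = P.1 + r * (Q.1 - P.1) := by simp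

/-- In a nondegenerate plane triangle, the first coordinate along the boundary goes strictly
monotonically from `u` to `v` and back. -/
theorem IsPlaneTriangle.strictMonoOn_fst {𝒥 : CxStructure} {m₁ m₂ : ℕ} {u v a b c : ℝ}
    {W : ℂ → ℝ × ℝ} (h : IsPlaneTriangle 𝒥 m₁ m₂ u v a b c W) (hm₁ : 0 < m₁) (hm₂ : 0 < m₂)
    (huv : u ≠ v) :
    StrictMonoOn (fun τ => (v - u) * (W (cis τ)).1) (Icc b c) ∧
      StrictAntiOn (fun τ => (v - u) * (W (cis τ)).1) (Icc c (b + 2 * Real.pi)) := by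
  obtain ⟨F, hF, e⟩ := h.exists_isTriangleMap hm₁ hm₂ huv
  obtain ⟨ρ₀, mono₀, -, -, f0⟩ := hF.edge₀
  obtain ⟨ρ₁, mono₁, -, -, f1⟩ := hF.edge₁
  obtain ⟨ρ₂, mono₂, -, -, f2⟩ := hF.edge₂
  have key : ∀ {P Q : ℝ × ℝ} {r τ : ℝ},
      F (cis τ) = 𝒥.toComplex P + r * (𝒥.toComplex Q - 𝒥.toComplex P) →
      (W (cis τ)).1 = P.1 + r * (Q.1 - P.1) := by
    intro P Q r τ hr
    have h1 : 𝒥.toComplex (W (cis τ)) = 𝒥.toComplex (P + r • (Q - P)) := by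
      rw [map_add, map_smul, map_sub, Complex.real_smul, ← hr]
      exact e (cis_mem_closedBall τ)
    rw [𝒥.toComplex.injective h1, fst_affine]
  have hsq : 0 < (u - v) ^ 2 := by have := sub_ne_zero.2 huv; positivity
  have hm : (0 : ℝ) < m₁ + m₂ := by positivity
  -- The weighted mean E lies strictly between u and v. The factor v - u expresses this, and the
  -- monotonicity below, for both orders of u and v at once.
  have e1 : (v - u) * (Efun m₁ m₂ u v - u) = m₂ / (m₁ + m₂) * (u - v) ^ 2 := by
    rw [Efun]; field_simp; ring
  have e2 : (v - u) * (v - Efun m₁ m₂ u v) = m₁ / (m₁ + m₂) * (u - v) ^ 2 := by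
    rw [Efun]; field_simp; ring
  have p1 : 0 < (v - u) * (Efun m₁ m₂ u v - u) := by rw [e1]; positivity
  have p2 : 0 < (v - u) * (v - Efun m₁ m₂ u v) := by rw [e2]; positivity
  refine ⟨fun x hx y hy hxy => ?_, ?_⟩
  · have := mono₁ hx hy hxy
    simp only [key (f1 x hx), key (f1 y hy), TorusFloer.vert₁, TorusFloer.vert₂]
    nlinarith
  have anti₂ : StrictAntiOn (fun τ => (v - u) * (W (cis τ)).1) (Icc c (a + 2 * Real.pi)) := by
    intro x hx y hy hxy
    have := mono₂ hx hy hxy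
    simp only [key (f2 x hx), key (f2 y hy), TorusFloer.vert₀, TorusFloer.vert₂]
    nlinarith
  have anti₀ : StrictAntiOn (fun τ => (v - u) * (W (cis τ)).1)
      (Icc (a + 2 * Real.pi) (b + 2 * Real.pi)) := by
    intro x hx y hy hxy
    have hx' : x - 2 * Real.pi ∈ Icc a b := ⟨by linarith [hx.1], by linarith [hx.2]⟩
    have hy' : y - 2 * Real.pi ∈ Icc a b := ⟨by linarith [hy.1], by linarith [hy.2]⟩
    have := mono₀ hx' hy' (by linarith)
    have gx := key (f0 _ hx')
    have gy := key (f0 _ hy')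
    rw [← cis_add_two_pi, sub_add_cancel] at gx gy
    simp only [gx, gy, TorusFloer.vert₀, TorusFloer.vert₁]
    nlinarith
  have := anti₂.union anti₀ (isGreatest_Icc h.hca.le) (isLeast_Icc (by linarith [h.hab]))
  rwa [Icc_union_Icc_eq_Icc h.hca.le (by linarith [h.hab])] at this

section Signs

variable {𝒥 : CxStructure} {m₁ m₂ : ℕ} {k₁ k₂ : ℤ} {y : Torus}

/-- The boundary passes through a star exactly where the first coordinate is `ε` modulo `1`. -/
theorem IsNormalized.star_iff (hm₁ : 0 < m₁) (hm₂ : 0 < m₂)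
    {s : ProductTriangle 𝒥 m₁ m₂ k₁ k₂ y} {ℓ : ℤ} {a b c : ℝ} {W : ℂ → ℝ × ℝ}
    (h : IsNormalized s ℓ a b c W) (ε : ℝ) {τ : ℝ} (hτ : τ ∈ Ico b (b + 2 * Real.pi)) :
    (∃ i, s.u (bdry (Circle.exp τ)) = ![star ε 0, star ε m₁, star ε ((m₁ : ℤ) + m₂)] i) ↔
      ∃ n : ℤ, (W (cis τ)).1 = ε + n := by
  rw [← h.lift, coe_bdry_exp]
  constructor
  · rintro ⟨i, hi⟩
    fin_cases i <;> exact (pt_eq_pt_iff.1 hi).1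
  · intro hn
    have key : ∀ (m : ℤ) (k : ℤ), (W (cis τ)).2 + m * (W (cis τ)).1 = k →
        pt (W (cis τ)) = star ε m := by
      intro m k hk
      obtain ⟨n, hn⟩ := hn
      refine pt_eq_pt_iff.2 ⟨⟨n, hn⟩, k - m * n, ?_⟩
      push_cast
      rw [hn] at hk
      linarith
    have hm₁' : (m₁ : ℝ) * (k₁ / m₁) = k₁ := by field_simp
    have hm₂' : (m₂ : ℝ) * (k₂ / m₂ + ℓ) = k₂ + m₂ * ℓ := by field_simp
    rcases le_total τ c with h1 | h1
    · refine ⟨1, key m₁ k₁ ?_⟩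
      have := h.plane.edge₁ τ ⟨hτ.1, h1⟩
      push_cast; rw [this, hm₁']
    rcases le_total τ (a + 2 * Real.pi) with h2 | h2
    · refine ⟨2, key (m₁ + m₂) (k₁ + (k₂ + m₂ * ℓ)) ?_⟩
      have := h.plane.edge₂ τ ⟨h1, h2⟩
      push_cast; rw [this, hm₁', hm₂']
    · refine ⟨0, key 0 0 ?_⟩
      have := h.plane.edge₀ (τ - 2 * Real.pi) ⟨by linarith, by linarith [hτ.2]⟩
      rw [← cis_add_two_pi, sub_add_cancel] at this
      simp [this]

/-- Stars occur exactly at abscissas in ε + ℤ. The turning abscissas u and v are rational while ε is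
irrational, so no star sits at a turning point and the crossings pair up between the outward and the
return path. -/
theorem even_numStars (hm₁ : 0 < m₁) (hm₂ : 0 < m₂) {ε : ℝ} (hε : Irrational ε)
    (s : ProductTriangle 𝒥 m₁ m₂ k₁ k₂ y) :
    Even (s.numStars ![star ε 0, star ε m₁, star ε ((m₁ : ℤ) + m₂)]) := by
  obtain ⟨ℓ, a, b, c, W, h⟩ := exists_isNormalized hm₁ hm₂ s
  set u : ℝ := (k₁ : ℝ) / m₁ with hu
  set v : ℝ := (k₂ : ℝ) / m₂ + ℓ with hv
  have hu' : ∀ n : ℤ, u ≠ ε + n := fun n hn =>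
    (hε.add_intCast n) ⟨(k₁ : ℚ) / m₁, by push_cast; rw [← hn, hu]⟩
  have hv' : ∀ n : ℤ, v ≠ ε + n := fun n hn =>
    (hε.add_intCast n) ⟨(k₂ : ℚ) / m₂ + ℓ, by push_cast; rw [← hn, hv]⟩
  have hset : {w : Circle | ∃ i, s.u (bdry w) =
      ![star ε 0, star ε m₁, star ε ((m₁ : ℤ) + m₂)] i} =
      (fun τ => Circle.exp τ) '' {τ | τ ∈ Ico b (b + 2 * Real.pi) ∧
        ∃ n : ℤ, (W (cis τ)).1 = ε + n} := by
    ext w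
    constructor
    · intro hw
      obtain ⟨τ, hτ, rfl⟩ := exists_circle_exp w b
      exact ⟨τ, ⟨hτ, (h.star_iff hm₁ hm₂ ε hτ).1 hw⟩, rfl⟩
    · rintro ⟨τ, ⟨hτ, hn⟩, rfl⟩
      exact (h.star_iff hm₁ hm₂ ε hτ).2 hn
  rw [HolTriangle.numStars, hset, InjOn.ncard_image]
  swap
  · rintro x ⟨hx, -⟩ x' ⟨hx', -⟩ hxx
    refine cis_injOn b hx hx' ?_
    rw [← circle_exp_eq_cis, ← circle_exp_eq_cis]
    exact congrArg _ hxx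
  by_cases huv : u = v
  · have : {τ | τ ∈ Ico b (b + 2 * Real.pi) ∧ ∃ n : ℤ, (W (cis τ)).1 = ε + n} = ∅ := by
      ext τ
      simp only [mem_empty_iff_false, iff_false]
      rintro ⟨-, n, hn⟩
      rw [h.plane.eq_const hm₁ huv _ (cis_mem_closedBall τ)] at hn
      exact hu' n hn
    rw [this, ncard_empty]; exact ⟨0, rfl⟩
  · obtain ⟨h1, h2⟩ := h.plane.strictMonoOn_fst hm₁ hm₂ huv
    have hvu : v - u ≠ 0 := sub_ne_zero.2 (Ne.symm huv)
    have hb : (W (cis b)).1 = u := by rw [h.plane.vert₁]; rfl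
    have hc : (W (cis c)).1 = v := by rw [h.plane.vert₂]; rfl
    have hcont : Continuous fun τ => (v - u) * (W (cis τ)).1 := continuous_const.mul
      (continuous_fst.comp (h.plane.cont.comp_continuous continuous_cis cis_mem_closedBall))
    have := even_ncard_of_strictMonoOn_of_strictAntiOn hcont h.plane.hbc
      (by linarith [h.plane.hca, h.plane.hab]) h1 h2 (by rw [cis_add_two_pi])
      (P := {t | ∃ n : ℤ, t = (v - u) * (ε + n)}) ?_ ?_
    · convert this using 4
      exact and_congr_right fun _ => exists_congr fun n => (mul_right_inj' hvu).symm
    · rintro ⟨n, hn⟩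
      rw [hb] at hn
      exact hu' n (mul_left_cancel₀ hvu hn)
    · rintro ⟨n, hn⟩
      rw [hc] at hn
      exact hv' n (mul_left_cancel₀ hvu hn)

theorem mas_dir {m m' : ℤ} (h : m < m') : mas (dir m) (dir m') = 0 := by
  have : (m : ℝ) < m' := by exact_mod_cast h
  rw [mas, if_pos]
  simp only [dir]
  linarith

theorem triSign_eq_one (hm₁ : 0 < m₁) (hm₂ : 0 < m₂) {ε : ℝ} (hε : Irrational ε)
    (s : ProductTriangle 𝒥 m₁ m₂ k₁ k₂ y) : triSign 0 m₁ ((m₁ : ℤ) + m₂) ε s = 1 := by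
  have h1 : (0 : ℤ) < m₁ := by exact_mod_cast hm₁
  have h2 : (0 : ℤ) < m₂ := by exact_mod_cast hm₂
  rw [triSign, mas_dir h1, mas_dir (add_pos h1 h2), mas_dir (show (m₁ : ℤ) < m₁ + m₂ by linarith)]
  simpa using (even_numStars hm₁ hm₂ hε s).neg_one_pow

end Signs

end TorusFloer
end

noncomputable section
namespace TorusFloer

open Complex Set Filter Topology MeasureTheory Metric

/-! ### Areas -/

theorem det_eq_of_complex (L : ℂ →L[ℝ] ℂ) :
    L.det = (L 1).re * (L I).im - (L 1).im * (L I).re := by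
  rw [ContinuousLinearMap.det, ← LinearMap.det_toMatrix Complex.basisOneI, Matrix.det_fin_two]
  simp [LinearMap.toMatrix_apply]
  ring

theorem volume_openTri_zero_one_I : volume (openTri 0 1 I) = ENNReal.ofReal (1 / 2) := by
  have h : openTri 0 1 I = Complex.measurableEquivRealProd ⁻¹'
      regionBetween (fun _ => 0) (fun x => 1 - x) (Ioo 0 1) := by
    ext z
    simp only [openTri, cr, regionBetween, mem_preimage, Set.mem_ofPred_eq,
      Complex.measurableEquivRealProd_apply, mem_Ioo]
    simp
    constructor
    · rintro ⟨h1, h2, h3⟩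
      refine ⟨⟨?_, ?_⟩, ?_, ?_⟩ <;> linarith
    · rintro ⟨⟨h1, h2⟩, h3, h4⟩
      refine ⟨?_, ?_, ?_⟩ <;> linarith
  rw [h, Complex.volume_preserving_equiv_real_prod.measure_preimage_equiv,
    Measure.volume_eq_prod, volume_regionBetween_eq_integral]
  · congr 1
    rw [← integral_Ioc_eq_integral_Ioo, ← intervalIntegral.integral_of_le zero_le_one]
    simp only [Pi.sub_apply, sub_zero]
    rw [intervalIntegral.integral_sub (by simp) (by simp)]
    norm_num [integral_id]
  · exact integrableOn_const (by simp) (by simp)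
  · exact (Continuous.integrableOn_Icc (by fun_prop)).mono_set Ioo_subset_Icc_self
  · exact measurableSet_Ioo
  · intro x hx
    linarith [hx.2]

/-- The triangle is an affine image of the standard one, and the determinant of the linear part is
twice its signed area. -/
theorem volume_openTri {A₀ A₁ A₂ : ℂ} (h : 0 < cr A₀ A₁ A₂) :
    volume (openTri A₀ A₁ A₂) = ENNReal.ofReal (cr A₀ A₁ A₂ / 2) := by
  set M : ℂ →L[ℝ] ℂ := Complex.reCLM.smulRight (A₁ - A₀) + Complex.imCLM.smulRight (A₂ - A₀) with hM
  have hMz : ∀ z, M z = (z.re : ℂ) * (A₁ - A₀) + z.im * (A₂ - A₀) := fun z => by simp [hM]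
  have hdet : LinearMap.det (M : ℂ →ₗ[ℝ] ℂ) = cr A₀ A₁ A₂ := by
    change M.det = _
    rw [det_eq_of_complex, hMz, hMz, cr]
    simp
  have hpre : openTri 0 1 I = M ⁻¹' ((fun z => A₀ + z) ⁻¹' openTri A₀ A₁ A₂) := by
    ext z
    have e0 : cr A₀ A₁ (A₀ + M z) = cr A₀ A₁ A₂ * cr 0 1 z := by
      rw [hMz]; simp [cr]; ring
    have e1 : cr A₁ A₂ (A₀ + M z) = cr A₀ A₁ A₂ * cr 1 I z := by
      rw [hMz]; simp [cr]; ring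
    have e2 : cr A₂ A₀ (A₀ + M z) = cr A₀ A₁ A₂ * cr I 0 z := by
      rw [hMz]; simp [cr]; ring
    simp only [openTri, mem_preimage, Set.mem_ofPred_eq, e0, e1, e2, mul_pos_iff_of_pos_left h]
  have h1 := volume_openTri_zero_one_I
  rw [hpre, Measure.addHaar_preimage_continuousLinearMap _ (by rw [hdet]; exact h.ne'), hdet,
    measure_preimage_add, abs_of_pos (inv_pos.2 h)] at h1
  have h2 : ENNReal.ofReal (cr A₀ A₁ A₂) * ENNReal.ofReal (cr A₀ A₁ A₂)⁻¹ = 1 := by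
    rw [← ENNReal.ofReal_mul h.le, mul_inv_cancel₀ h.ne', ENNReal.ofReal_one]
  rw [← one_mul (volume _), ← h2, mul_assoc, h1, ← ENNReal.ofReal_mul h.le]
  congr 1; ring

/-- The open triangle in the plane spanned by the lifted vertices. -/
def planeTri (m₁ m₂ : ℕ) (u v : ℝ) : Set (ℝ × ℝ) :=
  {p | 0 < cr2 (vert₀ m₁ m₂ u v) (vert₁ u) p ∧ 0 < cr2 (vert₁ u) (vert₂ m₁ u v) p ∧
    0 < cr2 (vert₂ m₁ u v) (vert₀ m₁ m₂ u v) p}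

theorem IsPlaneTriangle.bijOn {𝒥 : CxStructure} {m₁ m₂ : ℕ} {u v a b c : ℝ} {W : ℂ → ℝ × ℝ}
    (h : IsPlaneTriangle 𝒥 m₁ m₂ u v a b c W) (hm₁ : 0 < m₁) (hm₂ : 0 < m₂) (huv : u ≠ v) :
    BijOn W (ball 0 1) (planeTri m₁ m₂ u v) := by
  obtain ⟨F, hF, e⟩ := h.exists_isTriangleMap hm₁ hm₂ huv
  have hb := hF.bijOn_ball (cr_verts_pos 𝒥 hm₁ hm₂ huv)
  have e' : EqOn F (𝒥.toComplex ∘ W) (ball 0 1) := (e.mono ball_subset_closedBall).symm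
  have hpre : planeTri m₁ m₂ u v = 𝒥.toComplex ⁻¹' openTri (𝒥.toComplex (TorusFloer.vert₀ m₁ m₂ u v))
      (𝒥.toComplex (TorusFloer.vert₁ u)) (𝒥.toComplex (TorusFloer.vert₂ m₁ u v)) := by
    ext p
    simp only [planeTri, openTri, mem_preimage, Set.mem_ofPred_eq, 𝒥.cr_toComplex,
      mul_pos_iff_of_pos_left 𝒥.tau_im_pos]
  have hb' := hb.congr e'
  rw [hpre]
  refine ⟨fun w hw => hb'.mapsTo hw, fun w hw w' hw' hww => hb'.injOn hw hw' (by simp [hww]),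
    fun p hp => ?_⟩
  obtain ⟨w, hw, hwp⟩ := hb'.surjOn hp
  exact ⟨w, hw, 𝒥.toComplex.injective hwp⟩

section Area

variable {𝒥 : CxStructure} {m₁ m₂ : ℕ} {k₁ k₂ : ℤ} {y : Torus}

theorem IsNormalized.fderiv_eq {s : ProductTriangle 𝒥 m₁ m₂ k₁ k₂ y} {ℓ : ℤ} {a b c : ℝ}
    {W : ℂ → ℝ × ℝ} (h : IsNormalized s ℓ a b c W) (w : ℂ) :
    fderiv ℝ W w = fderiv ℝ s.lift w := by
  obtain ⟨i, j, hW⟩ := h.shift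
  rw [funext hW, fderiv_add_const]

/-- The interior maps injectively onto the Euclidean triangle, so the change of variables formula
computes the integral; in the degenerate case the map is constant and both sides vanish. -/
theorem IsNormalized.area_eq (hm₁ : 0 < m₁) (hm₂ : 0 < m₂)
    {s : ProductTriangle 𝒥 m₁ m₂ k₁ k₂ y} {ℓ : ℤ} {a b c : ℝ} {W : ℂ → ℝ × ℝ}
    (h : IsNormalized s ℓ a b c W) :
    s.area = m₁ * m₂ / (m₁ + m₂) * ((k₁ : ℝ) / m₁ - ((k₂ : ℝ) / m₂ + ℓ)) ^ 2 / 2 := by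
  set u : ℝ := (k₁ : ℝ) / m₁ with hu
  set v : ℝ := (k₂ : ℝ) / m₂ + ℓ with hv
  rw [HolTriangle.area]
  simp_rw [← h.fderiv_eq]
  by_cases huv : u = v
  · have : ∀ w ∈ ball (0 : ℂ) 1, (fderiv ℝ W w 1).1 * (fderiv ℝ W w I).2 -
        (fderiv ℝ W w 1).2 * (fderiv ℝ W w I).1 = 0 := by
      intro w hw
      have h1 : W =ᶠ[𝓝 w] fun _ => (u, 0) := by
        filter_upwards [isOpen_ball.mem_nhds hw] with z hz
        exact h.plane.eq_const hm₁ huv z (ball_subset_closedBall hz)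
      rw [h1.fderiv_eq]
      simp
    rw [setIntegral_congr_fun measurableSet_ball this, huv]
    simp
  · set e : (ℝ × ℝ) ≃L[ℝ] ℂ := Complex.equivRealProdCLM.symm with he
    have hcr : ∀ P Q p : ℝ × ℝ, cr (e P) (e Q) (e p) = cr2 P Q p := fun P Q p => by
      simp [cr, cr2, he]
    have hb := h.plane.bijOn hm₁ hm₂ huv
    have himg : (fun w => e (W w)) '' ball 0 1 =
        openTri (e (vert₀ m₁ m₂ u v)) (e (vert₁ u)) (e (vert₂ m₁ u v)) := by
      rw [← image_image, hb.image_eq, ContinuousLinearEquiv.image_eq_preimage_symm]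
      ext z
      rw [← e.apply_symm_apply z]
      simp only [planeTri, openTri, mem_preimage, Set.mem_ofPred_eq, hcr, e.symm_apply_apply]
      rfl
    have hdW : ∀ w ∈ ball (0 : ℂ) 1, DifferentiableAt ℝ W w := by
      obtain ⟨i, j, hW⟩ := h.shift
      intro w hw
      rw [funext hW]
      exact (s.isHolLift.differentiableAt hw).add_const _
    have hd : ∀ w ∈ ball (0 : ℂ) 1, HasFDerivWithinAt (fun w => e (W w))
        ((e : ℝ × ℝ →L[ℝ] ℂ).comp (fderiv ℝ W w)) (ball 0 1) w := fun w hw =>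
      ((e : ℝ × ℝ →L[ℝ] ℂ).hasFDerivAt.comp w (hdW w hw).hasFDerivAt).hasFDerivWithinAt
    have hinj : InjOn (fun w => e (W w)) (ball 0 1) := fun w hw w' hw' hww =>
      hb.injOn hw hw' (e.injective hww)
    have hpos : 0 < cr (e (vert₀ m₁ m₂ u v)) (e (vert₁ u)) (e (vert₂ m₁ u v)) := by
      rw [hcr, cr2_verts hm₁]
      have : 0 < (u - v) ^ 2 := by have := sub_ne_zero.2 huv; positivity
      positivity
    have key := integral_image_eq_integral_abs_det_fderiv_smul volume measurableSet_ball hd hinj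
      (fun _ => (1 : ℝ))
    rw [himg, setIntegral_const, Measure.real, volume_openTri hpos,
      ENNReal.toReal_ofReal (by positivity), hcr, cr2_verts hm₁] at key
    simp only [smul_eq_mul, mul_one] at key
    rw [key]
    refine setIntegral_congr_fun measurableSet_ball fun w hw => ?_
    have hJ : fderiv ℝ W w I = 𝒥.J (fderiv ℝ W w 1) := by
      have := s.isHolLift.hol w hw 1
      rwa [mul_one, ← h.fderiv_eq] at this
    have hdet : ((e : ℝ × ℝ →L[ℝ] ℂ).comp (fderiv ℝ W w)).det = (fderiv ℝ W w 1).1 *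
        (fderiv ℝ W w I).2 - (fderiv ℝ W w 1).2 * (fderiv ℝ W w I).1 := by
      rw [det_eq_of_complex]
      simp [he]
    -- The Jacobian is the pairing of a vector with its image under J, which is nonnegative because
    -- J induces the standard orientation.
    rw [hdet, abs_of_nonneg]
    rw [hJ]
    by_cases h0 : fderiv ℝ W w 1 = 0
    · simp [h0]
    · exact (𝒥.pos _ h0).le

end Area

end TorusFloer
end

noncomputable section
namespace TorusFloer

open Complex Set Filter Topology MeasureTheory Metric

/-! ### Counting lattice points in triangles -/

theorem mul_Efun {m₁ m₂ : ℕ} (hm : 0 < m₁) (u v : ℝ) :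
    (m₁ + m₂) * Efun m₁ m₂ u v = m₁ * u + m₂ * v := by
  have : (m₁ : ℝ) + m₂ ≠ 0 := by positivity
  rw [Efun]; field_simp

/-- The error under an integral shift is affine in s. It therefore drops out of λ, so the counting
may be carried out after translating everything to the right of 0. -/
theorem phi_add_natCast (s : ℝ) (R : ℕ) :
    phi (s + R) = phi s + R * s + ((R : ℝ) ^ 2 - R) / 2 := by
  have : s + R + 1 = s + 1 + R := by ring
  rw [phi, phi, this, Int.floor_add_natCast, Int.floor_add_natCast, Int.floor_add_one]
  push_cast
  ring

/-- For t with integral part n the nonzero terms are among i ≤ n, and their sum is (n + 1) t - n(n +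
1)/2. This is how φ enters the count. -/
theorem sum_max_sub (N : ℕ) : ∀ t : ℝ, 0 ≤ t → t < N →
    ∑ i ∈ Finset.range N, max (t - i) 0 = phi t + t := by
  induction N with
  | zero => intro t h0 h1; simp at h1; linarith
  | succ N ih =>
    intro t h0 h1
    push_cast at h1
    rcases lt_or_ge t N with h | h
    · rw [Finset.sum_range_succ, ih t h0 h, max_eq_right (by linarith), add_zero]
    · have hfl : ⌊t⌋ = N := Int.floor_eq_iff.2 ⟨by exact_mod_cast h, by exact_mod_cast h1⟩
      have hs : ∀ M : ℕ, M ≤ N + 1 →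
          ∑ i ∈ Finset.range M, max (t - i) 0 = M * t - M * (M - 1) / 2 := by
        intro M
        induction M with
        | zero => simp
        | succ M ihM =>
          intro hM
          have : (M : ℝ) ≤ N := by exact_mod_cast Nat.le_of_succ_le_succ hM
          rw [Finset.sum_range_succ, ihM (by omega), max_eq_left (by linarith)]
          push_cast
          ring
      rw [hs _ le_rfl, phi, Int.floor_add_one, hfl]
      push_cast
      ring

/-- The lattice points of column `a` in the triangle with edges `b = 0`, `b = h`, `b = h + d`, up to
boundary conventions. -/
def cell (up : Prop) [Decidable up] (h d : ℤ) : Finset ℤ :=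
  if up then Finset.Ico h (min 0 (h + d)) else Finset.Ico (max 0 (h + d)) h

/-- If h and d have the same sign, the interval is empty and the right side vanishes. The hypotheses
leave only one pattern of opposite signs for each orientation, and there both sides equal the
smaller of |h| and |d|. -/
theorem card_cell {up : Prop} [Decidable up] {h d : ℤ} (h1 : up → 0 < h → 0 ≤ d)
    (h2 : ¬up → h < 0 → d ≤ 0) : ((cell up h d).card : ℤ) = max h 0 + max d 0 - max (h + d) 0 := by
  unfold cell
  split_ifs with hup
  · have := h1 hup
    rw [Int.card_Ico]
    omega
  · have := h2 hup
    rw [Int.card_Ico]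
    omega

theorem add_intCast_pos_iff {θ : ℝ} (h0 : 0 < θ) (h1 : θ < 1) (n : ℤ) : 0 < θ + n ↔ 0 ≤ n := by
  constructor
  · intro h
    by_contra hn
    have : (n : ℝ) ≤ -1 := by exact_mod_cast (by omega : n ≤ -1)
    linarith
  · intro h
    have : (0 : ℝ) ≤ n := by exact_mod_cast h
    linarith

theorem add_intCast_neg_iff {θ : ℝ} (h0 : 0 < θ) (h1 : θ < 1) (n : ℤ) : θ + n < 0 ↔ n < 0 := by
  constructor
  · intro h
    by_contra hn
    have : (0 : ℝ) ≤ n := by exact_mod_cast (by omega : 0 ≤ n)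
    linarith
  · intro h
    have : (n : ℝ) ≤ -1 := by exact_mod_cast (by omega : n ≤ -1)
    linarith

theorem mul_pos_iff_neg {x y : ℝ} (hx : x < 0) : 0 < x * y ↔ y < 0 :=
  ⟨fun h => neg_of_mul_pos_right h hx.le, fun h => mul_pos_of_neg_of_neg hx h⟩

theorem mul_neg_iff_neg {x y : ℝ} (hx : 0 < x) : x * y < 0 ↔ y < 0 :=
  ⟨fun h => neg_of_mul_neg_right h hx.le, fun h => mul_neg_of_pos_of_neg hx h⟩

/-- The translates of `p` by the lattice that lie in the lifted triangle. -/
def triPts (m₁ m₂ : ℕ) (u v : ℝ) (p : ℝ × ℝ) : Set (ℤ × ℤ) :=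
  {n | p + ((n.1 : ℝ), (n.2 : ℝ)) ∈ planeTri m₁ m₂ u v}

theorem triPts_self (m₁ m₂ : ℕ) (u : ℝ) (p : ℝ × ℝ) : triPts m₁ m₂ u u p = ∅ := by
  ext n
  simp [triPts, planeTri, cr2_edge₁]

section Count

variable {m₁ m₂ : ℕ} {u v : ℝ} {c₁ c₂ : ℤ} {p : ℝ × ℝ}

/-- The edges lie at integral levels 0, c₁ and c₁ + c₂ of the functions y, y + m₁x and y + (m₁ +
m₂)x, while the values of these functions at p lie in (0, 1). Hence each strict real inequality
becomes an integral one, independent of p; the order of u and v decides its direction. -/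
theorem mem_triPts_iff (hm₁ : 0 < m₁) (hm₂ : 0 < m₂) (hu : (m₁ : ℝ) * u = c₁)
    (hv : (m₂ : ℝ) * v = c₂) (h1 : 0 < p.1) (h2 : 0 < p.2) (h3 : p.2 + (m₁ + m₂) * p.1 < 1)
    (n : ℤ × ℤ) :
    n ∈ triPts m₁ m₂ u v p ↔ n.2 ∈ cell (u < v) (c₁ - m₁ * n.1) (c₂ - m₂ * n.1) := by
  have hM₁ : (0 : ℝ) < m₁ := by exact_mod_cast hm₁
  have hM₂ : (0 : ℝ) < m₂ := by exact_mod_cast hm₂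
  have q1 : 0 < m₁ * p.1 := by positivity
  have q2 : 0 < m₂ * p.1 := by positivity
  obtain ⟨a, b⟩ := n
  have e1 : p.2 + b + m₁ * (p.1 + a) - m₁ * u =
      p.2 + m₁ * p.1 + ((b - (c₁ - m₁ * a) : ℤ) : ℝ) := by
    push_cast; rw [hu]; ring
  have e2 : p.2 + b + (m₁ + m₂) * (p.1 + a) - (m₁ * u + m₂ * v) =
      p.2 + (m₁ + m₂) * p.1 + ((b - (c₁ - m₁ * a + (c₂ - m₂ * a)) : ℤ) : ℝ) := by
    push_cast; rw [hu, hv]; ring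
  have s1 := Efun_sub (m₂ := m₂) hm₁ u v
  have s2 := Efun_sub' (m₂ := m₂) hm₁ u v
  simp only [triPts, planeTri, Set.mem_ofPred_eq, cr2_edge₀, cr2_edge₁, cr2_edge₂ hm₁,
    Prod.fst_add, Prod.snd_add, e1, e2]
  have t2 : 0 < p.2 + m₁ * p.1 := by linarith
  have t2' : p.2 + m₁ * p.1 < 1 := by linarith
  have t3 : 0 < p.2 + (m₁ + m₂) * p.1 := by linarith
  have t1' : p.2 < 1 := by linarith
  rcases lt_trichotomy u v with huv | huv | huv
  · have n1 : u - Efun m₁ m₂ u v < 0 := by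
      by_contra hc
      push Not at hc
      have := mul_nonneg (add_pos hM₁ hM₂).le hc
      nlinarith
    have n2 : Efun m₁ m₂ u v - v < 0 := by
      by_contra hc
      push Not at hc
      have := mul_nonneg (add_pos hM₁ hM₂).le hc
      nlinarith
    rw [mul_pos_iff_neg n1, mul_pos_iff_neg n2,
      mul_pos_iff_of_pos_left (sub_pos.2 huv), add_intCast_neg_iff h2 t1',
      add_intCast_pos_iff t2 t2', add_intCast_neg_iff t3 h3, cell, if_pos huv, Finset.mem_Ico]
    omega
  · subst huv
    simp only [sub_self, zero_mul, lt_self_iff_false, false_and, and_false, false_iff, cell,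
      if_false, Finset.mem_Ico, not_and, not_lt]
    intro hb
    by_contra hc
    push Not at hc
    have i1 : (0 : ℤ) < c₁ - m₁ * a := by omega
    have i2 : (c₂ - m₂ * a : ℤ) < 0 := by omega
    have r1 : (0 : ℝ) < c₁ - m₁ * a := by exact_mod_cast i1
    have r2 : (c₂ - m₂ * a : ℝ) < 0 := by exact_mod_cast i2
    rw [← hu, ← mul_sub] at r1
    rw [← hv, ← mul_sub] at r2
    have := mul_pos hM₂ ((mul_pos_iff_of_pos_left hM₁).1 r1)
    linarith
  · have n1 : 0 < u - Efun m₁ m₂ u v := by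
      by_contra hc
      push Not at hc
      have := mul_nonneg (add_pos hM₁ hM₂).le (neg_nonneg.2 hc)
      nlinarith
    have n2 : 0 < Efun m₁ m₂ u v - v := by
      by_contra hc
      push Not at hc
      have := mul_nonneg (add_pos hM₁ hM₂).le (neg_nonneg.2 hc)
      nlinarith
    rw [mul_pos_iff_of_pos_left n1, mul_pos_iff_of_pos_left n2,
      mul_pos_iff_neg (sub_neg.2 huv), add_intCast_pos_iff h2 t1',
      add_intCast_neg_iff t2 t2', add_intCast_pos_iff t3 h3, cell, if_neg huv.not_gt,
      Finset.mem_Ico]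
    omega

/-- The triangle contains `λ(u, v)` translates of a point close to `0` in the first quadrant. -/
theorem ncard_triPts (hm₁ : 0 < m₁) (hm₂ : 0 < m₂) (hu : (m₁ : ℝ) * u = c₁)
    (hv : (m₂ : ℝ) * v = c₂) (h1 : 0 < p.1) (h2 : 0 < p.2) (h3 : p.2 + (m₁ + m₂) * p.1 < 1) :
    ((triPts m₁ m₂ u v p).ncard : ℝ) = lam m₁ m₂ u v := by
  classical
  have hM₁ : (0 : ℝ) < m₁ := by exact_mod_cast hm₁
  have hM₂ : (0 : ℝ) < m₂ := by exact_mod_cast hm₂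
  obtain ⟨R, hR⟩ := exists_nat_ge (max |u| |v|)
  have hRu := abs_le.1 ((le_max_left _ _).trans hR)
  have hRv := abs_le.1 ((le_max_right _ _).trans hR)
  -- Only the columns from -R to R can contain points. Shifted by R they are numbered from 0 to 2R,
  -- and u + R, v + R, E + R all lie in [0, N).
  set N := 2 * R + 1 with hN
  have hNR : (N : ℝ) = 2 * R + 1 := by rw [hN]; push_cast; ring
  set g : ℤ → Finset ℤ := fun a => cell (u < v) (c₁ - m₁ * a) (c₂ - m₂ * a) with hg
  have k1 : ∀ a : ℤ, ((c₁ - m₁ * a : ℤ) : ℝ) = m₁ * (u - a) := fun a => by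
    push_cast; rw [← hu]; ring
  have k2 : ∀ a : ℤ, ((c₂ - m₂ * a : ℤ) : ℝ) = m₂ * (v - a) := fun a => by
    push_cast; rw [← hv]; ring
  have k3 : ∀ a : ℤ, ((c₁ - m₁ * a + (c₂ - m₂ * a) : ℤ) : ℝ) =
      (m₁ + m₂) * (Efun m₁ m₂ u v - a) := fun a => by
    rw [Int.cast_add, k1, k2, mul_sub _ (Efun _ _ _ _), mul_Efun hm₁]; ring
  have pos1 : ∀ a : ℤ, 0 < c₁ - m₁ * a ↔ (a : ℝ) < u := fun a => by
    rw [← sub_pos (b := (a : ℝ)), ← mul_pos_iff_of_pos_left hM₁, ← k1]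
    exact Int.cast_pos.symm
  have pos2 : ∀ a : ℤ, 0 < c₂ - m₂ * a ↔ (a : ℝ) < v := fun a => by
    rw [← sub_pos (b := (a : ℝ)), ← mul_pos_iff_of_pos_left hM₂, ← k2]
    exact Int.cast_pos.symm
  have neg1 : ∀ a : ℤ, c₁ - m₁ * a < 0 ↔ u < a := fun a => by
    rw [← sub_neg (b := (a : ℝ)), ← mul_neg_iff_neg hM₁, ← k1]
    exact Int.cast_lt_zero.symm
  have neg2 : ∀ a : ℤ, c₂ - m₂ * a < 0 ↔ v < a := fun a => by
    rw [← sub_neg (b := (a : ℝ)), ← mul_neg_iff_neg hM₂, ← k2]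
    exact Int.cast_lt_zero.symm
  have hcard : ∀ a : ℤ, ((g a).card : ℝ) = m₁ * max (u - a) 0 + m₂ * max (v - a) 0 -
      (m₁ + m₂) * max (Efun m₁ m₂ u v - a) 0 := by
    intro a
    have := card_cell (up := u < v) (h := c₁ - m₁ * a) (d := c₂ - m₂ * a)
      (fun huv h => ((pos2 a).2 (((pos1 a).1 h).trans huv)).le)
      (fun huv h => ((neg2 a).2 ((not_lt.1 huv).trans_lt ((neg1 a).1 h))).le)
    have := congrArg (Int.cast : ℤ → ℝ) this
    rw [Int.cast_natCast, Int.cast_sub, Int.cast_add, Int.cast_max, Int.cast_max, Int.cast_max,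
      k1, k2, k3, Int.cast_zero] at this
    rw [mul_max_of_nonneg _ _ hM₁.le, mul_max_of_nonneg _ _ hM₂.le,
      mul_max_of_nonneg _ _ (add_pos hM₁ hM₂).le, mul_zero, mul_zero, mul_zero]
    exact this
  have hempty : ∀ a : ℤ, a < -R ∨ R < a → g a = ∅ := by
    intro a ha
    rw [hg]
    simp only [cell]
    rcases ha with ha | ha
    · have ha' : (a : ℝ) < -R := by exact_mod_cast ha
      have := (pos1 a).2 (by linarith)
      have := (pos2 a).2 (by linarith)
      split_ifs <;> rw [Finset.Ico_eq_empty_iff] <;> omega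
    · have ha' : (R : ℝ) < a := by exact_mod_cast ha
      have := (neg1 a).2 (by linarith)
      have := (neg2 a).2 (by linarith)
      split_ifs <;> rw [Finset.Ico_eq_empty_iff] <;> omega
  let f : (Σ _ : ℕ, ℤ) → ℤ × ℤ := fun x => ((x.1 : ℤ) - R, x.2)
  have hf : Function.Injective f := by
    rintro ⟨i, b⟩ ⟨j, b'⟩ hij
    simp only [f, Prod.mk.injEq] at hij
    obtain ⟨h4, rfl⟩ := hij
    obtain rfl : i = j := by omega
    rfl
  have hset : triPts m₁ m₂ u v p =
      f '' ((Finset.range N).sigma fun i => g ((i : ℤ) - R) : Finset (Σ _ : ℕ, ℤ)) := by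
    ext ⟨a, b⟩
    rw [mem_triPts_iff hm₁ hm₂ hu hv h1 h2 h3]
    change b ∈ g a ↔ _
    constructor
    · intro hb
      have ha : -(R : ℤ) ≤ a ∧ a ≤ R := by
        by_contra hc
        rw [hempty a (by omega)] at hb
        exact absurd hb (Finset.notMem_empty b)
      have hi : (((a + R).toNat : ℕ) : ℤ) - R = a := by omega
      refine ⟨⟨(a + R).toNat, b⟩, ?_, ?_⟩
      · rw [Finset.mem_coe, Finset.mem_sigma]
        simp only
        rw [hi, Finset.mem_range]
        exact ⟨by omega, hb⟩
      · simp only [f, hi]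
    · rintro ⟨⟨i, b'⟩, hmem, hib⟩
      rw [Finset.mem_coe, Finset.mem_sigma] at hmem
      simp only [f, Prod.mk.injEq] at hib
      rw [← hib.1, ← hib.2]
      exact hmem.2
  rw [hset, ncard_image_of_injective _ hf, ncard_coe_finset, Finset.card_sigma, Nat.cast_sum]
  simp_rw [hcard]
  have hsum : ∀ s : ℝ, -(R : ℝ) ≤ s → s ≤ R →
      ∑ i ∈ Finset.range N, max (s - (((i : ℤ) - R : ℤ) : ℝ)) 0 =
        phi s + R * s + ((R : ℝ) ^ 2 - R) / 2 + (s + R) := by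
    intro s hs1 hs2
    rw [← phi_add_natCast, ← sum_max_sub N (s + R) (by linarith) (by linarith)]
    refine Finset.sum_congr rfl fun i _ => ?_
    push_cast
    congr 1; ring
  have hE := mul_Efun (m₂ := m₂) hm₁ u v
  have hE1 : -(R : ℝ) ≤ Efun m₁ m₂ u v := by
    rw [Efun, le_div_iff₀ (by positivity)]
    nlinarith
  have hE2 : Efun m₁ m₂ u v ≤ R := by
    rw [Efun, div_le_iff₀ (by positivity)]
    nlinarith
  rw [Finset.sum_sub_distrib, Finset.sum_add_distrib, ← Finset.mul_sum, ← Finset.mul_sum,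
    ← Finset.mul_sum, hsum u hRu.1 hRu.2, hsum v hRv.1 hRv.2, hsum _ hE1 hE2, lam]
  -- The constants cancel because the weights m₁, m₂ add up to m₁ + m₂, and the linear terms because
  -- E is the weighted mean.
  linear_combination (-(R : ℝ) - 1) * hE

end Count

section Mult

variable {𝒥 : CxStructure} {m₁ m₂ : ℕ} {k₁ k₂ : ℤ} {y : Torus}

theorem IsNormalized.boundary_mem (hm₁ : 0 < m₁) (hm₂ : 0 < m₂)
    {s : ProductTriangle 𝒥 m₁ m₂ k₁ k₂ y} {ℓ : ℤ} {a b c : ℝ} {W : ℂ → ℝ × ℝ}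
    (h : IsNormalized s ℓ a b c W) {w : ℂ} (hw : ‖w‖ = 1) :
    pt (W w) ∈ Lag 0 ∪ Lag m₁ ∪ Lag ((m₁ : ℤ) + m₂) := by
  have hm₁' : (m₁ : ℝ) * (k₁ / m₁) = k₁ := by field_simp
  have hm₂' : (m₂ : ℝ) * (k₂ / m₂ + ℓ) = k₂ + m₂ * ℓ := by field_simp
  obtain ⟨τ, rfl, hτ | hτ | hτ⟩ := exists_arc hw a b c
  · refine Or.inl (Or.inl (pt_mem_Lag_iff.2 ⟨0, ?_⟩))
    rw [h.plane.edge₀ τ (Ico_subset_Icc_self hτ)]; simp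
  · refine Or.inl (Or.inr (pt_mem_Lag_iff.2 ⟨k₁, ?_⟩))
    push_cast
    rw [h.plane.edge₁ τ (Ico_subset_Icc_self hτ), hm₁']
  · refine Or.inr (pt_mem_Lag_iff.2 ⟨k₁ + (k₂ + m₂ * ℓ), ?_⟩)
    push_cast
    rw [h.plane.edge₂ τ (Ico_subset_Icc_self hτ), hm₁', hm₂']

/-- As the point avoids the three circles, no boundary point maps to it. In the interior the lift is
a bijection onto the open triangle, so preimages correspond to the lattice translates of p in that
triangle. -/
theorem IsNormalized.mult_eq (hm₁ : 0 < m₁) (hm₂ : 0 < m₂)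
    {s : ProductTriangle 𝒥 m₁ m₂ k₁ k₂ y} {ℓ : ℤ} {a b c : ℝ} {W : ℂ → ℝ × ℝ}
    (h : IsNormalized s ℓ a b c W) {p : ℝ × ℝ}
    (hp : pt p ∉ Lag 0 ∪ Lag m₁ ∪ Lag ((m₁ : ℤ) + m₂)) :
    s.mult (pt p) = (triPts m₁ m₂ ((k₁ : ℝ) / m₁) ((k₂ : ℝ) / m₂ + ℓ) p).ncard := by
  set u : ℝ := (k₁ : ℝ) / m₁ with hu
  set v : ℝ := (k₂ : ℝ) / m₂ + ℓ with hv
  have hint : ∀ w : Disk, s.u w = pt p → (w : ℂ) ∈ ball (0 : ℂ) 1 := by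
    intro w hw
    rw [mem_ball_zero_iff]
    refine lt_of_le_of_ne (mem_closedBall_zero_iff.1 w.2) fun h1 => hp ?_
    rw [← hw, ← h.lift]
    exact h.boundary_mem hm₁ hm₂ h1
  rw [HolTriangle.mult]
  by_cases huv : u = v
  · rw [huv, triPts_self, ncard_empty]
    convert ncard_empty Disk
    ext w
    simp only [Set.mem_ofPred_eq, mem_empty_iff_false, iff_false]
    intro hw
    refine hp (Or.inl (Or.inl ?_))
    rw [← hw, ← h.lift, h.plane.eq_const hm₁ huv _ w.2, pt_mem_Lag_iff]
    exact ⟨0, by simp⟩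
  · have hb := h.plane.bijOn hm₁ hm₂ huv
    have hi1 : InjOn (fun w : Disk => W w) {w | s.u w = pt p} := fun w hw w' hw' hww =>
      Subtype.ext (hb.injOn (hint w hw) (hint w' hw') hww)
    have hi2 : Function.Injective fun n : ℤ × ℤ => p + ((n.1 : ℝ), (n.2 : ℝ)) := by
      rintro ⟨i, j⟩ ⟨i', j'⟩ hij
      simpa using hij
    rw [← hi1.ncard_image, ← ncard_image_of_injective _ hi2]
    congr 1
    ext q
    constructor
    · rintro ⟨w, hw, rfl⟩
      have hw' : pt (W w) = pt p := (h.lift w).trans hw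
      obtain ⟨⟨i, hi⟩, j, hj⟩ := pt_eq_pt_iff.1 hw'
      have hWw : p + ((i : ℝ), (j : ℝ)) = W w := Prod.ext hi.symm hj.symm
      refine ⟨(i, j), ?_, hWw⟩
      change p + ((i : ℝ), (j : ℝ)) ∈ planeTri m₁ m₂ u v
      rw [hWw]
      exact hb.mapsTo (hint w hw)
    · rintro ⟨n, hn, rfl⟩
      obtain ⟨w, hw, hWw⟩ := hb.surjOn hn
      refine ⟨⟨w, ball_subset_closedBall hw⟩, ?_, hWw⟩
      change s.u _ = pt p
      rw [← h.lift]
      refine pt_eq_pt_iff.2 ⟨⟨n.1, ?_⟩, n.2, ?_⟩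
      · exact congrArg Prod.fst hWw
      · exact congrArg Prod.snd hWw

end Mult

end TorusFloer
end

noncomputable section
namespace TorusFloer

open Complex Set Filter Topology MeasureTheory Metric

/-! ### Convergence -/

theorem tendsto_mul_sq_cofinite {r : ℝ} (hr : 0 < r) (κ : ℝ) :
    Tendsto (fun ℓ : ℤ => r * ((ℓ : ℝ) + κ) ^ 2) cofinite atTop := by
  have h1 : Tendsto (fun ℓ : ℤ => (ℓ : ℝ) + κ) cofinite (cocompact ℝ) :=
    (Homeomorph.addRight κ).isClosedEmbedding.tendsto_cocompact.comp Int.tendsto_coe_cofinite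
  have h2 := (tendsto_norm_cocompact_atTop (E := ℝ)).comp h1
  refine ((tendsto_pow_atTop two_ne_zero).comp h2).const_mul_atTop hr |>.congr fun ℓ => ?_
  simp

/-- The function φ is the piecewise linear interpolation of s(s - 1)/2 at the integers; the gap is
f(1 - f)/2, with f the fractional part, hence at most 1/8. -/
theorem phi_bounds (s : ℝ) : s * (s - 1) / 2 ≤ phi s ∧ phi s ≤ s * (s - 1) / 2 + 1 / 8 := by
  have h1 := Int.floor_le s
  have h2 := Int.lt_floor_add_one s
  rw [phi, Int.floor_add_one]
  push_cast
  set n : ℝ := (⌊s⌋ : ℝ)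
  constructor
  · nlinarith
  · nlinarith [sq_nonneg (s - n - 1 / 2)]

/-- With s(s - 1)/2 in place of φ, λ would be exactly the Euclidean area. Only the term at E can
lower it, by at most (m₁ + m₂)/8. -/
theorem le_lam {m₁ m₂ : ℕ} (hm₁ : 0 < m₁) (u v : ℝ) :
    m₁ * m₂ / (m₁ + m₂) * (u - v) ^ 2 / 2 - (m₁ + m₂) / 8 ≤ lam m₁ m₂ u v := by
  have hM : (0 : ℝ) < m₁ + m₂ := by positivity
  have hM₁ : (0 : ℝ) ≤ m₁ := by positivity
  have hM₂ : (0 : ℝ) ≤ m₂ := by positivity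
  have h1 := mul_le_mul_of_nonneg_left (phi_bounds u).1 hM₁
  have h2 := mul_le_mul_of_nonneg_left (phi_bounds v).1 hM₂
  have h3 := mul_le_mul_of_nonneg_left (phi_bounds (Efun m₁ m₂ u v)).2 hM.le
  have key : m₁ * m₂ / (m₁ + m₂) * (u - v) ^ 2 / 2 = m₁ * (u * (u - 1) / 2) +
      m₂ * (v * (v - 1) / 2) - (m₁ + m₂) * (Efun m₁ m₂ u v * (Efun m₁ m₂ u v - 1) / 2) := by
    rw [Efun]; field_simp; ring
  rw [lam, key]
  linarith

theorem tendsto_lam {m₁ m₂ : ℕ} (hm₁ : 0 < m₁) (hm₂ : 0 < m₂) (κ₁ κ₂ : ℝ) :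
    Tendsto (fun ℓ : ℤ => lam m₁ m₂ κ₁ (κ₂ + ℓ)) cofinite atTop := by
  have hr : (0 : ℝ) < m₁ * m₂ / (m₁ + m₂) / 2 := by positivity
  refine tendsto_atTop_mono (fun ℓ => ?_)
    (tendsto_atTop_add_const_right _ (-((m₁ + m₂ : ℝ) / 8)) (tendsto_mul_sq_cofinite hr (κ₂ - κ₁)))
  refine le_trans (le_of_eq ?_) (le_lam hm₁ κ₁ (κ₂ + ℓ))
  ring

namespace Novikov

theorem tendsto_nhds_iff {ι : Type*} {l : Filter ι} {g : ι → Novikov} {a : Novikov} :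
    Tendsto g l (𝓝 a) ↔ ∀ c : ℝ, ∀ᶠ x in l, ∀ b < c,
      (g x : HahnSeries ℝ ℤ).coeff b = (a : HahnSeries ℝ ℤ).coeff b := by
  rw [nhds_iInf, tendsto_iInf]
  refine forall_congr' fun c => ?_
  let _ : TopologicalSpace (Set.Iio c → ℤ) := ⊥
  have _ : DiscreteTopology (Set.Iio c → ℤ) := ⟨rfl⟩
  rw [nhds_induced, tendsto_comap_iff, nhds_discrete, tendsto_pure]
  refine eventually_congr (Eventually.of_forall fun x => ?_)
  simp [funext_iff]

/-- A family of monomials with exponents tending to infinity is summable. -/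
theorem summable_tpow {ι : Type*} {e : ι → ℝ} (he : Tendsto e cofinite atTop) :
    Summable fun i => tpow (e i) := by
  classical
  have hfin : ∀ c : ℝ, {i | e i ≤ c}.Finite := by
    intro c
    have := (he.eventually (eventually_gt_atTop c))
    rw [eventually_cofinite] at this
    simpa using this
  have hrange : ∀ c : ℝ, (range e ∩ Iic c).Finite := by
    intro c
    refine ((hfin c).image e).subset ?_
    rintro _ ⟨⟨i, rfl⟩, hi⟩
    exact ⟨i, hi, rfl⟩
  -- A strictly descending sequence of exponents would give infinitely many below its first term.
  have hpwo : (range e).IsPWO := by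
    rw [Set.isPWO_iff_isWF, Set.isWF_iff_no_descending_seq]
    intro f hf hmem
    refine (infinite_range_of_injective hf.injective) ((hrange (f 0)).subset ?_)
    rintro _ ⟨n, rfl⟩
    exact ⟨hmem n, hf.antitone (Nat.zero_le n)⟩
  let S : HahnSeries ℝ ℤ :=
    { coeff := fun b => (({i | e i = b}.ncard : ℕ) : ℤ)
      isPWO_support' := hpwo.mono fun b hb => by
        rw [Function.mem_support, Nat.cast_ne_zero] at hb
        obtain ⟨i, hi⟩ := nonempty_of_ncard_ne_zero hb
        exact ⟨i, hi⟩ }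
  have hS : S ∈ Novikov := by
    intro c
    refine (hrange c).subset ?_
    rintro b ⟨hb, hc⟩
    refine ⟨?_, hc⟩
    have hb' : (({i | e i = b}.ncard : ℕ) : ℤ) ≠ 0 := hb
    rw [Nat.cast_ne_zero] at hb'
    obtain ⟨i, hi⟩ := nonempty_of_ncard_ne_zero hb'
    exact ⟨i, hi⟩
  refine ⟨⟨S, hS⟩, ?_⟩
  rw [HasSum, tendsto_nhds_iff]
  intro c
  rw [SummationFilter.unconditional_filter]
  filter_upwards [eventually_ge_atTop (hfin c).toFinset] with s hs b hb
  rw [AddSubmonoidClass.coe_finsetSum, HahnSeries.coeff_sum]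
  have h1 : ∀ i, (tpow (e i) : HahnSeries ℝ ℤ).coeff b = if e i = b then 1 else 0 := by
    intro i
    rw [tpow, HahnSeries.coeff_single]
    simp [eq_comm]
  simp_rw [h1]
  rw [Finset.sum_boole]
  change _ = (({i | e i = b}.ncard : ℕ) : ℤ)
  have h2 : {i | e i = b} = ((s.filter fun i => e i = b : Finset ι) : Set ι) := by
    ext i
    simp only [Set.mem_ofPred_eq, Finset.coe_filter, iff_and_self]
    intro hi
    apply hs
    rw [Set.Finite.mem_toFinset]
    exact hi.le.trans hb.le
  rw [h2, ncard_coe_finset]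

end Novikov

theorem summable_X_pow {ι : Type*} {N : ι → ℕ} (hN : ∀ d, {i | N i = d}.Finite) :
    Summable fun i => (PowerSeries.X : PowerSeries ℤ) ^ N i := by
  rw [PowerSeries.WithPiTopology.summable_iff_summable_coeff]
  intro d
  refine summable_of_hasFiniteSupport ((hN d).subset fun i hi => ?_)
  rw [Function.mem_support, PowerSeries.coeff_X_pow] at hi
  by_contra hne
  exact hi (if_neg fun h => hne h.symm)

/-! ### The triangle product -/

section Product

variable {Λ : Type} [CommRing Λ] [TopologicalSpace Λ] {𝒥 : CxStructure} {ε : ℝ}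

theorem mu2_gen {m₀ m₁ m₂ : ℤ} (wt : ∀ x : Fin 3 → Torus, Triangle 𝒥 m₀ m₁ m₂ x → Λ)
    (x₂ : ↥(Lag m₁ ∩ Lag m₂)) (x₁ : ↥(Lag m₀ ∩ Lag m₁)) (y : ↥(Lag m₀ ∩ Lag m₂)) :
    mu2 𝒥 ε m₀ m₁ m₂ wt (gen x₂ 1) (gen x₁ 1) y =
      ∑' c : Moduli 𝒥 (lags m₀ m₁ m₂) ![y, x₁, x₂], term 𝒥 ε m₀ m₁ m₂ wt _ c := by
  rw [mu2, finsum_eq_single _ x₂, finsum_eq_single _ x₁]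
  · simp [gen]
  · intro x hx
    simp [gen, Pi.single_eq_of_ne hx]
  · intro x hx
    simp [gen, Pi.single_eq_of_ne hx]

/-- The triangle product for a weight that depends only on the index of a triangle. -/
theorem hasSum_mu2 {m₁ m₂ : ℕ} (hm₁ : 0 < m₁) (hm₂ : 0 < m₂) (hε : Irrational ε) {k₁ k₂ : ℤ}
    {κ₁ κ₂ : ℝ} (hκ₁ : κ₁ = (k₁ : ℝ) / m₁) (hκ₂ : κ₂ = (k₂ : ℝ) / m₂)
    (hE : ∀ ℓ : ℤ, xPt (Efun m₁ m₂ κ₁ (κ₂ + ℓ)) ∈ Lag 0 ∩ Lag ((m₁ : ℤ) + m₂))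
    (wt : ∀ x : Fin 3 → Torus, Triangle 𝒥 0 m₁ ((m₁ : ℤ) + m₂) x → Λ) {e : ℤ → Λ}
    (hwt : ∀ (y : Torus) (s : ProductTriangle 𝒥 m₁ m₂ k₁ k₂ y) (ℓ : ℤ), HasIndex s ℓ →
      wt _ s = e ℓ)
    (he : ∀ (ι : Type) (f : ι → ℤ), Function.Injective f → Summable fun i => e (f i)) :
    (∀ y : ↥(Lag 0 ∩ Lag ((m₁ : ℤ) + m₂)),
      Summable (term 𝒥 ε 0 m₁ ((m₁ : ℤ) + m₂) wt ![y, xGen m₁ k₁, twistedGen m₁ m₂ k₂])) ∧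
    HasSum (fun ℓ : ℤ => (gen ⟨xPt (Efun m₁ m₂ κ₁ (κ₂ + ℓ)), hE ℓ⟩ (e ℓ) :
      CF Λ 0 ((m₁ : ℤ) + m₂)))
      (mu2 𝒥 ε 0 m₁ ((m₁ : ℤ) + m₂) wt (gen (twistedGen m₁ m₂ k₂) 1) (gen (xGen m₁ k₁) 1)) := by
  subst hκ₁ hκ₂
  have main : ∀ y : ↥(Lag 0 ∩ Lag ((m₁ : ℤ) + m₂)),
      ∃ f : Moduli 𝒥 (lags 0 m₁ ((m₁ : ℤ) + m₂)) ![y, xGen m₁ k₁, twistedGen m₁ m₂ k₂] → ℤ,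
        Function.Injective f ∧
        range f = {ℓ : ℤ | xPt (Efun m₁ m₂ ((k₁ : ℝ) / m₁) ((k₂ : ℝ) / m₂ + ℓ)) = y} ∧
        term 𝒥 ε 0 m₁ ((m₁ : ℤ) + m₂) wt ![y, xGen m₁ k₁, twistedGen m₁ m₂ k₂] =
          fun c => e (f c) := by
    intro y
    obtain ⟨f, hf, hi, hr⟩ := exists_index hm₁ hm₂ 𝒥 k₁ k₂ y
    refine ⟨f, hf, hr, funext fun c => ?_⟩
    rw [term, hwt _ _ _ (hi c), triSign_eq_one hm₁ hm₂ hε, one_smul]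
  have hsum : ∀ y : ↥(Lag 0 ∩ Lag ((m₁ : ℤ) + m₂)), Summable
      (term 𝒥 ε 0 m₁ ((m₁ : ℤ) + m₂) wt ![y, xGen m₁ k₁, twistedGen m₁ m₂ k₂]) := by
    intro y
    obtain ⟨f, hf, -, ht⟩ := main y
    rw [ht]
    exact he _ f hf
  refine ⟨hsum, Pi.hasSum.2 fun y => ?_⟩
  rw [mu2_gen]
  obtain ⟨f, hf, hr, ht⟩ := main y
  have h1 := (hsum y).hasSum
  have h2 : term 𝒥 ε 0 m₁ ((m₁ : ℤ) + m₂) wt ![y, xGen m₁ k₁, twistedGen m₁ m₂ k₂] =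
      (fun ℓ : ℤ => (gen ⟨xPt (Efun m₁ m₂ ((k₁ : ℝ) / m₁) ((k₂ : ℝ) / m₂ + ℓ)), hE ℓ⟩ (e ℓ) :
        CF Λ 0 ((m₁ : ℤ) + m₂)) y) ∘ f := by
    rw [ht]
    funext c
    have hc : xPt (Efun m₁ m₂ ((k₁ : ℝ) / m₁) ((k₂ : ℝ) / m₂ + f c)) = y := by
      have : f c ∈ range f := mem_range_self c
      rwa [hr] at this
    have hc' : (⟨_, hE (f c)⟩ : ↥(Lag 0 ∩ Lag ((m₁ : ℤ) + m₂))) = y := Subtype.ext hc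
    rw [Function.comp_apply, gen, hc', Pi.single_eq_same]
  -- The classes with output y correspond to the indices whose vertex represents y; every other ℓ
  -- contributes 0 to the coefficient of y. The sum over the moduli space is thus a sum over all of
  -- ℤ.
  refine (hf.hasSum_iff fun ℓ hℓ => ?_).1 (h2 ▸ h1)
  rw [gen, Pi.single_eq_of_ne]
  rintro rfl
  exact hℓ (by rw [hr]; rfl)

end Product

theorem xPt_Efun_mem {m₁ m₂ : ℕ} (hm₁ : 0 < m₁) (hm₂ : 0 < m₂) (k₁ k₂ ℓ : ℤ) :
    xPt (Efun m₁ m₂ ((k₁ : ℝ) / m₁) ((k₂ : ℝ) / m₂ + ℓ)) ∈ Lag 0 ∩ Lag ((m₁ : ℤ) + m₂) := by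
  refine xPt_mem _ _ ⟨k₁ + (k₂ + m₂ * ℓ), ?_⟩
  push_cast
  rw [mul_Efun hm₁]
  field_simp

theorem pt_notMem_Lag {p : ℝ × ℝ} {m : ℤ} (h0 : 0 < p.2 + m * p.1) (h1 : p.2 + m * p.1 < 1) :
    pt p ∉ Lag m := by
  rw [pt_mem_Lag_iff]
  rintro ⟨n, hn⟩
  rw [hn] at h0 h1
  have h0' : 0 < n := by exact_mod_cast h0
  have h1' : n < 1 := by exact_mod_cast h1
  omega

end TorusFloer
end

/-! ### The product formulas -/

open TorusFloer Topology in
theorem mainTheorem4 (𝒥 : CxStructure) (ε : ℝ) (hε : Irrational ε)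
    (m₁ m₂ : ℕ) (hm₁ : 0 < m₁) (hm₂ : 0 < m₂) (k₁ k₂ : ℕ) (hk₁ : k₁ < m₁) (hk₂ : k₂ < m₂)
    (κ₁ κ₂ : ℝ) (hκ₁ : κ₁ = (k₁ : ℝ) / (m₁ : ℝ)) (hκ₂ : κ₂ = (k₂ : ℝ) / (m₂ : ℝ)) :
    -- every `E(κ₁, κ₂ + ℓ)` is the index of an intersection point of `Lag 0` and `Lag (m₁ + m₂)`
    ∃ hE : ∀ ℓ : ℤ, xPt (Efun m₁ m₂ κ₁ (κ₂ + ℓ)) ∈ Lag 0 ∩ Lag ((m₁ : ℤ) + m₂),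
      -- all signs are `+1`
      (∀ (y : Torus)
        (s : Triangle 𝒥 0 m₁ ((m₁ : ℤ) + m₂) ![y, xGen m₁ k₁, twistedGen m₁ m₂ k₂]),
        triSign 0 m₁ ((m₁ : ℤ) + m₂) ε s = 1) ∧
      -- the absolute setting
      ((∀ y : ↥(Lag 0 ∩ Lag ((m₁ : ℤ) + m₂)),
          Summable (term 𝒥 ε 0 m₁ ((m₁ : ℤ) + m₂) (absWeight 𝒥 0 m₁ ((m₁ : ℤ) + m₂))
            ![y, xGen m₁ k₁, twistedGen m₁ m₂ k₂])) ∧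
        HasSum
          (fun ℓ : ℤ => (gen ⟨xPt (Efun m₁ m₂ κ₁ (κ₂ + ℓ)), hE ℓ⟩
            (tpow (((ℓ : ℝ) + κ₂ - κ₁) ^ 2 / (2 * (1 / (m₁ : ℝ) + 1 / (m₂ : ℝ))))) :
              CF Novikov 0 ((m₁ : ℤ) + m₂)))
          (mu2 𝒥 ε 0 m₁ ((m₁ : ℤ) + m₂) (absWeight 𝒥 0 m₁ ((m₁ : ℤ) + m₂))
            (gen (twistedGen m₁ m₂ k₂) 1) (gen (xGen m₁ k₁) 1))) ∧
      -- the relative setting, for `D` in the first quadrant and close to `(0, 0)`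
      ∃ N : ℤ → ℕ, (∀ ℓ : ℤ, (N ℓ : ℝ) = lam m₁ m₂ κ₁ (κ₂ + ℓ)) ∧
        ∀ᶠ p : ℝ × ℝ in 𝓝[Set.Ioi 0 ×ˢ Set.Ioi 0] (0, 0),
          pt p ∉ Lag 0 ∪ Lag m₁ ∪ Lag ((m₁ : ℤ) + m₂) ∧
          (∀ y : ↥(Lag 0 ∩ Lag ((m₁ : ℤ) + m₂)),
            Summable (term 𝒥 ε 0 m₁ ((m₁ : ℤ) + m₂) (relWeight 𝒥 (pt p) 0 m₁ ((m₁ : ℤ) + m₂))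
              ![y, xGen m₁ k₁, twistedGen m₁ m₂ k₂])) ∧
          HasSum
            (fun ℓ : ℤ => (gen ⟨xPt (Efun m₁ m₂ κ₁ (κ₂ + ℓ)), hE ℓ⟩
              (PowerSeries.X ^ N ℓ) : CF (PowerSeries ℤ) 0 ((m₁ : ℤ) + m₂)))
            (mu2 𝒥 ε 0 m₁ ((m₁ : ℤ) + m₂) (relWeight 𝒥 (pt p) 0 m₁ ((m₁ : ℤ) + m₂))
              (gen (twistedGen m₁ m₂ k₂) 1) (gen (xGen m₁ k₁) 1)) := by
  have hc₁ : κ₁ = ((k₁ : ℤ) : ℝ) / m₁ := by rw [hκ₁, Int.cast_natCast]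
  have hc₂ : κ₂ = ((k₂ : ℤ) : ℝ) / m₂ := by rw [hκ₂, Int.cast_natCast]
  have hM₁ : (0 : ℝ) < m₁ := by exact_mod_cast hm₁
  have hM₂ : (0 : ℝ) < m₂ := by exact_mod_cast hm₂
  have hu : (m₁ : ℝ) * κ₁ = ((k₁ : ℤ) : ℝ) := by rw [hc₁]; field_simp
  have hv : ∀ ℓ : ℤ, (m₂ : ℝ) * (κ₂ + ℓ) = ((k₂ + m₂ * ℓ : ℤ) : ℝ) := by
    intro ℓ; rw [hc₂]; push_cast; field_simp
  have hE : ∀ ℓ : ℤ, xPt (Efun m₁ m₂ κ₁ (κ₂ + ℓ)) ∈ Lag 0 ∩ Lag ((m₁ : ℤ) + m₂) := by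
    intro ℓ; rw [hc₁, hc₂]; exact xPt_Efun_mem hm₁ hm₂ k₁ k₂ ℓ
  refine ⟨hE, fun y s => triSign_eq_one hm₁ hm₂ hε s,
    hasSum_mu2 hm₁ hm₂ hε hc₁ hc₂ hE _ ?_ ?_, ?_⟩
  · intro y s ℓ hs
    obtain ⟨a, b, c, W, h⟩ := hs.exists_isNormalized hm₁ hm₂
    rw [absWeight, h.area_eq hm₁ hm₂, ← hc₁, ← hc₂]
    congr 1
    field_simp
    ring
  · intro ι f hf
    have hr : (0 : ℝ) < 1 / (2 * (1 / (m₁ : ℝ) + 1 / (m₂ : ℝ))) := by positivity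
    have ht : Filter.Tendsto
        (fun ℓ : ℤ => ((ℓ : ℝ) + κ₂ - κ₁) ^ 2 / (2 * (1 / (m₁ : ℝ) + 1 / (m₂ : ℝ))))
        Filter.cofinite Filter.atTop :=
      (tendsto_mul_sq_cofinite hr (κ₂ - κ₁)).congr fun ℓ => by ring
    exact Novikov.summable_tpow (ht.comp hf.tendsto_cofinite)
  · have hN : ∀ ℓ : ℤ, ∃ n : ℕ, (n : ℝ) = lam m₁ m₂ κ₁ (κ₂ + ℓ) := by
      intro ℓ
      -- That λ is a nonnegative integer follows from its being a number of lattice points. Any test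
      -- point in the allowed region will do; this one has y + (m₁ + m₂)x = 3/4.
      refine ⟨_, ncard_triPts (p := (1 / (2 * (m₁ + m₂)), 1 / 4)) hm₁ hm₂ hu (hv ℓ) ?_ ?_ ?_⟩
      · simp only; positivity
      · norm_num
      · have : ((m₁ : ℝ) + m₂) * (1 / (2 * (m₁ + m₂))) = 1 / 2 := by field_simp
        simp only [this]
        norm_num
    choose N hN using hN
    refine ⟨N, hN, ?_⟩
    have hcont : Continuous fun p : ℝ × ℝ => p.2 + (m₁ + m₂) * p.1 := by fun_prop
    -- This bound is the only closeness condition on D. It does not involve ℓ, so one neighbourhood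
    -- serves for all triangles simultaneously.
    have hlt : ∀ᶠ p : ℝ × ℝ in 𝓝 (0, 0), p.2 + (m₁ + m₂) * p.1 < 1 :=
      hcont.tendsto (0, 0) |>.eventually_lt_const (by simp)
    filter_upwards [self_mem_nhdsWithin, nhdsWithin_le_nhds hlt] with p hp h3
    obtain ⟨h1, h2⟩ : 0 < p.1 ∧ 0 < p.2 := hp
    have q1 : 0 < m₁ * p.1 := mul_pos hM₁ h1
    have q2 : 0 < m₂ * p.1 := mul_pos hM₂ h1
    have hp' : pt p ∉ Lag 0 ∪ Lag m₁ ∪ Lag ((m₁ : ℤ) + m₂) := by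
      rintro ((h | h) | h)
      · exact pt_notMem_Lag (by push_cast; linarith) (by push_cast; linarith) h
      · exact pt_notMem_Lag (by push_cast; linarith) (by push_cast; linarith) h
      · exact pt_notMem_Lag (by push_cast; linarith) (by push_cast; linarith) h
    refine ⟨hp', hasSum_mu2 hm₁ hm₂ hε hc₁ hc₂ hE _ ?_ ?_⟩
    · intro y s ℓ hs
      obtain ⟨a, b, c, W, h⟩ := hs.exists_isNormalized hm₁ hm₂
      have hcount := ncard_triPts hm₁ hm₂ hu (hv ℓ) h1 h2 h3
      rw [← hN ℓ, Nat.cast_inj] at hcount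
      rw [relWeight, h.mult_eq hm₁ hm₂ hp', ← hc₁, ← hc₂, hcount]
    · intro ι f hf
      refine summable_X_pow fun d => ?_
      have ht := (tendsto_lam hm₁ hm₂ κ₁ κ₂).comp hf.tendsto_cofinite
      have hev := ht.eventually (Filter.eventually_gt_atTop (d : ℝ))
      rw [Filter.eventually_cofinite] at hev
      refine hev.subset fun i hi => ?_
      have hi' : N (f i) = d := hi
      simp only [Set.mem_ofPred_eq, Function.comp_apply, ← hN, hi', lt_irrefl, not_false_eq_true]
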